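/- **Theorem (control on vertical strips).** Let $L>0$, let $\Omega_y$ be $(0,\pi)$, $\mathbb S^1=\mathbb R/2\pi\mathbb Z$ or $\mathbb R$, and let $\Omega=(-L,L)\times\Omega_y$. Let $\gamma\ge 1$ be an integer and let $q\in C^\infty([-L,L])$ satisfy $q^{(k)}(0)=0$ for $0\le k\le\gamma-1$, $q^{(\gamma)}(0)>0$, and $q(x)\ne0$ for every $x\ne0$. Let $r\in C^\infty(\Omega_y)$ with $r>0$, and $r\equiv1$ if $\Omega_y=\mathbb R$. Let $V\in L^\infty(-L,L)$ be a function of $x$ alone. All functions are real-valued. Let $G_V=-\partial_x^2-q(x)^2\partial_y(r(y)^2\partial_y)+V(x)$ be the Friedrichs extension on $L^2(\Omega)$ of this operator defined on $C_c^\infty(\Omega)$. Its form domain $D(G_V^{1/2})\subset L^2(\Omega)$ is the completion of $C_c^\infty(\Omega)$ for the norm with square $\int_\Omega |\partial_xf|^2+q^2r^2|\partial_yf|^2+(V+c)|f|^2\,dx\,dy$, where $c$ is a sufficiently large constant; it does not depend on $c$ (nor on $V$). Let $\tilde\omega=\tilde\omega_x\times\Omega_y$, where $\tilde\omega_x\subset(-L,L)$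 is a nonempty measurable set with $\operatorname{dist}(\tilde\omega_x,0)>0$. For $T>0$ consider the control system $$\partial_tf-\partial_x^2f-q(x)^2\partial_y(r(y)^2\partial_yf)+V(x)f=u\,\mathbf 1_{\tilde\omega}\ \text{ in }(0,T)\times\Omega,\qquad f=0\ \text{ on }(0,T)\times\partial\Omega,\qquad f(0)=f_0,$$ with $u\in L^2((0,T)\times\tilde\omega)$, whose solution is understood as the weak solution $f\in C^0([0,T],L^2(\Omega))\cap L^2((0,T),D(G_V^{1/2}))$. Say that $f_0$ can be steered to $0$ in time $T$ if for some $u\in L^2((0,T)\times\tilde\omega)$ the solution satisfies $f(T)=0$. Put $$d_{\mathrm{agm}}(x)=\int_{\min(0,x)}^{\max(0,x)}|q(s)|\,ds,\qquad d_{\mathrm{agm}}(\tilde\omega_x)=\inf_{x\in\tilde\omega_x}d_{\mathrm{agm}}(x).$$ (i) If $\gamma=1$, then for every $T>0$ with $T<d_{\mathrm{agm}}(\tilde\omega_x)/q'(0)$ there is $f_0\in D(G_V^{1/2})$ that cannot be steered to $0$ in time $T$. (ii) If $\gamma>1$, then for every $T>0$ there is $f_0\in D(G_V^{1/2})$ that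 cannot be steered to $0$ in time $T$. -/

import Mathlib

open MeasureTheory Set

namespace Grushin

/-- The three possible transversal domains `Ω_y`: the interval `(0, π)`, the circle `𝕊¹ = ℝ / 2πℤ`
and the line `ℝ`. Functions on the circle are represented by `2π`-periodic functions on `ℝ`
(up to null sets: functions on the fundamental domain `[0, 2π)`). -/
inductive YDomain where
  | interval
  | circle
  | line

/-- The points of `Ω_y`, as a subset of `ℝ` (a fundamental domain in the case of the circle). -/
def YDomain.carrier : YDomain → Set ℝ
  | .interval => Ioo 0 Real.pi
  | .circle => Ico 0 (2 * Real.pi)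
  | .line => univ

/-- `Ω = (-L, L) × Ω_y`. -/
def domain (L : ℝ) (Y : YDomain) : Set (ℝ × ℝ) := Ioo (-L) L ×ˢ Y.carrier

/-- The Lebesgue measure `dx dy` on `Ω`. -/
noncomputable def meas (L : ℝ) (Y : YDomain) : Measure (ℝ × ℝ) := volume.restrict (domain L Y)

/-- The real Hilbert space `L²(Ω)`. -/
noncomputable abbrev L2 (L : ℝ) (Y : YDomain) := Lp ℝ 2 (meas L Y)

/-- The assumption on `q`: it is smooth on `[-L, L]`, vanishes at `0` exactly to order `γ`, with
positive `γ`-th derivative there, and has no other zero. -/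
structure IsGrushinCoeff (L : ℝ) (γ : ℕ) (q : ℝ → ℝ) : Prop where
  smooth : ContDiffOn ℝ ((⊤ : ℕ∞) : WithTop ℕ∞) q (Icc (-L) L)
  deriv_zero : ∀ k < γ, iteratedDeriv k q 0 = 0
  deriv_pos : 0 < iteratedDeriv γ q 0
  ne_zero : ∀ x ∈ Icc (-L) L, x ≠ 0 → q x ≠ 0

/-- The assumption on `r`: smooth and positive on `Ω_y`, and identically one if `Ω_y = ℝ`. -/
def IsTransversalCoeff : YDomain → (ℝ → ℝ) → Prop
  | .interval, r => ContDiffOn ℝ ((⊤ : ℕ∞) : WithTop ℕ∞) r (Ioo 0 Real.pi) ∧ ∀ y ∈ Ioo 0 Real.pi, 0 < r y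
  | .circle, r => ContDiff ℝ ((⊤ : ℕ∞) : WithTop ℕ∞) r ∧ Function.Periodic r (2 * Real.pi) ∧ ∀ y, 0 < r y
  | .line, r => ∀ y, r y = 1

/-- The test functions `C_c^∞(Ω)`. On the circle these are the smooth functions that are
`2π`-periodic in `y` and vanish for `x` near `±L`. -/
def IsTest (L : ℝ) : YDomain → (ℝ × ℝ → ℝ) → Prop
  | .interval, φ =>
      ContDiff ℝ ((⊤ : ℕ∞) : WithTop ℕ∞) φ ∧ HasCompactSupport φ ∧ tsupport φ ⊆ Ioo (-L) L ×ˢ Ioo 0 Real.pi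
  | .circle, φ =>
      ContDiff ℝ ((⊤ : ℕ∞) : WithTop ℕ∞) φ ∧ (∀ x y, φ (x, y + 2 * Real.pi) = φ (x, y)) ∧
        ∃ a < L, ∀ x y, a ≤ |x| → φ (x, y) = 0
  | .line, φ =>
      ContDiff ℝ ((⊤ : ℕ∞) : WithTop ℕ∞) φ ∧ HasCompactSupport φ ∧ tsupport φ ⊆ Ioo (-L) L ×ˢ univ

/-- `∂_x φ`. -/
noncomputable def dx (φ : ℝ × ℝ → ℝ) (z : ℝ × ℝ) : ℝ := deriv (fun x => φ (x, z.2)) z.1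

/-- `q(x) r(y) ∂_y φ`. -/
noncomputable def dY (q r : ℝ → ℝ) (φ : ℝ × ℝ → ℝ) (z : ℝ × ℝ) : ℝ :=
  q z.1 * r z.2 * deriv (fun y => φ (z.1, y)) z.2

/-- The closure in `L²(Ω)³` of the set of triples `(φ, ∂_x φ, q r ∂_y φ)` with `φ ∈ C_c^∞(Ω)`. A
triple `(f, g, h)` in it consists of an element `f` of the completion of `C_c^∞(Ω)` for the norm
`(‖φ‖² + ‖∂_x φ‖² + ‖q r ∂_y φ‖²)^{1/2}` and of its weak derivatives `g = ∂_x f`,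
`h = q r ∂_y f`. -/
def formGraph (L : ℝ) (Y : YDomain) (q r : ℝ → ℝ) : Set (L2 L Y × L2 L Y × L2 L Y) :=
  closure {p | ∃ φ, IsTest L Y φ ∧ p.1 =ᵐ[meas L Y] φ ∧ p.2.1 =ᵐ[meas L Y] dx φ ∧
    p.2.2 =ᵐ[meas L Y] dY q r φ}

/-- The form domain `D(G_V^{1/2})` of the Friedrichs extension of
`G_V = -∂_x² - q² ∂_y (r² ∂_y) + V`, as a subset of `L²(Ω)`. For bounded `V`, the form
`∫ |∂_x φ|² + q² r² |∂_y φ|² + V |φ|²`, shifted by a large multiple of `‖φ‖²` so as to be positive,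
defines a norm equivalent to the one in `formGraph`; the form domain does not depend on `V`. -/
def formDomain (L : ℝ) (Y : YDomain) (q r : ℝ → ℝ) : Set (L2 L Y) :=
  {f | ∃ g h, (f, g, h) ∈ formGraph L Y q r}

/-- `f ∈ C⁰([0,T], L²(Ω)) ∩ L²((0,T), D(G_V^{1/2}))` is the (weak) solution of
`∂_t f - ∂_x² f - q² ∂_y (r² ∂_y f) + V(x) f = u 𝟙_W` on `(0,T) × Ω`, with Dirichlet boundary
condition and with `f(0) = f₀`. -/
def IsSolution (L : ℝ) (Y : YDomain) (q r V : ℝ → ℝ) (W : Set (ℝ × ℝ)) (T : ℝ)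
    (f₀ : L2 L Y) (u : ℝ × (ℝ × ℝ) → ℝ) (f : ℝ → L2 L Y) : Prop :=
  ContinuousOn f (Icc 0 T) ∧ f 0 = f₀ ∧
  ∃ g h : ℝ → L2 L Y,
    MemLp g 2 (volume.restrict (Ioo 0 T)) ∧ MemLp h 2 (volume.restrict (Ioo 0 T)) ∧
    (∀ᵐ t ∂volume.restrict (Ioo 0 T), (f t, g t, h t) ∈ formGraph L Y q r) ∧
    ∀ φ, IsTest L Y φ → ∀ t ∈ Icc 0 T,
      (∫ z, f t z * φ z ∂meas L Y) +
        (∫ s in Ioo 0 t, ∫ z, (g s z * dx φ z + h s z * dY q r φ z + V z.1 * f s z * φ z)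
          ∂meas L Y)
      = (∫ z, f₀ z * φ z ∂meas L Y) +
        ∫ s in Ioo 0 t, ∫ z in W, u (s, z) * φ z ∂meas L Y

/-- The initial state `f₀` can be steered to `0` in time `T` by a control in
`L²((0,T) × W)`. -/
def Steerable (L : ℝ) (Y : YDomain) (q r V : ℝ → ℝ) (W : Set (ℝ × ℝ)) (T : ℝ)
    (f₀ : L2 L Y) : Prop :=
  ∃ u : ℝ × (ℝ × ℝ) → ℝ,
    MemLp u 2 ((volume.restrict (Ioo 0 T)).prod ((meas L Y).restrict W)) ∧
    ∃ f : ℝ → L2 L Y, IsSolution L Y q r V W T f₀ u f ∧ f T = 0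

/-- The Agmon distance of `x` to `0`. -/
noncomputable def agmonDist (q : ℝ → ℝ) (x : ℝ) : ℝ := ∫ s in (min 0 x)..(max 0 x), |q s|

/-- The Agmon distance of a nonempty set to `0`. -/
noncomputable def agmonDistSet (q : ℝ → ℝ) (A : Set ℝ) : ℝ := sInf (agmonDist q '' A)

end Grushin

/-!
If every state of the form domain could be steered to `0`, then, by duality and the uniform
boundedness principle, every approximate eigenfunction `F` of `G_V`, with approximate eigenvalue
`l`, would satisfy `‖F‖² ≤ K c (1 + ‖F‖² + ‖∂_x F‖² + ‖q r ∂_y F‖²)`, where `c` is `e^{|l| T}` times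
the sum of the precision of `F` and of the `L²` norm of `F` on the control region. This is violated
by products `F(x, y) = φ(x) ψ(y)`, in which `ψ` is an approximate eigenfunction of
`-∂_y (r² ∂_y)` at the energy `μ²` and `φ` an approximate ground state of `-∂_x² + V + μ² q²`:

* a Gaussian trial function shows that the ground state energy is at most `b μ + C`, for every
  `b > |q'(0)|`;
* Agmon's exponentially weighted estimates bound `φ` by `e^{-μ d'}` on the control region, for every
  `d'` less than the Agmon distance of this region to the origin.

The precision may be taken as small as `e^{-μ d'}`, so that `c = O(μ e^{-μ (d' - b T)})`, whereas
the energy of `F` is `O(μ²)`. As `μ → ∞` this is a contradiction when `b T < d'`. Working with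
approximate eigenfunctions instead of eigenfunctions allows `Ω_y = ℝ`, where the transversal
operator has no eigenfunction.
-/

namespace Grushin

open Filter Topology
open scoped ContDiff RealInnerProductSpace InnerProductSpace

/-! ### Test functions -/

/-- Lebesgue measure on `(-L, L)`. -/
noncomputable abbrev measX (L : ℝ) : Measure ℝ := volume.restrict (Ioo (-L) L)

/-- Lebesgue measure on `Ω_y`. -/
noncomputable abbrev measY (Y : YDomain) : Measure ℝ := volume.restrict Y.carrier

theorem meas_eq_prod (L : ℝ) (Y : YDomain) : meas L Y = (measX L).prod (measY Y) := by
  rw [meas, domain, Measure.prod_restrict, Measure.volume_eq_prod]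

/-- Test functions on `(-L, L)`. -/
structure IsTestX (L : ℝ) (φ : ℝ → ℝ) : Prop where
  smooth : ContDiff ℝ ∞ φ
  vanish : ∃ a < L, ∀ x, a ≤ |x| → φ x = 0

/-- Test functions on `Ω_y`; on the circle, these are the smooth `2π`-periodic functions. -/
def IsTestY : YDomain → (ℝ → ℝ) → Prop
  | .interval, ψ => ContDiff ℝ ∞ ψ ∧ HasCompactSupport ψ ∧ tsupport ψ ⊆ Ioo 0 Real.pi
  | .circle, ψ => ContDiff ℝ ∞ ψ ∧ Function.Periodic ψ (2 * Real.pi)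
  | .line, ψ => ContDiff ℝ ∞ ψ ∧ HasCompactSupport ψ

/-- The product `φ(x) ψ(y)` of a function of `x` and a function of `y`. -/
def tensor (φ ψ : ℝ → ℝ) (z : ℝ × ℝ) : ℝ := φ z.1 * ψ z.2

section Support

theorem contDiff_mul_of_tsupport_subset {U : Set ℝ} (hU : IsOpen U) {m φ : ℝ → ℝ}
    (hm : ContDiffOn ℝ ∞ m U) (hφ : ContDiff ℝ ∞ φ) (hs : tsupport φ ⊆ U) :
    ContDiff ℝ ∞ (fun x => m x * φ x) := by
  refine contDiff_iff_contDiffAt.2 fun x => ?_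
  by_cases hx : x ∈ tsupport φ
  · exact (hm.contDiffAt (hU.mem_nhds (hs hx))).mul hφ.contDiffAt
  · refine contDiffAt_const (c := (0 : ℝ)) |>.congr_of_eventuallyEq ?_
    filter_upwards [notMem_tsupport_iff_eventuallyEq.1 hx] with y hy
    simp [hy]

theorem tsupport_tensor_subset (φ ψ : ℝ → ℝ) :
    tsupport (tensor φ ψ) ⊆ tsupport φ ×ˢ tsupport ψ :=
  closure_minimal (fun _ hz => ⟨subset_tsupport _ (left_ne_zero_of_mul hz),
    subset_tsupport _ (right_ne_zero_of_mul hz)⟩)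
    ((isClosed_tsupport φ).prod (isClosed_tsupport ψ))

theorem hasCompactSupport_tensor {φ ψ : ℝ → ℝ} (hφ : HasCompactSupport φ)
    (hψ : HasCompactSupport ψ) : HasCompactSupport (tensor φ ψ) :=
  (hφ.isCompact.prod hψ.isCompact).of_isClosed_subset (isClosed_tsupport _)
    (tsupport_tensor_subset φ ψ)

theorem exists_lt_forall_eq_zero_of_tsupport_subset {L : ℝ} (hL : 0 < L) {F : ℝ × ℝ → ℝ}
    (hc : HasCompactSupport F) (hs : tsupport F ⊆ Ioo (-L) L ×ˢ univ) :
    ∃ a < L, ∀ x y, a ≤ |x| → F (x, y) = 0 := by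
  rcases (tsupport F).eq_empty_or_nonempty with hempty | hne
  · exact ⟨0, hL, fun x y _ => image_eq_zero_of_notMem_tsupport (by simp [hempty])⟩
  · obtain ⟨z, hz, hmax⟩ := hc.isCompact.exists_isMaxOn hne
      (f := fun z : ℝ × ℝ => |z.1|) (by fun_prop)
    have hzL : |z.1| < L := abs_lt.2 (hs hz).1
    refine ⟨(|z.1| + L) / 2, by linarith, fun x y hx =>
      image_eq_zero_of_notMem_tsupport fun hxy => ?_⟩
    have : |x| ≤ |z.1| := hmax hxy
    linarith

theorem hasCompactSupport_slice {F : ℝ × ℝ → ℝ} (hc : HasCompactSupport F) (x : ℝ) :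
    HasCompactSupport (fun y => F (x, y)) :=
  HasCompactSupport.of_support_subset_isCompact (hc.isCompact.image continuous_snd)
    fun y hy => ⟨(x, y), subset_tsupport F hy, rfl⟩

end Support

namespace IsTestX

variable {L : ℝ} {φ χ : ℝ → ℝ}

theorem tsupport_subset (hφ : IsTestX L φ) : tsupport φ ⊆ Ioo (-L) L := by
  obtain ⟨a, haL, hvanish⟩ := hφ.vanish
  have hsupport : Function.support φ ⊆ Icc (-a) a := fun x hx =>
    abs_le.1 (not_le.1 fun hax => hx (hvanish x hax)).le
  exact (closure_minimal hsupport isClosed_Icc).trans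
    (Icc_subset_Ioo (neg_lt_neg haL) haL)

theorem hasCompactSupport (hφ : IsTestX L φ) : HasCompactSupport φ :=
  HasCompactSupport.of_support_subset_isCompact (isCompact_Icc (a := -L) (b := L))
    ((subset_tsupport φ).trans (hφ.tsupport_subset.trans Ioo_subset_Icc_self))

theorem continuous (hφ : IsTestX L φ) : Continuous φ := hφ.smooth.continuous

theorem continuous_deriv (hφ : IsTestX L φ) : Continuous (deriv φ) :=
  hφ.smooth.continuous_deriv (by simp)

theorem differentiable (hφ : IsTestX L φ) : Differentiable ℝ φ :=
  hφ.smooth.differentiable (by simp)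

theorem zero (L : ℝ) : IsTestX L 0 := ⟨contDiff_const, L - 1, sub_one_lt L, fun _ _ => rfl⟩

theorem add (hφ : IsTestX L φ) (hχ : IsTestX L χ) : IsTestX L (φ + χ) := by
  obtain ⟨a, ha, hφa⟩ := hφ.vanish
  obtain ⟨b, hb, hχb⟩ := hχ.vanish
  refine ⟨hφ.smooth.add hχ.smooth, max a b, max_lt ha hb, fun x hx => ?_⟩
  simp [hφa x (le_of_max_le_left hx), hχb x (le_of_max_le_right hx)]

theorem const_smul (c : ℝ) (hφ : IsTestX L φ) : IsTestX L (c • φ) := by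
  obtain ⟨a, ha, hφa⟩ := hφ.vanish
  exact ⟨hφ.smooth.const_smul c, a, ha, fun x hx => by simp [hφa x hx]⟩

theorem mul_left {m : ℝ → ℝ} (hm : ContDiffOn ℝ ∞ m (Ioo (-L) L)) (hφ : IsTestX L φ) :
    IsTestX L (fun x => m x * φ x) := by
  obtain ⟨a, ha, hφa⟩ := hφ.vanish
  exact ⟨contDiff_mul_of_tsupport_subset isOpen_Ioo hm hφ.smooth hφ.tsupport_subset, a, ha,
    fun x hx => by simp [hφa x hx]⟩

theorem memLp (hφ : IsTestX L φ) (p : ENNReal) : MemLp φ p (measX L) :=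
  (hφ.continuous.memLp_of_hasCompactSupport hφ.hasCompactSupport).restrict _

theorem memLp_deriv (hφ : IsTestX L φ) (p : ENNReal) : MemLp (deriv φ) p (measX L) :=
  (hφ.continuous_deriv.memLp_of_hasCompactSupport hφ.hasCompactSupport.deriv).restrict _

end IsTestX

/-- The vector space of test functions on `(-L, L)`. -/
def testX (L : ℝ) : Submodule ℝ (ℝ → ℝ) where
  carrier := {φ | IsTestX L φ}
  zero_mem' := IsTestX.zero L
  add_mem' := IsTestX.add
  smul_mem' c _ := IsTestX.const_smul c

theorem memLp_circle_of_continuous {f : ℝ → ℝ} (hf : Continuous f) :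
    MemLp f 2 (measY .circle) := by
  obtain ⟨C, hC⟩ := (isCompact_Icc (a := (0 : ℝ)) (b := 2 * Real.pi)).exists_bound_of_continuousOn
    hf.continuousOn
  have : IsFiniteMeasure (measY .circle) :=
    ⟨by rw [Measure.restrict_apply_univ]; exact measure_Ico_lt_top⟩
  exact .of_bound hf.aestronglyMeasurable C <| (ae_restrict_iff' measurableSet_Ico).2 <|
    .of_forall fun y hy => hC y (Ico_subset_Icc_self hy)

namespace IsTestY

variable {Y : YDomain} {ψ χ : ℝ → ℝ}

theorem smooth (hψ : IsTestY Y ψ) : ContDiff ℝ ∞ ψ := by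
  cases Y <;> exact hψ.1

theorem continuous_deriv (hψ : IsTestY Y ψ) : Continuous (deriv ψ) :=
  hψ.smooth.continuous_deriv (by simp)

theorem zero (Y : YDomain) : IsTestY Y 0 :=
  match Y with
  | .interval => ⟨contDiff_const, .zero, by simp [tsupport]⟩
  | .circle => ⟨contDiff_const, fun _ => rfl⟩
  | .line => ⟨contDiff_const, .zero⟩

theorem add (hψ : IsTestY Y ψ) (hχ : IsTestY Y χ) : IsTestY Y (ψ + χ) :=
  match Y, hψ, hχ with
  | .interval, hψ, hχ => ⟨hψ.1.add hχ.1, hψ.2.1.add hχ.2.1,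
      (tsupport_add ψ χ).trans (union_subset hψ.2.2 hχ.2.2)⟩
  | .circle, hψ, hχ => ⟨hψ.1.add hχ.1, hψ.2.add hχ.2⟩
  | .line, hψ, hχ => ⟨hψ.1.add hχ.1, hψ.2.add hχ.2⟩

theorem const_smul (c : ℝ) (hψ : IsTestY Y ψ) : IsTestY Y (c • ψ) :=
  have hs : tsupport (c • ψ) ⊆ tsupport ψ := closure_mono (Function.support_const_smul_subset c ψ)
  match Y, hψ with
  | .interval, hψ => ⟨hψ.1.const_smul c, hψ.2.1.mono (Function.support_const_smul_subset c ψ),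
      hs.trans hψ.2.2⟩
  | .circle, hψ => ⟨hψ.1.const_smul c, fun y => by simp [hψ.2 y]⟩
  | .line, hψ => ⟨hψ.1.const_smul c, hψ.2.mono (Function.support_const_smul_subset c ψ)⟩

theorem memLp (hψ : IsTestY Y ψ) : MemLp ψ 2 (measY Y) :=
  match Y, hψ with
  | .interval, hψ => (hψ.1.continuous.memLp_of_hasCompactSupport hψ.2.1).restrict _
  | .circle, hψ => memLp_circle_of_continuous hψ.1.continuous
  | .line, hψ => (hψ.1.continuous.memLp_of_hasCompactSupport hψ.2).restrict _

theorem memLp_coeff_mul_deriv {r : ℝ → ℝ} (hr : IsTransversalCoeff Y r) (hψ : IsTestY Y ψ) :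
    MemLp (fun y => r y * deriv ψ y) 2 (measY Y) :=
  match Y, hr, hψ with
  | .interval, hr, hψ => by
      have hsupport : tsupport (fun y => r y * deriv ψ y) ⊆ Ioo 0 Real.pi :=
        (tsupport_mul_subset_right.trans tsupport_deriv_subset).trans hψ.2.2
      have hcont : Continuous fun y => r y * deriv ψ y :=
        (hr.1.continuousOn.mul (hψ.1.continuous_deriv (by simp)).continuousOn)
          |>.continuous_of_tsupport_subset isOpen_Ioo hsupport
      exact (hcont.memLp_of_hasCompactSupport hψ.2.1.deriv.mul_left).restrict _
  | .circle, hr, hψ => memLp_circle_of_continuous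
      (hr.1.continuous.mul (hψ.1.continuous_deriv (by simp)))
  | .line, hr, hψ => by
      simpa only [hr _, one_mul] using
        ((hψ.1.continuous_deriv (by simp)).memLp_of_hasCompactSupport hψ.2.deriv).restrict _

end IsTestY

/-- The vector space of test functions on `Ω_y`. -/
def testY (Y : YDomain) : Submodule ℝ (ℝ → ℝ) where
  carrier := {ψ | IsTestY Y ψ}
  zero_mem' := IsTestY.zero Y
  add_mem' := IsTestY.add
  smul_mem' c _ := IsTestY.const_smul c

namespace IsTest

variable {L : ℝ} {Y : YDomain} {F G : ℝ × ℝ → ℝ}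

theorem smooth (hF : IsTest L Y F) : ContDiff ℝ ∞ F := by
  cases Y <;> exact hF.1

theorem zero (L : ℝ) (Y : YDomain) : IsTest L Y 0 :=
  match Y with
  | .interval => ⟨contDiff_const, .zero, by simp [tsupport]⟩
  | .circle => ⟨contDiff_const, fun _ _ => rfl, L - 1, sub_one_lt L, fun _ _ _ => rfl⟩
  | .line => ⟨contDiff_const, .zero, by simp [tsupport]⟩

theorem add (hF : IsTest L Y F) (hG : IsTest L Y G) : IsTest L Y (F + G) := by
  refine match Y, hF, hG with
  | .interval, hF, hG => ⟨hF.1.add hG.1, hF.2.1.add hG.2.1,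
      (tsupport_add F G).trans (union_subset hF.2.2 hG.2.2)⟩
  | .circle, hF, hG => ⟨hF.1.add hG.1, fun x y => by simp [hF.2.1 x y, hG.2.1 x y], ?_⟩
  | .line, hF, hG => ⟨hF.1.add hG.1, hF.2.1.add hG.2.1,
      (tsupport_add F G).trans (union_subset hF.2.2 hG.2.2)⟩
  obtain ⟨a, ha, hFa⟩ := hF.2.2
  obtain ⟨b, hb, hGb⟩ := hG.2.2
  refine ⟨max a b, max_lt ha hb, fun x y hx => ?_⟩
  simp [hFa x y (le_of_max_le_left hx), hGb x y (le_of_max_le_right hx)]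

theorem const_smul (c : ℝ) (hF : IsTest L Y F) : IsTest L Y (c • F) := by
  have hs : tsupport (c • F) ⊆ tsupport F := closure_mono (Function.support_const_smul_subset c F)
  refine match Y, hF with
  | .interval, hF => ⟨hF.1.const_smul c, hF.2.1.mono (Function.support_const_smul_subset c F),
      hs.trans hF.2.2⟩
  | .circle, hF => ⟨hF.1.const_smul c, fun x y => by simp [hF.2.1 x y], ?_⟩
  | .line, hF => ⟨hF.1.const_smul c, hF.2.1.mono (Function.support_const_smul_subset c F),
      hs.trans hF.2.2⟩
  obtain ⟨a, ha, hFa⟩ := hF.2.2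
  exact ⟨a, ha, fun x y hx => by simp [hFa x y hx]⟩

theorem slice_x (hL : 0 < L) (hF : IsTest L Y F) (y : ℝ) : IsTestX L (fun x => F (x, y)) := by
  refine ⟨hF.smooth.comp (contDiff_id.prodMk contDiff_const), ?_⟩
  have hvanish : ∃ a < L, ∀ x y, a ≤ |x| → F (x, y) = 0 :=
    match Y, hF with
    | .interval, hF => exists_lt_forall_eq_zero_of_tsupport_subset hL hF.2.1
        (hF.2.2.trans (prod_mono subset_rfl (subset_univ _)))
    | .circle, hF => hF.2.2
    | .line, hF => exists_lt_forall_eq_zero_of_tsupport_subset hL hF.2.1 hF.2.2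
  obtain ⟨a, ha, hFa⟩ := hvanish
  exact ⟨a, ha, fun x hx => hFa x y hx⟩

theorem slice_y (hF : IsTest L Y F) (x : ℝ) : IsTestY Y (fun y => F (x, y)) :=
  have hs : ContDiff ℝ ∞ (fun y => F (x, y)) :=
    hF.smooth.comp (contDiff_const.prodMk contDiff_id)
  match Y, hF with
  | .interval, hF => ⟨hs, hasCompactSupport_slice hF.2.1 x,
      fun _ hy => (hF.2.2
        (tsupport_comp_subset_preimage (f := fun y => (x, y)) F (by fun_prop) hy)).2⟩
  | .circle, hF => ⟨hs, fun y => hF.2.1 x y⟩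
  | .line, hF => ⟨hs, hasCompactSupport_slice hF.2.1 x⟩

end IsTest

theorem IsTestX.tensor {L : ℝ} {Y : YDomain} {φ ψ : ℝ → ℝ} (hφ : IsTestX L φ)
    (hψ : IsTestY Y ψ) : IsTest L Y (tensor φ ψ) := by
  have hs : ContDiff ℝ ∞ (Grushin.tensor φ ψ) :=
    (hφ.smooth.comp contDiff_fst).mul (hψ.smooth.comp contDiff_snd)
  refine match Y, hψ with
  | .interval, hψ => ⟨hs, hasCompactSupport_tensor hφ.hasCompactSupport hψ.2.1,
      (tsupport_tensor_subset φ ψ).trans (prod_mono hφ.tsupport_subset hψ.2.2)⟩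
  | .circle, hψ => ⟨hs, fun x y => congrArg (φ x * ·) (hψ.2 y), ?_⟩
  | .line, hψ => ⟨hs, hasCompactSupport_tensor hφ.hasCompactSupport hψ.2,
      (tsupport_tensor_subset φ ψ).trans (prod_mono hφ.tsupport_subset (subset_univ _))⟩
  obtain ⟨a, ha, hφa⟩ := hφ.vanish
  exact ⟨a, ha, fun x y hx => by simp [Grushin.tensor, hφa x hx]⟩

theorem dx_tensor (φ ψ : ℝ → ℝ) : dx (tensor φ ψ) = tensor (deriv φ) ψ := by
  funext z
  simp [dx, tensor]

theorem dY_tensor (q r φ ψ : ℝ → ℝ) :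
    dY q r (tensor φ ψ) = tensor (fun x => q x * φ x) (fun y => r y * deriv ψ y) := by
  funext z
  simp only [dY, tensor, deriv_const_mul_field]
  ring

theorem memLp_tensor {μ ν : Measure ℝ} [SFinite μ] [SFinite ν] {φ ψ : ℝ → ℝ} (hφ : MemLp φ 2 μ)
    (hψ : MemLp ψ 2 ν) : MemLp (tensor φ ψ) 2 (μ.prod ν) := by
  have hmeas : AEStronglyMeasurable (tensor φ ψ) (μ.prod ν) := hφ.1.comp_fst.mul hψ.1.comp_snd
  rw [memLp_two_iff_integrable_sq hmeas]
  simpa only [tensor, mul_pow] using hφ.integrable_sq.mul_prod hψ.integrable_sq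

theorem integral_tensor_sq (μ ν : Measure ℝ) [SFinite μ] [SFinite ν] (φ ψ : ℝ → ℝ) :
    ∫ z, tensor φ ψ z ^ 2 ∂(μ.prod ν) = (∫ x, φ x ^ 2 ∂μ) * ∫ y, ψ y ^ 2 ∂ν := by
  simp only [← integral_prod_mul, tensor, mul_pow]

/-! ### Approximate eigenvalues -/

section ApproxEigenvalue

variable {K : Type*} [NormedAddCommGroup K] [InnerProductSpace ℝ K]

/-- `β` belongs to the approximate point spectrum of the bounded operator `C`. -/
def IsApproxEigenvalue (C : K →L[ℝ] K) (β : ℝ) : Prop :=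
  ∀ ε > 0, ∃ k, k ≠ 0 ∧ ‖C k - β • k‖ ≤ ε * ‖k‖

theorem norm_apply_sq_le_of_isPositive {A : K →L[ℝ] K} (hA : A.IsPositive) (x : K) :
    ‖A x‖ ^ 2 ≤ ‖A‖ * ⟪A x, x⟫ := by
  have hcs : ⟪A x, A x⟫ ^ 2 ≤ ⟪A x, x⟫ * ⟪A (A x), A x⟫ :=
    LinearMap.BilinForm.apply_sq_le_of_symm ((innerₗ K).comp A.toLinearMap)
      hA.inner_nonneg_left ⟨fun y z => (hA.isSymmetric y z).trans (real_inner_comm _ _)⟩ x (A x)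
  have hAA : ⟪A (A x), A x⟫ ≤ ‖A‖ * ‖A x‖ ^ 2 :=
    (real_inner_le_norm _ _).trans (by nlinarith [A.le_opNorm (A x), norm_nonneg (A x)])
  rw [real_inner_self_eq_norm_sq] at hcs
  rcases (sq_nonneg ‖A x‖).eq_or_lt with hzero | hpos
  · rw [← hzero]
    exact mul_nonneg (norm_nonneg A) (hA.inner_nonneg_left x)
  · nlinarith [mul_le_mul_of_nonneg_left hAA (hA.inner_nonneg_left x)]

theorem isApproxEigenvalue_zero_of_isPositive {A : K →L[ℝ] K} (hA : A.IsPositive)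
    (hsmall : ∀ η > 0, ∃ x, x ≠ 0 ∧ ⟪A x, x⟫ ≤ η * ‖x‖ ^ 2) : IsApproxEigenvalue A 0 := by
  intro ε hε
  obtain ⟨x, hx, hxle⟩ := hsmall (ε ^ 2 / (‖A‖ + 1)) (by positivity)
  refine ⟨x, hx, ?_⟩
  rw [zero_smul, sub_zero]
  refine abs_le_of_sq_le_sq ?_ (by positivity) |>.trans' (le_abs_self _)
  calc ‖A x‖ ^ 2 ≤ (‖A‖ + 1) * ⟪A x, x⟫ :=
        (norm_apply_sq_le_of_isPositive hA x).trans
          (mul_le_mul_of_nonneg_right (by linarith) (hA.inner_nonneg_left x))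
    _ ≤ (‖A‖ + 1) * (ε ^ 2 / (‖A‖ + 1) * ‖x‖ ^ 2) := by gcongr
    _ = (ε * ‖x‖) ^ 2 := by field_simp

theorem IsApproxEigenvalue.of_sub_smul_id {A : K →L[ℝ] K} {c β : ℝ}
    (h : IsApproxEigenvalue (A - c • ContinuousLinearMap.id ℝ K) β) :
    IsApproxEigenvalue A (c + β) := by
  intro ε hε
  obtain ⟨k, hk, hle⟩ := h ε hε
  refine ⟨k, hk, le_of_eq_of_le (congrArg _ ?_) hle⟩
  simp only [_root_.sub_apply, _root_.smul_apply, ContinuousLinearMap.id_apply]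
  module

theorem isSymmetric_sub_smul_id {A : K →L[ℝ] K} (hA : A.IsSymmetric) (c : ℝ) :
    (A - c • ContinuousLinearMap.id ℝ K).IsSymmetric :=
  hA.sub (LinearMap.IsSymmetric.id.smul (conj_trivial c))

theorem isApproxEigenvalue_iInf_rayleighQuotient [Nontrivial K] {A : K →L[ℝ] K}
    (hA : A.IsSymmetric) :
    IsApproxEigenvalue A (⨅ x : {x : K // x ≠ 0}, A.rayleighQuotient x) := by
  set m := ⨅ x : {x : K // x ≠ 0}, A.rayleighQuotient x
  have hbdd : BddBelow (range fun x : {x : K // x ≠ 0} => A.rayleighQuotient x) :=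
    ⟨-‖A‖, by rintro _ ⟨x, rfl⟩; exact (abs_le.1 (A.rayleighQuotient_le_norm x)).1⟩
  set B : K →L[ℝ] K := A - m • ContinuousLinearMap.id ℝ K with hB
  have hB_inner : ∀ x, ⟪B x, x⟫ = ⟪A x, x⟫ - m * ‖x‖ ^ 2 := fun x => by
    simp [hB, inner_sub_left, real_inner_smul_left]
  have hBpos : B.IsPositive := by
    refine ⟨isSymmetric_sub_smul_id hA m, fun x => ?_⟩
    rcases eq_or_ne x 0 with rfl | hx
    · simp [ContinuousLinearMap.reApplyInnerSelf_apply]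
    · have hm : m * ‖x‖ ^ 2 ≤ ⟪A x, x⟫ :=
        (le_div_iff₀ (by positivity)).1 (ciInf_le hbdd ⟨x, hx⟩)
      exact (sub_nonneg.2 hm).trans_eq (hB_inner x).symm
  have hB_zero : IsApproxEigenvalue B 0 := by
    refine isApproxEigenvalue_zero_of_isPositive hBpos fun η hη => ?_
    have : Nonempty {x : K // x ≠ 0} := nonempty_subtype.2 (exists_ne 0)
    obtain ⟨⟨x, hx⟩, hxm⟩ := exists_lt_of_ciInf_lt (lt_add_of_pos_right m hη)
    have hnear : ⟪A x, x⟫ < (m + η) * ‖x‖ ^ 2 := (div_lt_iff₀ (by positivity)).1 hxm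
    exact ⟨x, hx, by rw [hB_inner]; linarith⟩
  simpa only [add_zero] using hB_zero.of_sub_smul_id

theorem isApproxEigenvalue_or_neg_of_comp_self {B : K →L[ℝ] K} {s : ℝ}
    (hB : IsApproxEigenvalue (B.comp B) (s ^ 2)) :
    IsApproxEigenvalue B s ∨ IsApproxEigenvalue B (-s) := by
  by_contra! hcon
  simp only [IsApproxEigenvalue] at hcon
  push Not at hcon
  obtain ⟨⟨ε₁, hε₁, hlower⟩, ε₂, hε₂, hlower_neg⟩ := hcon
  obtain ⟨x, hx, hxle⟩ := hB (ε₁ * ε₂) (by positivity)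
  set y := B x - s • x
  have hfactor : (B.comp B) x - s ^ 2 • x = B y - (-s) • y := by
    simp only [ContinuousLinearMap.comp_apply, y, map_sub, map_smul]
    module
  have hy : y ≠ 0 := fun hy => by
    have := hlower x hx
    simp only [y] at hy
    rw [hy, norm_zero] at this
    linarith [mul_pos hε₁ (norm_pos_iff.2 hx)]
  rw [hfactor] at hxle
  nlinarith [hlower x hx, hlower_neg y hy]

/-- The operator `(C - δ / 2)²` is shown to have an approximate eigenvalue below `(δ / 2)²`. -/
theorem exists_isApproxEigenvalue_mem_Ioo {C : K →L[ℝ] K} (hC : C.IsSymmetric) {δ : ℝ} {k₀ : K}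
    (hδ : 0 < δ) (hk₀ : ‖C k₀‖ ^ 2 < δ * ⟪C k₀, k₀⟫) :
    ∃ β ∈ Ioo 0 δ, IsApproxEigenvalue C β := by
  have hk₀_ne : k₀ ≠ 0 := by
    rintro rfl
    simp at hk₀
  have : Nontrivial K := ⟨k₀, 0, hk₀_ne⟩
  set B : K →L[ℝ] K := C - (δ / 2) • ContinuousLinearMap.id ℝ K
  have hB_apply : ∀ x, B x = C x - (δ / 2) • x := fun x => by simp [B]
  have hB_symm : ∀ x y, ⟪B x, y⟫ = ⟪x, B y⟫ := isSymmetric_sub_smul_id hC _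
  have hBB : (B.comp B).IsSymmetric := fun x y => (hB_symm (B x) y).trans (hB_symm x (B y))
  have hquot : ∀ x, (B.comp B).rayleighQuotient x = ‖B x‖ ^ 2 / ‖x‖ ^ 2 := fun x =>
    congrArg (· / _) ((hB_symm (B x) x).trans (real_inner_self_eq_norm_sq _))
  set m := ⨅ x : {x : K // x ≠ 0}, (B.comp B).rayleighQuotient x
  have hm_nonneg : 0 ≤ m := Real.iInf_nonneg fun x => by rw [hquot]; positivity
  have hm_lt : √m < δ / 2 := by
    have hbdd : BddBelow (range fun x : {x : K // x ≠ 0} => (B.comp B).rayleighQuotient x) :=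
      ⟨0, by rintro _ ⟨x, rfl⟩; simp only [hquot]; positivity⟩
    rw [Real.sqrt_lt' (by positivity)]
    refine (ciInf_le hbdd ⟨k₀, hk₀_ne⟩).trans_lt ?_
    rw [hquot, div_lt_iff₀ (by positivity), hB_apply, norm_sub_sq_real, real_inner_smul_right,
      norm_smul, mul_pow, Real.norm_eq_abs, sq_abs]
    linarith
  have happrox : IsApproxEigenvalue (B.comp B) (√m ^ 2) := by
    rw [Real.sq_sqrt hm_nonneg]
    exact isApproxEigenvalue_iInf_rayleighQuotient hBB
  have hm_sqrt := Real.sqrt_nonneg m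
  rcases isApproxEigenvalue_or_neg_of_comp_self happrox with hs | hs
  · exact ⟨δ / 2 + √m, ⟨by linarith, by linarith⟩, hs.of_sub_smul_id⟩
  · exact ⟨δ / 2 + -√m, ⟨by linarith, by linarith⟩, hs.of_sub_smul_id⟩

theorem IsApproxEigenvalue.exists_of_denseRange {C : K →L[ℝ] K} {β : ℝ}
    (hC : IsApproxEigenvalue C β) {E : Type*} {ι : E → K} (hι : DenseRange ι) {ε : ℝ}
    (hε : 0 < ε) : ∃ x, ι x ≠ 0 ∧ ‖C (ι x) - β • ι x‖ ≤ ε * ‖ι x‖ := by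
  obtain ⟨k, hk, hkle⟩ := hC (ε / 2) (by positivity)
  have hopen : IsOpen {k : K | ‖C k - β • k‖ < ε * ‖k‖} := isOpen_lt (by fun_prop) (by fun_prop)
  have hmem : ‖C k - β • k‖ < ε * ‖k‖ :=
    hkle.trans_lt (mul_lt_mul_of_pos_right (by linarith) (norm_pos_iff.2 hk))
  obtain ⟨x, hx⟩ := hι.exists_mem_open hopen ⟨k, hmem⟩
  refine ⟨x, fun h0 => ?_, le_of_lt hx⟩
  simp [h0] at hx

end ApproxEigenvalue

section ClosedForm

variable {K H H' : Type*} [NormedAddCommGroup K] [InnerProductSpace ℝ K] [CompleteSpace K]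
  [NormedAddCommGroup H] [InnerProductSpace ℝ H] [CompleteSpace H]
  [NormedAddCommGroup H'] [InnerProductSpace ℝ H'] {J : K →L[ℝ] H} {J' : K →L[ℝ] H'}

open ContinuousLinearMap (adjoint)

theorem inner_adjoint_comp_self (J : K →L[ℝ] H) (k k' : K) :
    ⟪((adjoint J).comp J) k, k'⟫ = ⟪J k, J k'⟫ := by
  simp [ContinuousLinearMap.adjoint_inner_left]

theorem exists_isApproxEigenvalue_adjoint_comp_self
    (hinner : ∀ k k', ⟪k, k'⟫ = ⟪J k, J k'⟫ + ⟪J' k, J' k'⟫) {δ : ℝ} (hδ : 0 < δ) {k₀ : K} {e : H'}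
    (he : ∀ k, ⟪J k₀, J k⟫ = -⟪e, J' k⟫) (hlt : ‖e‖ ^ 2 < δ * ‖J k₀‖ ^ 2) :
    ∃ β ∈ Ioo 0 δ, IsApproxEigenvalue ((adjoint J).comp J) β := by
  have hsymm : ((adjoint J).comp J).IsSymmetric := fun x y =>
    (inner_adjoint_comp_self J x y).trans
      ((real_inner_comm _ _).trans ((inner_adjoint_comp_self J y x).symm.trans
        (real_inner_comm _ _)))
  refine exists_isApproxEigenvalue_mem_Ioo hsymm (k₀ := k₀) hδ ?_
  set z := ((adjoint J).comp J) k₀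
  have hJ'z : ‖J' z‖ ≤ ‖z‖ := by
    have := hinner z z
    simp only [real_inner_self_eq_norm_sq] at this
    exact le_of_sq_le_sq (by nlinarith [sq_nonneg ‖J z‖]) (norm_nonneg z)
  have hz_sq : ‖z‖ ^ 2 = -⟪e, J' z⟫ := by
    rw [← real_inner_self_eq_norm_sq, inner_adjoint_comp_self, he]
  have hz : ‖z‖ ^ 2 ≤ ‖e‖ * ‖z‖ :=
    calc ‖z‖ ^ 2 ≤ ‖e‖ * ‖J' z‖ :=
          hz_sq.trans_le ((neg_le_abs _).trans (abs_real_inner_le_norm _ _))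
      _ ≤ ‖e‖ * ‖z‖ := by gcongr
  have hz_le : ‖z‖ ≤ ‖e‖ := by
    by_contra! hlt'
    nlinarith [norm_nonneg e]
  rw [inner_adjoint_comp_self, real_inner_self_eq_norm_sq]
  exact (pow_le_pow_left₀ (norm_nonneg z) hz_le 2).trans_lt hlt

theorem half_mul_norm_sq_le_of_norm_sub_le {β : ℝ} {k : K}
    (hk : ‖((adjoint J).comp J) k - β • k‖ ≤ β / 2 * ‖k‖) :
    β / 2 * ‖k‖ ^ 2 ≤ ‖J k‖ ^ 2 := by
  have hinner : ⟪((adjoint J).comp J) k - β • k, k⟫ = ‖J k‖ ^ 2 - β * ‖k‖ ^ 2 := by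
    rw [inner_sub_left, inner_adjoint_comp_self, real_inner_smul_left,
      real_inner_self_eq_norm_sq, real_inner_self_eq_norm_sq]
  have hcs : -⟪((adjoint J).comp J) k - β • k, k⟫ ≤ (β / 2 * ‖k‖) * ‖k‖ :=
    (neg_le_abs _).trans ((abs_real_inner_le_norm _ _).trans
      (mul_le_mul_of_nonneg_right hk (norm_nonneg _)))
  nlinarith

theorem IsApproxEigenvalue.exists_weak_quasimode
    (hinner : ∀ k k', ⟪k, k'⟫ = ⟪J k, J k'⟫ + ⟪J' k, J' k'⟫) {β : ℝ} (hβ : 0 < β)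
    (hJ : IsApproxEigenvalue ((adjoint J).comp J) β) {E : Type*} {ι : E → K} (hι : DenseRange ι)
    {ε : ℝ} (hε : 0 < ε) :
    ∃ x, 0 < ‖J (ι x)‖ ∧ ∀ k',
      |⟪J' (ι x), J' k'⟫ - (1 / β - 1) * ⟪J (ι x), J k'⟫| ≤ ε * ‖J (ι x)‖ * ‖k'‖ := by
  set ε₁ := min (β / 2) (ε * β * √(β / 2))
  obtain ⟨x, hx, hxle⟩ := hJ.exists_of_denseRange hι (show 0 < ε₁ by positivity)
  set k := ι x
  have hsqrt : 0 < √(β / 2) := by positivity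
  have hk_sq : β / 2 * ‖k‖ ^ 2 ≤ ‖J k‖ ^ 2 :=
    half_mul_norm_sq_le_of_norm_sub_le (hxle.trans (by gcongr; exact min_le_left _ _))
  have hk : √(β / 2) * ‖k‖ ≤ ‖J k‖ := by
    refine le_of_sq_le_sq ?_ (norm_nonneg _)
    rwa [mul_pow, Real.sq_sqrt (by positivity)]
  refine ⟨x, lt_of_lt_of_le (mul_pos hsqrt (norm_pos_iff.2 hx)) hk, fun k' => ?_⟩
  have hidentity : ⟪J' k, J' k'⟫ - (1 / β - 1) * ⟪J k, J k'⟫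
      = -(β⁻¹ * ⟪((adjoint J).comp J) k - β • k, k'⟫) := by
    rw [inner_sub_left, inner_adjoint_comp_self, real_inner_smul_left, hinner]
    field_simp
    ring
  rw [hidentity, abs_neg, abs_mul, abs_of_pos (inv_pos.2 hβ)]
  calc β⁻¹ * |⟪((adjoint J).comp J) k - β • k, k'⟫|
      ≤ β⁻¹ * ((ε * β * √(β / 2)) * ‖k‖ * ‖k'‖) := by
        gcongr
        refine (abs_real_inner_le_norm _ _).trans ?_
        gcongr
        exact hxle.trans (by gcongr; exact min_le_right _ _)
    _ = ε * (√(β / 2) * ‖k‖) * ‖k'‖ := by field_simp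
    _ ≤ ε * ‖J k‖ * ‖k'‖ := by gcongr

theorem exists_weak_quasimode_of_denseRange
    (hinner : ∀ k k', ⟪k, k'⟫ = ⟪J k, J k'⟫ + ⟪J' k, J' k'⟫) {E : Type*} [AddCommGroup E]
    [Module ℝ E] {ι : E →ₗ[ℝ] K} (hι : DenseRange ι) {δ : ℝ} (hδ : 0 < δ) {x₀ : E} {e : H'}
    (he : ∀ x, ⟪J (ι x₀), J (ι x)⟫ = -⟪e, J' (ι x)⟫) (hlt : ‖e‖ ^ 2 < δ * ‖J (ι x₀)‖ ^ 2) :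
    ∃ β ∈ Ioo 0 δ, ∀ ε > 0, ∃ x, ‖J (ι x)‖ = 1 ∧ ∀ k,
      (⟪J' (ι x), J' k⟫ - (1 / β - 1) * ⟪J (ι x), J k⟫) ^ 2 ≤ ε ^ 2 * ‖k‖ ^ 2 := by
  have he_closure : ∀ k, ⟪J (ι x₀), J k⟫ = -⟪e, J' k⟫ := fun k =>
    hι.induction_on (p := fun k => ⟪J (ι x₀), J k⟫ = -⟪e, J' k⟫) k
      (isClosed_eq (by fun_prop) (by fun_prop)) he
  obtain ⟨β, hβ, happrox⟩ := exists_isApproxEigenvalue_adjoint_comp_self hinner hδ he_closure hlt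
  refine ⟨β, hβ, fun ε hε => ?_⟩
  obtain ⟨x, hx, hxle⟩ := happrox.exists_weak_quasimode hinner hβ.1 hι hε
  set c := ‖J (ι x)‖
  refine ⟨c⁻¹ • x, ?_, fun k => ?_⟩
  · rw [map_smul, map_smul, norm_smul, norm_inv, norm_norm, inv_mul_cancel₀ hx.ne']
  have hscale : ⟪J' (ι (c⁻¹ • x)), J' k⟫ - (1 / β - 1) * ⟪J (ι (c⁻¹ • x)), J k⟫
      = c⁻¹ * (⟪J' (ι x), J' k⟫ - (1 / β - 1) * ⟪J (ι x), J k⟫) := by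
    simp only [map_smul, real_inner_smul_left]
    ring
  rw [← mul_pow, hscale, ← sq_abs, abs_mul, abs_of_pos (inv_pos.2 hx)]
  refine pow_le_pow_left₀ (by positivity) ?_ 2
  calc c⁻¹ * |⟪J' (ι x), J' k⟫ - (1 / β - 1) * ⟪J (ι x), J k⟫|
      ≤ c⁻¹ * (ε * c * ‖k‖) := by gcongr; exact hxle k
    _ = ε * ‖k‖ := by field_simp

end ClosedForm

/-- The form `‖J' x‖² + ‖J x‖²` is closed by passing to the closure of the graph of
`x ↦ (J x, J' x)`. On the approximate eigenspace of `J† J` for the eigenvalue `β`, taken in that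
closure, `J'† J' = (1 / β - 1) J† J`. -/
theorem exists_weak_quasimode_of_inner_eq_neg {E H H' : Type*} [AddCommGroup E] [Module ℝ E]
    [NormedAddCommGroup H] [InnerProductSpace ℝ H] [CompleteSpace H]
    [NormedAddCommGroup H'] [InnerProductSpace ℝ H'] [CompleteSpace H']
    (J : E →ₗ[ℝ] H) (J' : E →ₗ[ℝ] H') {δ : ℝ} (hδ : 0 < δ) {x₀ : E} {e : H'}
    (he : ∀ x, ⟪J x₀, J x⟫ = -⟪e, J' x⟫) (hlt : ‖e‖ ^ 2 < δ * ‖J x₀‖ ^ 2) :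
    ∃ β ∈ Ioo 0 δ, ∀ ε > 0, ∃ x, ‖J x‖ = 1 ∧ ∀ y,
      (⟪J' x, J' y⟫ - (1 / β - 1) * ⟪J x, J y⟫) ^ 2 ≤ ε ^ 2 * (‖J y‖ ^ 2 + ‖J' y‖ ^ 2) := by
  set graph : E →ₗ[ℝ] WithLp 2 (H × H') :=
    (WithLp.linearEquiv 2 ℝ (H × H')).symm.toLinearMap ∘ₗ J.prod J'
  set K := graph.range.topologicalClosure
  have : CompleteSpace K := graph.range.isClosed_topologicalClosure.completeSpace_coe
  set ι : E →ₗ[ℝ] K := graph.codRestrict K fun x => graph.range.le_topologicalClosure ⟨x, rfl⟩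
  have hι : DenseRange ι := by
    rw [DenseRange, Subtype.dense_iff]
    refine fun k hk => closure_mono ?_ hk
    rintro _ ⟨x, rfl⟩
    exact ⟨ι x, ⟨x, rfl⟩, rfl⟩
  set P : K →L[ℝ] H := (WithLp.fstL 2 ℝ H H').comp K.subtypeL
  set P' : K →L[ℝ] H' := (WithLp.sndL 2 ℝ H H').comp K.subtypeL
  have hinner : ∀ k k' : K, ⟪k, k'⟫ = ⟪P k, P k'⟫ + ⟪P' k, P' k'⟫ := fun k k' =>
    WithLp.prod_inner_apply _ _
  have hnorm : ∀ y, ‖ι y‖ ^ 2 = ‖J y‖ ^ 2 + ‖J' y‖ ^ 2 := fun y => by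
    rw [← real_inner_self_eq_norm_sq, hinner, real_inner_self_eq_norm_sq,
      real_inner_self_eq_norm_sq]
    rfl
  obtain ⟨β, hβ, hquasi⟩ := exists_weak_quasimode_of_denseRange hinner hι hδ he hlt
  refine ⟨β, hβ, fun ε hε => ?_⟩
  obtain ⟨x, hx, hxle⟩ := hquasi ε hε
  exact ⟨x, hx, fun y => (hnorm y) ▸ hxle (ι y)⟩

section LpInner

variable {α : Type*} [MeasurableSpace α] {μ : Measure α} {f g : α → ℝ}

theorem inner_eq_integral {a b : Lp ℝ 2 μ} (ha : a =ᵐ[μ] f) (hb : b =ᵐ[μ] g) :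
    ⟪a, b⟫ = ∫ x, f x * g x ∂μ := by
  rw [L2.inner_def]
  refine integral_congr_ae ?_
  filter_upwards [ha, hb] with x hax hbx
  simp [hax, hbx, mul_comm]

theorem norm_sq_eq_integral {a : Lp ℝ 2 μ} (ha : a =ᵐ[μ] f) : ‖a‖ ^ 2 = ∫ x, f x ^ 2 ∂μ := by
  rw [← real_inner_self_eq_norm_sq, inner_eq_integral ha ha]
  simp only [sq]

theorem norm_toLp_sq (hf : MemLp f 2 μ) : ‖hf.toLp f‖ ^ 2 = ∫ x, f x ^ 2 ∂μ :=
  norm_sq_eq_integral hf.coeFn_toLp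

theorem inner_toLp_toLp (hf : MemLp f 2 μ) (hg : MemLp g 2 μ) :
    ⟪hf.toLp f, hg.toLp g⟫ = ∫ x, f x * g x ∂μ :=
  inner_eq_integral hf.coeFn_toLp hg.coeFn_toLp

end LpInner

/-! ### Transversal quasimodes -/

/-- Approximate eigenfunctions of `-∂_y (r² ∂_y)` for the energy `ν`: normalized test functions
solving the eigenvalue equation weakly, up to an error `ε` in the dual of the form norm. -/
structure IsTransversalQuasimode (Y : YDomain) (r : ℝ → ℝ) (ν ε : ℝ) (ψ : ℝ → ℝ) : Prop where
  test : IsTestY Y ψ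
  normalized : ∫ y, ψ y ^ 2 ∂measY Y = 1
  form_error_sq_le : ∀ χ, IsTestY Y χ →
    (∫ y, (r y * deriv ψ y) * (r y * deriv χ y) ∂measY Y - ν * ∫ y, ψ y * χ y ∂measY Y) ^ 2
      ≤ ε ^ 2 * (∫ y, χ y ^ 2 ∂measY Y + ∫ y, (r y * deriv χ y) ^ 2 ∂measY Y)

/-- Functions `Φ` for which `Φ / r` is square integrable and is mapped to the test function `Φ'` by
the adjoint of `-r ∂_y`. If `Φ / r` is small compared to `Φ'`, then `Φ'` is a state of high
energy. -/
structure IsTransversalPotential (Y : YDomain) (r Φ : ℝ → ℝ) : Prop where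
  test_deriv : IsTestY Y (deriv Φ)
  memLp : MemLp (fun y => Φ y / r y) 2 (measY Y)
  integral_deriv_mul : ∀ χ, IsTestY Y χ →
    ∫ y, deriv Φ y * χ y ∂measY Y = -∫ y, (Φ y / r y) * (r y * deriv χ y) ∂measY Y

section Quasimode

variable {Y : YDomain} {r : ℝ → ℝ}

/-- The embedding of the test functions on `Ω_y` into `L²(Ω_y)`. -/
noncomputable def testYToLp (Y : YDomain) : testY Y →ₗ[ℝ] Lp ℝ 2 (measY Y) where
  toFun ψ := ψ.2.memLp.toLp
  map_add' ψ χ := ψ.2.memLp.toLp_add χ.2.memLp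
  map_smul' c ψ := ψ.2.memLp.toLp_const_smul c

/-- The operator `ψ ↦ r ψ'` from the test functions on `Ω_y` to `L²(Ω_y)`. -/
noncomputable def coeffDerivToLp (hr : IsTransversalCoeff Y r) :
    testY Y →ₗ[ℝ] Lp ℝ 2 (measY Y) where
  toFun ψ := (ψ.2.memLp_coeff_mul_deriv hr).toLp
  map_add' ψ χ := by
    rw [← MemLp.toLp_add]
    congr 1
    funext y
    simp [deriv_add (ψ.2.smooth.differentiable (by simp) y)
      (χ.2.smooth.differentiable (by simp) y), mul_add]
  map_smul' c ψ := by
    rw [RingHom.id_apply, ← MemLp.toLp_const_smul]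
    congr 1
    funext y
    simp [deriv_const_smul c (ψ.2.smooth.differentiable (by simp) y), mul_left_comm]

theorem inner_testYToLp (ψ χ : testY Y) :
    ⟪testYToLp Y ψ, testYToLp Y χ⟫ = ∫ y, ψ.1 y * χ.1 y ∂measY Y :=
  inner_toLp_toLp ψ.2.memLp χ.2.memLp

theorem norm_testYToLp_sq (ψ : testY Y) : ‖testYToLp Y ψ‖ ^ 2 = ∫ y, ψ.1 y ^ 2 ∂measY Y :=
  norm_toLp_sq ψ.2.memLp

theorem inner_coeffDerivToLp (hr : IsTransversalCoeff Y r) (ψ χ : testY Y) :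
    ⟪coeffDerivToLp hr ψ, coeffDerivToLp hr χ⟫
      = ∫ y, (r y * deriv ψ y) * (r y * deriv χ y) ∂measY Y :=
  inner_toLp_toLp (ψ.2.memLp_coeff_mul_deriv hr) (χ.2.memLp_coeff_mul_deriv hr)

theorem norm_coeffDerivToLp_sq (hr : IsTransversalCoeff Y r) (ψ : testY Y) :
    ‖coeffDerivToLp hr ψ‖ ^ 2 = ∫ y, (r y * deriv ψ y) ^ 2 ∂measY Y :=
  norm_toLp_sq (ψ.2.memLp_coeff_mul_deriv hr)

theorem IsTransversalPotential.exists_quasimode (hr : IsTransversalCoeff Y r) {Φ : ℝ → ℝ}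
    (hΦ : IsTransversalPotential Y r Φ) {δ : ℝ} (hδ : 0 < δ)
    (hlt : ∫ y, (Φ y / r y) ^ 2 ∂measY Y < δ * ∫ y, deriv Φ y ^ 2 ∂measY Y) :
    ∃ β ∈ Ioo 0 δ, ∀ ε > 0, ∃ ψ, IsTransversalQuasimode Y r (1 / β - 1) ε ψ := by
  have hadjoint : ∀ χ, ⟪testYToLp Y ⟨deriv Φ, hΦ.test_deriv⟩, testYToLp Y χ⟫
      = -⟪hΦ.memLp.toLp, coeffDerivToLp hr χ⟫ := fun χ => by
    rw [inner_testYToLp, hΦ.integral_deriv_mul χ χ.2]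
    exact congrArg Neg.neg (inner_toLp_toLp hΦ.memLp (χ.2.memLp_coeff_mul_deriv hr)).symm
  obtain ⟨β, hβ, hquasi⟩ := exists_weak_quasimode_of_inner_eq_neg (testYToLp Y)
    (coeffDerivToLp hr) hδ hadjoint (by rwa [norm_toLp_sq, norm_testYToLp_sq])
  refine ⟨β, hβ, fun ε hε => ?_⟩
  obtain ⟨ψ, hnorm, herror⟩ := hquasi ε hε
  refine ⟨ψ, ψ.2, ?_, fun χ hχ => ?_⟩
  · rw [← norm_testYToLp_sq, hnorm, one_pow]
  · simpa only [inner_testYToLp, norm_testYToLp_sq, inner_coeffDerivToLp,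
      norm_coeffDerivToLp_sq] using herror ⟨χ, hχ⟩

end Quasimode

section Bump

theorem sq_sub_le_mul_integral_deriv_sq {f : ℝ → ℝ} (hf : ContDiff ℝ 1 f) {a b : ℝ}
    (hab : a ≤ b) : (f b - f a) ^ 2 ≤ (b - a) * ∫ y in a..b, deriv f y ^ 2 := by
  have hcont : Continuous (deriv f) := hf.continuous_deriv le_rfl
  have hint : ∫ y in a..b, deriv f y = f b - f a :=
    intervalIntegral.integral_deriv_eq_sub (fun y _ => hf.differentiable one_ne_zero y)
      (hcont.intervalIntegrable a b)
  rcases hab.eq_or_lt with rfl | hab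
  · simp
  set m := (f b - f a) / (b - a)
  have hvar : 0 ≤ ∫ y in a..b, (deriv f y - m) ^ 2 :=
    intervalIntegral.integral_nonneg hab.le fun y _ => sq_nonneg _
  have hexpand : ∫ y in a..b, (deriv f y - m) ^ 2
      = (∫ y in a..b, deriv f y ^ 2) - (f b - f a) ^ 2 / (b - a) := by
    calc ∫ y in a..b, (deriv f y - m) ^ 2
        = ∫ y in a..b, (deriv f y ^ 2 - (2 * m * deriv f y - m ^ 2)) := by
          congr 1 with y
          ring
      _ = (∫ y in a..b, deriv f y ^ 2) - (2 * m * (f b - f a) - (b - a) * m ^ 2) := by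
          rw [intervalIntegral.integral_sub, intervalIntegral.integral_sub,
            intervalIntegral.integral_const_mul, hint, intervalIntegral.integral_const,
            smul_eq_mul] <;> exact Continuous.intervalIntegrable (by fun_prop) a b
      _ = (∫ y in a..b, deriv f y ^ 2) - (f b - f a) ^ 2 / (b - a) := by
          have : b - a ≠ 0 := (sub_pos.2 hab).ne'
          simp only [m]
          field_simp
          ring
  rw [hexpand, sub_nonneg, div_le_iff₀ (sub_pos.2 hab)] at hvar
  linarith

variable {Y : YDomain} {r : ℝ → ℝ}

theorem isTransversalPotential_of_tsupport_subset (hY : IsOpen Y.carrier)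
    (hr : ContinuousOn r Y.carrier) (hr0 : ∀ y ∈ Y.carrier, r y ≠ 0) {Φ : ℝ → ℝ}
    (hΦ : ContDiff ℝ ∞ Φ) (hc : HasCompactSupport Φ) (hs : tsupport Φ ⊆ Y.carrier)
    (htest : IsTestY Y (deriv Φ)) : IsTransversalPotential Y r Φ := by
  have hzero : ∀ y ∉ Y.carrier, Φ y = 0 := fun y hy =>
    image_eq_zero_of_notMem_tsupport (notMem_subset hs hy)
  have hzero_deriv : ∀ y ∉ Y.carrier, deriv Φ y = 0 := fun y hy =>
    image_eq_zero_of_notMem_tsupport (notMem_subset (tsupport_deriv_subset.trans hs) hy)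
  have hquot : tsupport (fun y => Φ y / r y) ⊆ tsupport Φ :=
    closure_mono fun y hy => (div_ne_zero_iff.1 hy).1
  refine ⟨htest, ?_, fun χ hχ => ?_⟩
  · have hcont : Continuous fun y => Φ y / r y :=
      (hΦ.continuous.continuousOn.div hr hr0).continuous_of_tsupport_subset hY (hquot.trans hs)
    exact (hcont.memLp_of_hasCompactSupport (hc.mono' (subset_closure.trans hquot))).restrict _
  have hleft : ∫ y, deriv Φ y * χ y ∂measY Y = ∫ y, deriv Φ y * χ y :=
    setIntegral_eq_integral_of_forall_compl_eq_zero fun y hy => by rw [hzero_deriv y hy, zero_mul]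
  have hright : ∫ y, (Φ y / r y) * (r y * deriv χ y) ∂measY Y = ∫ y, Φ y * deriv χ y := by
    rw [← setIntegral_eq_integral_of_forall_compl_eq_zero (s := Y.carrier)
      (f := fun y => Φ y * deriv χ y) (fun y hy => by rw [hzero y hy, zero_mul])]
    exact setIntegral_congr_fun hY.measurableSet fun y hy => by
      rw [← mul_assoc, div_mul_cancel₀ _ (hr0 y hy)]
  rw [hleft, hright,
    integral_mul_deriv_eq_deriv_mul_of_integrable (u := Φ) (v := χ), neg_neg]
  · exact fun y _ => (hΦ.differentiable (by simp) y).hasDerivAt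
  · exact fun y _ => (hχ.smooth.differentiable (by simp) y).hasDerivAt
  · exact (hΦ.continuous.mul hχ.continuous_deriv).integrable_of_hasCompactSupport hc.mul_right
  · exact ((hΦ.continuous_deriv (by simp)).mul
      hχ.smooth.continuous).integrable_of_hasCompactSupport hc.deriv.mul_right
  · exact (hΦ.continuous.mul hχ.smooth.continuous).integrable_of_hasCompactSupport hc.mul_right

theorem setIntegral_div_sq_le {f r : ℝ → ℝ} {s : Set ℝ} {a b r₀ : ℝ} (hab : a ≤ b)
    (hs : MeasurableSet s) (hsub : Icc a b ⊆ s) (hf : ∀ y, |f y| ≤ 1)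
    (hzero : ∀ y ∉ Icc a b, f y = 0) (hr₀ : 0 < r₀) (hr : ∀ y ∈ Icc a b, r₀ ≤ r y) :
    ∫ y in s, (f y / r y) ^ 2 ≤ (b - a) / r₀ ^ 2 := by
  rw [setIntegral_eq_of_subset_of_forall_sdiff_eq_zero hs hsub
    fun y hy => by simp [hzero y hy.2]]
  refine (le_abs_self _).trans ?_
  have hbound : ∀ y ∈ Icc a b, ‖(f y / r y) ^ 2‖ ≤ 1 / r₀ ^ 2 := fun y hy => by
    rw [norm_pow, Real.norm_eq_abs, sq_abs, div_pow]
    have hfy : f y ^ 2 ≤ 1 := (sq_le_one_iff_abs_le_one _).2 (hf y)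
    have hry := hr y hy
    gcongr
  refine (norm_setIntegral_le_of_norm_le_const (by simp) hbound).trans_eq ?_
  rw [Real.volume_real_Icc_of_le hab]
  ring

theorem exists_small_potential_of_bump (hY : IsOpen Y.carrier)
    (htest : ∀ ψ, ContDiff ℝ ∞ ψ → HasCompactSupport ψ → tsupport ψ ⊆ Y.carrier → IsTestY Y ψ)
    (hr : ContinuousOn r Y.carrier) (hrpos : ∀ y ∈ Y.carrier, 0 < r y)
    (hsub : Icc (1 / 2) (3 / 2) ⊆ Y.carrier) {δ : ℝ} (hδ : 0 < δ) :
    ∃ Φ, IsTransversalPotential Y r Φ ∧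
      ∫ y, (Φ y / r y) ^ 2 ∂measY Y < δ * ∫ y, deriv Φ y ^ 2 ∂measY Y := by
  obtain ⟨y₀, hy₀, hmin⟩ := (isCompact_Icc (a := (1 / 2 : ℝ)) (b := 3 / 2)).exists_isMinOn
    (nonempty_Icc.2 (by norm_num)) (hr.mono hsub)
  have hr₀ : 0 < r y₀ := hrpos y₀ (hsub hy₀)
  set t := min (1 / 2) (r y₀ * √δ / 2)
  have ht : 0 < t := by positivity
  have hIcc : Icc (1 - t) (1 + t) ⊆ Icc (1 / 2) (3 / 2) := by
    have : t ≤ 1 / 2 := min_le_left _ _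
    exact Icc_subset_Icc (by linarith) (by linarith)
  let f : ContDiffBump (1 : ℝ) := ⟨t / 2, t, half_pos ht, half_lt_self ht⟩
  have htsupport : tsupport f = Icc (1 - t) (1 + t) := by
    rw [f.tsupport_eq, Real.closedBall_eq_Icc]
  have hs : tsupport f ⊆ Y.carrier := htsupport.subset.trans (hIcc.trans hsub)
  have hupper : ∫ y, (f y / r y) ^ 2 ∂measY Y ≤ 2 * t / r y₀ ^ 2 :=
    (setIntegral_div_sq_le (by linarith) hY.measurableSet (hIcc.trans hsub)
      (fun y => (abs_of_nonneg f.nonneg).trans_le f.le_one)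
      (fun y hy => image_eq_zero_of_notMem_tsupport (by rwa [htsupport])) hr₀
      fun y hy => hmin (hIcc hy)).trans_eq (by ring)
  have hlower : 1 / t ≤ ∫ y, deriv f y ^ 2 ∂measY Y := by
    have hrise := sq_sub_le_mul_integral_deriv_sq (f.contDiff (n := 1)) (sub_le_self 1 ht.le)
    rw [f.one_of_mem_closedBall (Metric.mem_closedBall_self f.rIn_pos.le),
      f.zero_of_le_dist (by simp [abs_of_pos ht, f]), intervalIntegral.integral_of_le
      (sub_le_self 1 ht.le)] at hrise
    have hint : Integrable (fun y => deriv f y ^ 2) (measY Y) :=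
      (((f.contDiff (n := 1)).continuous_deriv le_rfl).memLp_of_hasCompactSupport
        f.hasCompactSupport.deriv (p := 2)).integrable_sq.restrict
    have hmono : ∫ y in Ioc (1 - t) 1, deriv f y ^ 2 ≤ ∫ y, deriv f y ^ 2 ∂measY Y :=
      setIntegral_mono_set hint (.of_forall fun y => sq_nonneg _)
        (Ioc_subset_Icc_self.trans ((Icc_subset_Icc_right (by linarith)).trans
          (hIcc.trans hsub))).eventuallyLE
    rw [div_le_iff₀ ht]
    nlinarith
  have hsmall : 2 * t / r y₀ ^ 2 < δ * (1 / t) := by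
    have : t ^ 2 ≤ (r y₀ * √δ / 2) ^ 2 := pow_le_pow_left₀ ht.le (min_le_right _ _) 2
    rw [div_pow, mul_pow, Real.sq_sqrt hδ.le] at this
    rw [mul_one_div, div_lt_div_iff₀ (by positivity) ht]
    nlinarith [mul_pos (pow_pos hr₀ 2) hδ]
  refine ⟨f, isTransversalPotential_of_tsupport_subset hY hr (fun y hy => (hrpos y hy).ne')
    f.contDiff f.hasCompactSupport hs (htest _ f.contDiff.deriv' f.hasCompactSupport.deriv
      (tsupport_deriv_subset.trans hs)), ?_⟩
  exact hupper.trans_lt (hsmall.trans_le (by gcongr))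

end Bump

section Circle

theorem integral_measY_circle (f : ℝ → ℝ) :
    ∫ y, f y ∂measY .circle = ∫ y in (0)..(2 * Real.pi), f y := by
  rw [intervalIntegral.integral_of_le Real.two_pi_pos.le, ← integral_Ico_eq_integral_Ioc]
  rfl

theorem hasDerivAt_sin_mul_div {c : ℝ} (hc : c ≠ 0) (y : ℝ) :
    HasDerivAt (fun y => Real.sin (c * y) / c) (Real.cos (c * y)) y := by
  have := (((hasDerivAt_id y).const_mul c).sin).div_const c
  rwa [mul_one, mul_div_cancel_right₀ _ hc] at this

theorem isTransversalPotential_sin {r : ℝ → ℝ} (hr : IsTransversalCoeff .circle r) {n : ℕ}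
    (hn : n ≠ 0) : IsTransversalPotential .circle r fun y => Real.sin (n * y) / n := by
  obtain ⟨hrsmooth, -, hrpos⟩ := hr
  have hderiv := hasDerivAt_sin_mul_div (Nat.cast_ne_zero (R := ℝ).2 hn)
  have hderiv_eq : deriv (fun y : ℝ => Real.sin (n * y) / n) = fun y => Real.cos (n * y) :=
    funext fun y => (hderiv y).deriv
  refine ⟨?_, memLp_circle_of_continuous
    (Continuous.div (by fun_prop) hrsmooth.continuous fun y => (hrpos y).ne'), fun χ hχ => ?_⟩
  · rw [hderiv_eq]
    exact ⟨by fun_prop, fun y => by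
      simp only [mul_add, Real.cos_add_nat_mul_two_pi]⟩
  have hcancel : ∀ y, (Real.sin (n * y) / n / r y) * (r y * deriv χ y)
      = Real.sin (n * y) / n * deriv χ y := fun y => by
    rw [← mul_assoc, div_mul_cancel₀ _ (hrpos y).ne']
  simp only [hderiv_eq, hcancel, integral_measY_circle]
  rw [intervalIntegral.integral_mul_deriv_eq_deriv_mul (fun y _ => hderiv y)
    (fun y _ => (hχ.smooth.differentiable (by simp) y).hasDerivAt)
    (Continuous.intervalIntegrable (by fun_prop) _ _) (hχ.continuous_deriv.intervalIntegrable _ _),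
    Real.sin_periodic.nat_mul_eq]
  simp

theorem integral_cos_nat_mul_sq {n : ℕ} (hn : n ≠ 0) :
    ∫ y in (0)..(2 * Real.pi), Real.cos (n * y) ^ 2 = Real.pi := by
  have hn' : (n : ℝ) ≠ 0 := Nat.cast_ne_zero.2 hn
  rw [intervalIntegral.integral_comp_mul_left (fun y => Real.cos y ^ 2) hn', integral_cos_sq,
    Real.sin_periodic.nat_mul_eq]
  simp only [mul_zero, Real.sin_zero, sub_zero, zero_add, smul_eq_mul]
  field_simp

theorem exists_small_potential_circle {r : ℝ → ℝ} (hr : IsTransversalCoeff .circle r)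
    {δ : ℝ} (hδ : 0 < δ) :
    ∃ Φ, IsTransversalPotential .circle r Φ ∧
      ∫ y, (Φ y / r y) ^ 2 ∂measY .circle < δ * ∫ y, deriv Φ y ^ 2 ∂measY .circle := by
  obtain ⟨y₀, -, hmin⟩ := (isCompact_Icc (a := (0 : ℝ)) (b := 2 * Real.pi)).exists_isMinOn
    (nonempty_Icc.2 Real.two_pi_pos.le) hr.1.continuous.continuousOn
  have hr₀ : 0 < r y₀ := hr.2.2 y₀
  obtain ⟨m, hm⟩ := exists_nat_gt (2 / (δ * r y₀ ^ 2))
  have hn : m + 1 ≠ 0 := m.succ_ne_zero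
  refine ⟨_, isTransversalPotential_sin hr hn, ?_⟩
  generalize hN : (m + 1 : ℕ) = n at hn ⊢
  have hn1 : (1 : ℝ) ≤ n := by exact_mod_cast Nat.one_le_iff_ne_zero.2 hn
  have hδn : 2 / (r y₀ * n) ^ 2 < δ := by
    have hlt : 2 / (δ * r y₀ ^ 2) < n := hm.trans (by simp [← hN])
    rw [div_lt_iff₀ (by positivity)] at hlt ⊢
    nlinarith [mul_pos hδ (pow_pos hr₀ 2)]
  have hupper : ∫ y, (Real.sin (n * y) / n / r y) ^ 2 ∂measY .circle
      ≤ 2 * Real.pi * (1 / (r y₀ * n) ^ 2) := by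
    rw [integral_measY_circle]
    refine (Real.le_norm_self _).trans ((intervalIntegral.norm_integral_le_of_norm_le_const
      (C := 1 / (r y₀ * n) ^ 2) fun y hy => ?_).trans_eq ?_)
    · have hry : r y₀ ≤ r y := hmin (Ioc_subset_Icc_self (uIoc_of_le Real.two_pi_pos.le ▸ hy))
      rw [norm_pow, Real.norm_eq_abs, sq_abs, div_div, div_pow, mul_comm (n : ℝ) (r y)]
      have : Real.sin (n * y) ^ 2 ≤ 1 := Real.sin_sq_le_one _
      gcongr
    · rw [sub_zero, abs_of_pos Real.two_pi_pos, mul_comm]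
  calc ∫ y, (Real.sin (n * y) / n / r y) ^ 2 ∂measY .circle
      ≤ 2 * Real.pi * (1 / (r y₀ * n) ^ 2) := hupper
    _ = Real.pi * (2 / (r y₀ * n) ^ 2) := by ring
    _ < Real.pi * δ := by gcongr
    _ = δ * ∫ y, deriv (fun y : ℝ => Real.sin (n * y) / n) y ^ 2 ∂measY .circle := by
      simp only [integral_measY_circle, integral_cos_nat_mul_sq hn, mul_comm δ,
        (hasDerivAt_sin_mul_div (Nat.cast_ne_zero (R := ℝ).2 hn) _).deriv]

end Circle

theorem exists_small_potential {Y : YDomain} {r : ℝ → ℝ} (hr : IsTransversalCoeff Y r) {δ : ℝ}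
    (hδ : 0 < δ) :
    ∃ Φ, IsTransversalPotential Y r Φ ∧
      ∫ y, (Φ y / r y) ^ 2 ∂measY Y < δ * ∫ y, deriv Φ y ^ 2 ∂measY Y :=
  match Y, hr with
  | .interval, hr => exists_small_potential_of_bump (Y := .interval) isOpen_Ioo
      (fun _ hψ hc hs => ⟨hψ, hc, hs⟩) hr.1.continuousOn hr.2
      (Icc_subset_Ioo (by norm_num) (by linarith [Real.pi_gt_three])) hδ
  | .circle, hr => exists_small_potential_circle hr hδ
  | .line, hr => exists_small_potential_of_bump (Y := .line) isOpen_univ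
      (fun _ hψ hc _ => ⟨hψ, hc⟩) (funext hr ▸ continuousOn_const)
      (fun y _ => (hr y).symm ▸ one_pos) (subset_univ _) hδ

theorem exists_transversal_energy_ge {Y : YDomain} {r : ℝ → ℝ} (hr : IsTransversalCoeff Y r)
    (M : ℝ) : ∃ ν ≥ M, ∀ ε > 0, ∃ ψ, IsTransversalQuasimode Y r ν ε ψ := by
  have hM : 0 < |M| + 1 := by positivity
  obtain ⟨Φ, hΦ, hsmall⟩ := exists_small_potential hr (one_div_pos.2 hM)
  obtain ⟨β, hβ, hquasi⟩ := hΦ.exists_quasimode hr (one_div_pos.2 hM) hsmall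
  have : |M| + 1 < 1 / β := (lt_one_div hM hβ.1).2 hβ.2
  exact ⟨1 / β - 1, by linarith [le_abs_self M], hquasi⟩

/-! ### Truncated Gaussians -/

section Gaussian

variable {L : ℝ}

theorem integral_measX (hL : 0 ≤ L) (f : ℝ → ℝ) : ∫ x, f x ∂measX L = ∫ x in (-L)..L, f x := by
  rw [intervalIntegral.integral_of_le (by linarith), integral_Ioc_eq_integral_Ioo]

theorem IsTestX.integral_deriv_eq_zero {φ : ℝ → ℝ} (hφ : IsTestX L φ) :
    ∫ x, deriv φ x ∂measX L = 0 := by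
  rw [setIntegral_eq_integral_of_forall_compl_eq_zero fun x hx =>
    image_eq_zero_of_notMem_tsupport (notMem_subset (tsupport_deriv_subset.trans
      hφ.tsupport_subset) hx)]
  exact integral_eq_zero_of_hasDerivAt_of_integrable
    (fun x => (hφ.differentiable x).hasDerivAt)
    (hφ.continuous_deriv.integrable_of_hasCompactSupport hφ.hasCompactSupport.deriv)
    (hφ.continuous.integrable_of_hasCompactSupport hφ.hasCompactSupport)

/-- The ground state `exp (-c x² / 2)` of `-∂_x² + c² x²`, cut off by `χ`. -/
noncomputable def cutoffGaussian (χ : ℝ → ℝ) (c x : ℝ) : ℝ := Real.exp (-(c * x ^ 2 / 2)) * χ x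

theorem cutoffGaussian_eq_zero {χ : ℝ → ℝ} {x : ℝ} (hx : χ x = 0) (c : ℝ) :
    cutoffGaussian χ c x = 0 := by
  rw [cutoffGaussian, hx, mul_zero]

theorem exp_neg_half_sq (c x : ℝ) :
    Real.exp (-(c * x ^ 2 / 2)) ^ 2 = Real.exp (-(c * x ^ 2)) := by
  rw [← Real.exp_nat_mul]
  congr 1
  push_cast
  ring

theorem IsTestX.cutoffGaussian {χ : ℝ → ℝ} (hχ : IsTestX L χ) (c : ℝ) :
    IsTestX L (cutoffGaussian χ c) :=
  hχ.mul_left (ContDiff.contDiffOn (by fun_prop))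

theorem deriv_cutoffGaussian {χ : ℝ → ℝ} {x : ℝ} (hχ : DifferentiableAt ℝ χ x) (c : ℝ) :
    deriv (cutoffGaussian χ c) x
      = Real.exp (-(c * x ^ 2 / 2)) * deriv χ x - c * x * cutoffGaussian χ c x := by
  have hexponent : HasDerivAt (fun x : ℝ => -(c * x ^ 2 / 2)) (-(c * x)) x :=
    (((hasDerivAt_pow 2 x).const_mul c).div_const 2).neg.congr_deriv (by norm_num; ring)
  refine (hexponent.exp.mul hχ.hasDerivAt).deriv.trans ?_
  rw [cutoffGaussian]
  ring

theorem integral_cutoffGaussian_energy {χ : ℝ → ℝ} (hχ : IsTestX L χ) (c : ℝ) :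
    ∫ x, (deriv (cutoffGaussian χ c) x ^ 2 + c ^ 2 * x ^ 2 * cutoffGaussian χ c x ^ 2) ∂measX L
      = ∫ x, Real.exp (-(c * x ^ 2)) * deriv χ x ^ 2 ∂measX L
        + c * ∫ x, cutoffGaussian χ c x ^ 2 ∂measX L := by
  set φ := cutoffGaussian χ c
  have hφ : IsTestX L φ := hχ.cutoffGaussian c
  have hflux : IsTestX L fun x => (x * φ x) * φ x :=
    hφ.mul_left (contDiff_id.mul hφ.smooth).contDiffOn
  have hpointwise : ∀ x, deriv φ x ^ 2 + c ^ 2 * x ^ 2 * φ x ^ 2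
      = Real.exp (-(c * x ^ 2)) * deriv χ x ^ 2 + c * φ x ^ 2
        - c * deriv (fun x => (x * φ x) * φ x) x := fun x => by
    have hflux_deriv : deriv (fun x => (x * φ x) * φ x) x
        = (1 * φ x + x * deriv φ x) * φ x + x * φ x * deriv φ x :=
      (((hasDerivAt_id x).mul (hφ.differentiable x).hasDerivAt).mul
        (hφ.differentiable x).hasDerivAt).deriv
    rw [hflux_deriv, deriv_cutoffGaussian (hχ.differentiable x), ← exp_neg_half_sq]
    ring
  have hcut : Integrable (fun x => Real.exp (-(c * x ^ 2)) * deriv χ x ^ 2) (measX L) := by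
    have := (hχ.memLp_deriv 2).integrable_sq.bdd_mul (c := Real.exp (|c| * L ^ 2))
      (Continuous.aestronglyMeasurable (by fun_prop : Continuous fun x => Real.exp (-(c * x ^ 2))))
      (ae_restrict_of_forall_mem measurableSet_Ioo fun x hx => by
        rw [Real.norm_eq_abs, Real.abs_exp, Real.exp_le_exp]
        have hx2 : x ^ 2 ≤ L ^ 2 := sq_le_sq' hx.1.le hx.2.le
        nlinarith [neg_abs_le c, abs_nonneg c, sq_nonneg x])
    exact this
  have hφ2 := (hφ.memLp 2).integrable_sq
  have hflux_int := memLp_one_iff_integrable.1 (hflux.memLp_deriv 1)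
  have hsum : Integrable (fun x => Real.exp (-(c * x ^ 2)) * deriv χ x ^ 2 + c * φ x ^ 2)
      (measX L) := hcut.add (hφ2.const_mul c)
  simp only [hpointwise]
  rw [integral_sub hsum (hflux_int.const_mul c), integral_add hcut (hφ2.const_mul c),
    integral_const_mul, integral_const_mul, hflux.integral_deriv_eq_zero, mul_zero, sub_zero]

theorem le_integral_cutoffGaussian_sq {χ : ℝ → ℝ} (hχ : IsTestX L χ) {s c : ℝ} (hs : 0 ≤ s)
    (hsL : s ≤ L) (hc : 0 ≤ c) (hone : ∀ x, |x| ≤ s → χ x = 1) :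
    2 * s * Real.exp (-(c * s ^ 2)) ≤ ∫ x, cutoffGaussian χ c x ^ 2 ∂measX L := by
  have hcont : Continuous fun x => cutoffGaussian χ c x ^ 2 :=
    (hχ.cutoffGaussian c).continuous.pow 2
  calc 2 * s * Real.exp (-(c * s ^ 2)) = ∫ x in (-s)..s, Real.exp (-(c * s ^ 2)) := by
        rw [intervalIntegral.integral_const, smul_eq_mul]
        ring
    _ ≤ ∫ x in (-s)..s, cutoffGaussian χ c x ^ 2 := by
        refine intervalIntegral.integral_mono_on (by linarith) (by simp)
          (hcont.intervalIntegrable _ _) fun x hx => ?_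
        rw [cutoffGaussian, hone x (abs_le.2 hx), mul_one, exp_neg_half_sq]
        have hx2 : x ^ 2 ≤ s ^ 2 := sq_le_sq' hx.1 hx.2
        gcongr
    _ ≤ ∫ x in (-L)..L, cutoffGaussian χ c x ^ 2 :=
        intervalIntegral.integral_mono_interval (by linarith) (by linarith) hsL
          (.of_forall fun x => sq_nonneg _) (hcont.intervalIntegrable _ _)
    _ = ∫ x, cutoffGaussian χ c x ^ 2 ∂measX L := (integral_measX (hs.trans hsL) _).symm

theorem integral_exp_mul_deriv_sq_le {χ : ℝ → ℝ} {s c M : ℝ} (hL : 0 ≤ L) (hs : 0 ≤ s)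
    (hc : 0 ≤ c) (hzero : ∀ x, |x| < s → deriv χ x = 0) (hM : ∀ x, |deriv χ x| ≤ M) :
    ∫ x, Real.exp (-(c * x ^ 2)) * deriv χ x ^ 2 ∂measX L
      ≤ 2 * L * (M ^ 2 * Real.exp (-(c * s ^ 2))) := by
  have hbound : ∀ x ∈ Ioo (-L) L, ‖Real.exp (-(c * x ^ 2)) * deriv χ x ^ 2‖
      ≤ M ^ 2 * Real.exp (-(c * s ^ 2)) := fun x _ => by
    rw [Real.norm_eq_abs, abs_of_nonneg (by positivity)]
    rcases lt_or_ge |x| s with hx | hx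
    · rw [hzero x hx, zero_pow two_ne_zero, mul_zero]
      positivity
    · have hχ2 : deriv χ x ^ 2 ≤ M ^ 2 := sq_le_sq' (abs_le.1 (hM x)).1 (abs_le.1 (hM x)).2
      have hx2 : s ^ 2 ≤ x ^ 2 := sq_abs x ▸ pow_le_pow_left₀ hs hx 2
      rw [mul_comm]
      gcongr
  refine (Real.le_norm_self _).trans
    ((norm_setIntegral_le_of_norm_le_const (by simp) hbound).trans_eq ?_)
  rw [Real.volume_real_Ioo_of_le (by linarith)]
  ring

theorem exists_cutoffGaussian_energy_le {s : ℝ} (hs : 0 < s) (hsL : 2 * s < L) :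
    ∃ C ≥ 0, ∀ c ≥ 0, ∃ φ, IsTestX L φ ∧ (∀ x, 2 * s ≤ |x| → φ x = 0) ∧
      0 < ∫ x, φ x ^ 2 ∂measX L ∧
      ∫ x, (deriv φ x ^ 2 + c ^ 2 * x ^ 2 * φ x ^ 2) ∂measX L
        ≤ (c + C) * ∫ x, φ x ^ 2 ∂measX L := by
  have hL : 0 < L := by linarith
  let χ : ContDiffBump (0 : ℝ) := ⟨s, 2 * s, hs, by linarith⟩
  have hzero : ∀ x, 2 * s ≤ |x| → χ x = 0 := fun x hx => χ.zero_of_le_dist (by simpa using hx)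
  have hone : ∀ x, |x| ≤ s → χ x = 1 := fun x hx => χ.one_of_mem_closedBall (by simpa using hx)
  have hχ : IsTestX L χ := ⟨χ.contDiff, 2 * s, hsL, hzero⟩
  have hderiv_zero : ∀ x, |x| < s → deriv χ x = 0 := fun x hx => by
    have : χ =ᶠ[𝓝 x] fun _ => (1 : ℝ) := by
      filter_upwards [(isOpen_lt continuous_abs continuous_const).mem_nhds hx] with y hy
      exact hone y hy.le
    rw [this.deriv_eq, deriv_const]
  obtain ⟨M, hM⟩ :=
    hχ.continuous_deriv.bounded_above_of_compact_support hχ.hasCompactSupport.deriv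
  refine ⟨L * M ^ 2 / s, by positivity, fun c hc => ⟨cutoffGaussian χ c, hχ.cutoffGaussian c,
    fun x hx => cutoffGaussian_eq_zero (hzero x hx) c, ?_, ?_⟩⟩
  all_goals have hmass := le_integral_cutoffGaussian_sq hχ hs.le (by linarith) hc hone
  · exact lt_of_lt_of_le (by positivity) hmass
  rw [integral_cutoffGaussian_energy hχ, add_comm c, add_mul]
  gcongr
  calc ∫ x, Real.exp (-(c * x ^ 2)) * deriv χ x ^ 2 ∂measX L
      ≤ 2 * L * (M ^ 2 * Real.exp (-(c * s ^ 2))) :=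
        integral_exp_mul_deriv_sq_le hL.le hs.le hc hderiv_zero hM
    _ = L * M ^ 2 / s * (2 * s * Real.exp (-(c * s ^ 2))) := by field_simp
    _ ≤ L * M ^ 2 / s * ∫ x, cutoffGaussian χ c x ^ 2 ∂measX L := by gcongr

end Gaussian

/-! ### Longitudinal quasimodes -/

section BilinForm

variable {E : Type*} [AddCommGroup E] [Module ℝ E] {a m : LinearMap.BilinForm ℝ E}

theorem exists_ground_energy {c Λ : ℝ} (hm : ∀ φ, 0 ≤ m φ φ) (hc : ∀ φ, -c * m φ φ ≤ a φ φ)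
    (hΛ : ∃ φ, 0 < m φ φ ∧ a φ φ ≤ Λ * m φ φ) :
    ∃ l ∈ Icc (-c) Λ, (∀ χ, l * m χ χ ≤ a χ χ) ∧ ∀ ε > 0, ∃ φ, m φ φ = 1 ∧ a φ φ ≤ l + ε := by
  let quotients : Set ℝ := {t | ∃ φ, 0 < m φ φ ∧ a φ φ / m φ φ = t}
  have hlower : -c ∈ lowerBounds quotients := by
    rintro _ ⟨φ, hφ, rfl⟩
    exact (le_div_iff₀ hφ).2 (hc φ)
  have hbdd : BddBelow quotients := ⟨-c, hlower⟩
  obtain ⟨φ₀, hφ₀, hle⟩ := hΛ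
  have hne : quotients.Nonempty := ⟨_, φ₀, hφ₀, rfl⟩
  refine ⟨sInf quotients, ⟨le_csInf hne hlower, csInf_le_of_le hbdd ⟨φ₀, hφ₀, rfl⟩
    ((div_le_iff₀ hφ₀).2 hle)⟩, fun χ => ?_, fun ε hε => ?_⟩
  · rcases (hm χ).eq_or_lt with hzero | hpos
    · simpa [← hzero] using hc χ
    · exact (le_div_iff₀ hpos).1 (csInf_le hbdd ⟨χ, hpos, rfl⟩)
  · obtain ⟨_, ⟨φ, hφ, rfl⟩, hlt⟩ := exists_lt_of_csInf_lt hne (lt_add_of_pos_right _ hε)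
    have hsq : (√(m φ φ))⁻¹ * (√(m φ φ))⁻¹ = (m φ φ)⁻¹ := by
      rw [← mul_inv, Real.mul_self_sqrt hφ.le]
    refine ⟨(√(m φ φ))⁻¹ • φ, ?_, ?_⟩ <;>
      simp only [map_smul, LinearMap.smul_apply, smul_eq_mul, ← mul_assoc, hsq]
    · exact inv_mul_cancel₀ hφ.ne'
    · rw [inv_mul_eq_div]
      exact hlt.le

theorem sq_apply_sub_mul_le_of_near_min (ha : a.IsSymm) (hm : m.IsSymm) {l ε : ℝ}
    (hl : ∀ χ, l * m χ χ ≤ a χ χ) {φ : E} (hφ : m φ φ = 1) (hφε : a φ φ ≤ l + ε) (χ : E) :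
    (a φ χ - l * m φ χ) ^ 2 ≤ ε * (a χ χ - l * m χ χ) := by
  have hcauchy : (a φ χ - l * m φ χ) ^ 2 ≤ (a φ φ - l * m φ φ) * (a χ χ - l * m χ χ) :=
    LinearMap.BilinForm.apply_sq_le_of_symm (a - l • m) (fun φ => sub_nonneg.2 (hl φ))
      ⟨(ha.sub (hm.smul l)).eq⟩ φ χ
  refine hcauchy.trans (mul_le_mul_of_nonneg_right ?_ (sub_nonneg.2 (hl χ)))
  rw [hφ]
  linarith

end BilinForm

/-- The form `∫ φ' χ' + P φ χ` of `-∂_x² + P` on `(-L, L)`. -/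
noncomputable def formX (L : ℝ) (P φ χ : ℝ → ℝ) : ℝ :=
  ∫ x, (deriv φ x * deriv χ x + P x * (φ x * χ x)) ∂measX L

section FormX

variable {L : ℝ} {P φ χ : ℝ → ℝ}

theorem IsTestX.integrable_mul (hφ : IsTestX L φ) (hχ : IsTestX L χ) :
    Integrable (fun x => φ x * χ x) (measX L) :=
  (hφ.memLp 2).integrable_mul (hχ.memLp 2)

theorem IsTestX.integrable_sq (hφ : IsTestX L φ) : Integrable (fun x => φ x ^ 2) (measX L) :=
  (hφ.memLp 2).integrable_sq

theorem IsTestX.integrable_deriv_sq (hφ : IsTestX L φ) :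
    Integrable (fun x => deriv φ x ^ 2) (measX L) :=
  (hφ.memLp_deriv 2).integrable_sq

theorem IsTestX.integrable_potential_mul (hP : MemLp P ⊤ (measX L)) (hφ : IsTestX L φ)
    (hχ : IsTestX L χ) : Integrable (fun x => P x * (φ x * χ x)) (measX L) :=
  MemLp.integrable_mul hP (memLp_one_iff_integrable.2 (hφ.integrable_mul hχ))

theorem IsTestX.integrable_formX (hP : MemLp P ⊤ (measX L)) (hφ : IsTestX L φ)
    (hχ : IsTestX L χ) :
    Integrable (fun x => deriv φ x * deriv χ x + P x * (φ x * χ x)) (measX L) :=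
  ((hφ.memLp_deriv 2).integrable_mul (hχ.memLp_deriv 2)).add (hφ.integrable_potential_mul hP hχ)

theorem formX_comm (φ χ : ℝ → ℝ) : formX L P φ χ = formX L P χ φ := by
  simp only [formX, mul_comm]

theorem IsTestX.formX_self (hP : MemLp P ⊤ (measX L)) (hφ : IsTestX L φ) :
    formX L P φ φ = ∫ x, deriv φ x ^ 2 ∂measX L + ∫ x, P x * φ x ^ 2 ∂measX L := by
  simp only [formX, ← sq]
  exact integral_add hφ.integrable_deriv_sq
    (by simpa only [sq] using hφ.integrable_potential_mul hP hφ)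

/-- The bilinear form `∫ φ χ` on the test functions on `(-L, L)`. -/
noncomputable def massFormX (L : ℝ) : LinearMap.BilinForm ℝ (testX L) :=
  LinearMap.mk₂ ℝ (fun φ χ => ∫ x, φ.1 x * χ.1 x ∂measX L)
    (fun φ₁ φ₂ χ => by
      rw [← integral_add (φ₁.2.integrable_mul χ.2) (φ₂.2.integrable_mul χ.2)]
      simp [add_mul])
    (fun c φ χ => by simp [mul_assoc, integral_const_mul])
    (fun φ χ₁ χ₂ => by
      rw [← integral_add (φ.2.integrable_mul χ₁.2) (φ.2.integrable_mul χ₂.2)]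
      simp [mul_add])
    (fun c φ χ => by simp [mul_left_comm, integral_const_mul])

theorem formX_add_left {φ₁ φ₂ : ℝ → ℝ} (hP : MemLp P ⊤ (measX L)) (hφ₁ : IsTestX L φ₁)
    (hφ₂ : IsTestX L φ₂) (hχ : IsTestX L χ) :
    formX L P (φ₁ + φ₂) χ = formX L P φ₁ χ + formX L P φ₂ χ := by
  rw [formX, formX, formX, ← integral_add (hφ₁.integrable_formX hP hχ)
    (hφ₂.integrable_formX hP hχ)]
  refine integral_congr_ae (.of_forall fun x => ?_)
  simp only [deriv_add (hφ₁.differentiable x) (hφ₂.differentiable x), Pi.add_apply]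
  ring

theorem formX_smul_left (c : ℝ) (φ χ : ℝ → ℝ) : formX L P (c • φ) χ = c * formX L P φ χ := by
  rw [formX, formX, ← integral_const_mul]
  refine integral_congr_ae (.of_forall fun x => ?_)
  simp only [deriv_const_smul_field, Pi.smul_apply, smul_eq_mul]
  ring

/-- `formX` as a bilinear form on the test functions, for a bounded potential. -/
noncomputable def energyFormX (hP : MemLp P ⊤ (measX L)) : LinearMap.BilinForm ℝ (testX L) :=
  LinearMap.mk₂ ℝ (fun φ χ => formX L P φ.1 χ.1)
    (fun φ₁ φ₂ χ => formX_add_left hP φ₁.2 φ₂.2 χ.2)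
    (fun c φ χ => formX_smul_left c φ.1 χ.1)
    (fun φ χ₁ χ₂ => by
      simp only [formX_comm φ.1]
      exact formX_add_left hP χ₁.2 χ₂.2 φ.2)
    (fun c φ χ => by
      simp only [formX_comm φ.1]
      exact formX_smul_left c χ.1 φ.1)

theorem isSymm_massFormX (L : ℝ) : (massFormX L).IsSymm :=
  ⟨fun φ χ => by simp [massFormX, mul_comm]⟩

theorem isSymm_energyFormX (hP : MemLp P ⊤ (measX L)) : (energyFormX hP).IsSymm :=
  ⟨fun φ χ => formX_comm φ.1 χ.1⟩

theorem massFormX_self (φ : testX L) : massFormX L φ φ = ∫ x, φ.1 x ^ 2 ∂measX L := by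
  simp [massFormX, sq]

theorem IsTestX.neg_mul_le_integral_potential {v : ℝ} (hP : MemLp P ⊤ (measX L))
    (hv : ∀ᵐ x ∂measX L, -v ≤ P x) (hφ : IsTestX L φ) :
    -v * ∫ x, φ x ^ 2 ∂measX L ≤ ∫ x, P x * φ x ^ 2 ∂measX L := by
  rw [← integral_const_mul]
  refine integral_mono_ae (hφ.integrable_sq.const_mul _)
    (by simpa only [sq] using hφ.integrable_potential_mul hP hφ) ?_
  filter_upwards [hv] with x hx
  gcongr

theorem IsTestX.integral_deriv_sq_le {v : ℝ} (hP : MemLp P ⊤ (measX L))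
    (hv : ∀ᵐ x ∂measX L, -v ≤ P x) (hφ : IsTestX L φ) :
    ∫ x, deriv φ x ^ 2 ∂measX L ≤ formX L P φ φ + v * ∫ x, φ x ^ 2 ∂measX L := by
  rw [hφ.formX_self hP]
  linarith [hφ.neg_mul_le_integral_potential hP hv]

theorem IsTestX.formX_sub_le {c : ℝ} (hP : MemLp P ⊤ (measX L)) (hc0 : 0 ≤ c)
    (hc : ∀ᵐ x ∂measX L, P x ≤ c) (l : ℝ) (hχ : IsTestX L χ) :
    formX L P χ χ - l * ∫ x, χ x ^ 2 ∂measX L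
      ≤ (c + |l| + 1) * (∫ x, χ x ^ 2 ∂measX L + ∫ x, deriv χ x ^ 2 ∂measX L) := by
  have hpotential : ∫ x, P x * χ x ^ 2 ∂measX L ≤ c * ∫ x, χ x ^ 2 ∂measX L := by
    rw [← integral_const_mul]
    refine integral_mono_ae (by simpa only [sq] using hχ.integrable_potential_mul hP hχ)
      (hχ.integrable_sq.const_mul _) ?_
    filter_upwards [hc] with x hx
    gcongr
  have hmass : 0 ≤ ∫ x, χ x ^ 2 ∂measX L := integral_nonneg fun x => sq_nonneg _
  have hderiv : 0 ≤ ∫ x, deriv χ x ^ 2 ∂measX L := integral_nonneg fun x => sq_nonneg _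
  rw [hχ.formX_self hP]
  nlinarith [mul_le_mul_of_nonneg_right (neg_le_abs l) hmass,
    mul_nonneg (add_nonneg hc0 (abs_nonneg l)) hderiv]

end FormX

/-- A normalised test function that solves `-φ'' + P φ = l φ` up to an error of size at most `ε` in
the dual of `H¹₀(-L, L)`. -/
structure IsLongitudinalQuasimode (L : ℝ) (P : ℝ → ℝ) (l ε : ℝ) (φ : ℝ → ℝ) : Prop where
  test : IsTestX L φ
  normalized : ∫ x, φ x ^ 2 ∂measX L = 1
  form_error_sq_le : ∀ χ, IsTestX L χ → (formX L P φ χ - l * ∫ x, φ x * χ x ∂measX L) ^ 2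
    ≤ ε ^ 2 * (∫ x, χ x ^ 2 ∂measX L + ∫ x, deriv χ x ^ 2 ∂measX L)

section GroundEnergy

variable {L : ℝ} {P : ℝ → ℝ}

theorem exists_ae_abs_le {α : Type*} [MeasurableSpace α] {μ : Measure α} {V : α → ℝ}
    (hV : MemLp V ⊤ μ) : ∃ v ≥ 0, ∀ᵐ x ∂μ, |V x| ≤ v := by
  have hfinite : eLpNormEssSup V μ ≠ ⊤ := eLpNorm_exponent_top (f := V) (μ := μ) ▸ hV.2.ne
  refine ⟨(eLpNormEssSup V μ).toReal, ENNReal.toReal_nonneg, ?_⟩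
  filter_upwards [enorm_ae_le_eLpNormEssSup V μ] with x hx
  rw [← Real.norm_eq_abs, ← toReal_enorm]
  exact ENNReal.toReal_mono hfinite hx

theorem exists_longitudinalQuasimode_of_energy_le (hP : MemLp P ⊤ (measX L)) {v Λ : ℝ}
    (hv : ∀ᵐ x ∂measX L, -v ≤ P x)
    (hΛ : ∃ φ, IsTestX L φ ∧ 0 < ∫ x, φ x ^ 2 ∂measX L ∧
      formX L P φ φ ≤ Λ * ∫ x, φ x ^ 2 ∂measX L) :
    ∃ l ∈ Icc (-v) Λ, ∀ ε > 0, ∃ φ, IsLongitudinalQuasimode L P l ε φ ∧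
      ∫ x, deriv φ x ^ 2 ∂measX L ≤ l + 1 + v := by
  obtain ⟨c, hc0, hc⟩ := exists_ae_abs_le hP
  have hlower (φ : testX L) : -v * massFormX L φ φ ≤ energyFormX hP φ φ := by
    rw [massFormX_self]
    have hderiv : 0 ≤ ∫ x, deriv φ.1 x ^ 2 ∂measX L := integral_nonneg fun x => sq_nonneg _
    linarith [φ.2.neg_mul_le_integral_potential hP hv, φ.2.formX_self hP,
      show energyFormX hP φ φ = formX L P φ.1 φ.1 from rfl]
  obtain ⟨φ₀, hφ₀, hpos, hle⟩ := hΛ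
  obtain ⟨l, hl, hmin, hnear⟩ := exists_ground_energy
    (fun φ => (massFormX_self φ).symm ▸ integral_nonneg fun x => sq_nonneg _) hlower
    ⟨⟨φ₀, hφ₀⟩, by rwa [massFormX_self], by rwa [massFormX_self]⟩
  refine ⟨l, hl, fun ε hε => ?_⟩
  obtain ⟨φ, hone, henergy⟩ := hnear (min 1 (ε ^ 2 / (c + |l| + 1))) (by positivity)
  have hone' : ∫ x, φ.1 x ^ 2 ∂measX L = 1 := massFormX_self φ ▸ hone
  refine ⟨φ, ⟨φ.2, hone', fun χ hχ => ?_⟩, ?_⟩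
  · have hcauchy := sq_apply_sub_mul_le_of_near_min (isSymm_energyFormX hP) (isSymm_massFormX L)
      hmin hone henergy ⟨χ, hχ⟩
    have hgap := sub_nonneg.2 (hmin ⟨χ, hχ⟩)
    rw [massFormX_self] at hcauchy hgap
    calc _ ≤ min 1 (ε ^ 2 / (c + |l| + 1)) * (formX L P χ χ - l * ∫ x, χ x ^ 2 ∂measX L) := hcauchy
      _ ≤ ε ^ 2 / (c + |l| + 1) * ((c + |l| + 1) *
            (∫ x, χ x ^ 2 ∂measX L + ∫ x, deriv χ x ^ 2 ∂measX L)) :=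
          mul_le_mul (min_le_right _ _)
            (hχ.formX_sub_le hP hc0 (hc.mono fun x hx => (le_abs_self _).trans hx) l) hgap
            (by positivity)
      _ = _ := by field_simp
  · have hderiv := φ.2.integral_deriv_sq_le hP hv
    have henergy' : formX L P φ.1 φ.1 ≤ l + min 1 (ε ^ 2 / (c + |l| + 1)) := henergy
    rw [hone'] at hderiv
    linarith [min_le_left 1 (ε ^ 2 / (c + |l| + 1))]

theorem exists_test_formX_le {s : ℝ} (hs : 0 < s) (hsL : 2 * s < L) :
    ∃ C ≥ 0, ∀ c ≥ 0, ∀ v P, MemLp P ⊤ (measX L) →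
      (∀ᵐ x ∂measX L, |x| < 2 * s → P x ≤ v + c ^ 2 * x ^ 2) →
      ∃ φ, IsTestX L φ ∧ 0 < ∫ x, φ x ^ 2 ∂measX L ∧
        formX L P φ φ ≤ (c + C + v) * ∫ x, φ x ^ 2 ∂measX L := by
  obtain ⟨C, hC, hgauss⟩ := exists_cutoffGaussian_energy_le hs hsL
  refine ⟨C, hC, fun c hc v P hP hPle => ?_⟩
  obtain ⟨φ, hφ, hzero, hpos, henergy⟩ := hgauss c hc
  refine ⟨φ, hφ, hpos, ?_⟩
  have hharmonic : IsTestX L fun x => c * x * φ x :=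
    hφ.mul_left (contDiff_const.mul contDiff_id).contDiffOn
  have hint : Integrable (fun x => deriv φ x ^ 2 + c ^ 2 * x ^ 2 * φ x ^ 2) (measX L) := by
    simpa only [mul_pow] using! hφ.integrable_deriv_sq.add hharmonic.integrable_sq
  calc formX L P φ φ
      ≤ ∫ x, ((deriv φ x ^ 2 + c ^ 2 * x ^ 2 * φ x ^ 2) + v * φ x ^ 2) ∂measX L := by
        refine integral_mono_ae (hφ.integrable_formX hP hφ)
          (hint.add (hφ.integrable_sq.const_mul v)) ?_
        filter_upwards [hPle] with x hx
        rcases lt_or_ge |x| (2 * s) with hxs | hxs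
        · nlinarith [mul_le_mul_of_nonneg_right (hx hxs) (sq_nonneg (φ x))]
        · simp [hzero x hxs, sq]
    _ ≤ (c + C + v) * ∫ x, φ x ^ 2 ∂measX L := by
        rw [integral_add hint (hφ.integrable_sq.const_mul v), integral_const_mul]
        linarith

end GroundEnergy

/-! ### Agmon estimates -/

section Agmon

variable {L : ℝ} {P θ φ : ℝ → ℝ}

theorem hasDerivAt_of_contDiffOn_Ioo (hθ : ContDiffOn ℝ ∞ θ (Ioo (-L) L)) {x : ℝ}
    (hx : x ∈ Ioo (-L) L) : HasDerivAt θ (deriv θ x) x :=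
  ((hθ.contDiffAt (isOpen_Ioo.mem_nhds hx)).differentiableAt (by simp)).hasDerivAt

theorem IsTestX.exp_mul (hθ : ContDiffOn ℝ ∞ θ (Ioo (-L) L)) (hφ : IsTestX L φ) :
    IsTestX L fun x => Real.exp (2 * θ x) * φ x :=
  hφ.mul_left (contDiffOn_const.mul hθ).exp

theorem IsTestX.deriv_exp_mul (hθ : ContDiffOn ℝ ∞ θ (Ioo (-L) L)) (hφ : IsTestX L φ) {x : ℝ}
    (hx : x ∈ Ioo (-L) L) :
    deriv (fun x => Real.exp (2 * θ x) * φ x) x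
      = Real.exp (2 * θ x) * (deriv φ x + 2 * deriv θ x * φ x) := by
  refine ((((hasDerivAt_of_contDiffOn_Ioo hθ hx).const_mul 2).exp).mul
    (hφ.differentiable x).hasDerivAt).deriv.trans ?_
  ring

theorem IsTestX.integrable_agmon (hP : MemLp P ⊤ (measX L)) (hφ : IsTestX L φ)
    (hθ : ContDiffOn ℝ ∞ θ (Ioo (-L) L)) (l : ℝ) :
    Integrable (fun x => (P x - l - deriv θ x ^ 2) * (Real.exp (2 * θ x) * φ x ^ 2))
      (measX L) := by
  have hχ := hφ.exp_mul hθ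
  have hθ' : ContDiffOn ℝ ∞ (deriv θ) (Ioo (-L) L) := hθ.deriv_of_isOpen isOpen_Ioo le_rfl
  refine ((hφ.integrable_potential_mul (hP.sub (memLp_const l)) hχ).sub
    ((hφ.mul_left hθ').integrable_mul (hχ.mul_left hθ'))).congr (.of_forall fun x => ?_)
  simp only [Pi.sub_apply]
  ring

/- Testing the equation against `χ = e^{2θ} φ` gives
`φ' χ' = (e^θ φ)'² - θ'² (e^θ φ)²` pointwise. -/
theorem IsTestX.integral_agmon_le (hP : MemLp P ⊤ (measX L)) (hφ : IsTestX L φ)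
    (hθ : ContDiffOn ℝ ∞ θ (Ioo (-L) L)) (l : ℝ) :
    ∫ x, (P x - l - deriv θ x ^ 2) * (Real.exp (2 * θ x) * φ x ^ 2) ∂measX L
      ≤ formX L P φ (fun x => Real.exp (2 * θ x) * φ x)
        - l * ∫ x, φ x * (Real.exp (2 * θ x) * φ x) ∂measX L := by
  have hχ := hφ.exp_mul hθ
  have hmass := (hφ.integrable_mul hχ).const_mul l
  rw [formX, ← integral_const_mul, ← integral_sub (hφ.integrable_formX hP hχ) hmass]
  refine integral_mono_ae (hφ.integrable_agmon hP hθ l) ((hφ.integrable_formX hP hχ).sub hmass)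
    (ae_restrict_of_forall_mem measurableSet_Ioo fun x hx => ?_)
  have hsquare : 0 ≤ Real.exp (2 * θ x) * (deriv φ x + deriv θ x * φ x) ^ 2 := by positivity
  simp only [hφ.deriv_exp_mul hθ hx]
  linarith

theorem IsTestX.integral_exp_mul_sq_add_le {Θ : ℝ} (hφ : IsTestX L φ)
    (hθ : ContDiffOn ℝ ∞ θ (Ioo (-L) L)) (hθ_le : ∀ x ∈ Ioo (-L) L, θ x ≤ Θ)
    (hθ'_le : ∀ x ∈ Ioo (-L) L, |deriv θ x| ≤ Θ) :
    ∫ x, (Real.exp (2 * θ x) * φ x) ^ 2 ∂measX L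
        + ∫ x, deriv (fun x => Real.exp (2 * θ x) * φ x) x ^ 2 ∂measX L
      ≤ Real.exp (4 * Θ) * ((1 + 8 * Θ ^ 2) * ∫ x, φ x ^ 2 ∂measX L
        + 2 * ∫ x, deriv φ x ^ 2 ∂measX L) := by
  have hχ := hφ.exp_mul hθ
  have hφ2 := hφ.integrable_sq.const_mul (1 + 8 * Θ ^ 2)
  have hφ'2 := hφ.integrable_deriv_sq.const_mul 2
  rw [← integral_const_mul, ← integral_const_mul, ← integral_add hφ2 hφ'2, ← integral_const_mul,
    ← integral_add hχ.integrable_sq hχ.integrable_deriv_sq]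
  refine integral_mono_ae (hχ.integrable_sq.add hχ.integrable_deriv_sq)
    ((hφ2.add hφ'2).const_mul _) (ae_restrict_of_forall_mem measurableSet_Ioo fun x hx => ?_)
  have hexp : Real.exp (2 * θ x) ^ 2 ≤ Real.exp (4 * Θ) := by
    rw [← Real.exp_nat_mul, Real.exp_le_exp]
    push_cast
    linarith [hθ_le x hx]
  have hθ'2 : deriv θ x ^ 2 * φ x ^ 2 ≤ Θ ^ 2 * φ x ^ 2 := by
    gcongr ?_ * _
    exact sq_le_sq' (abs_le.1 (hθ'_le x hx)).1 (abs_le.1 (hθ'_le x hx)).2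
  have hsum : φ x ^ 2 + (deriv φ x + 2 * deriv θ x * φ x) ^ 2
      ≤ (1 + 8 * Θ ^ 2) * φ x ^ 2 + 2 * deriv φ x ^ 2 := by
    linarith [sq_nonneg (deriv φ x - 2 * deriv θ x * φ x)]
  simp only [hφ.deriv_exp_mul hθ hx, mul_pow (Real.exp _), ← mul_add]
  gcongr

theorem IsLongitudinalQuasimode.integral_agmon_le_one {l ε Θ Λ : ℝ} (hP : MemLp P ⊤ (measX L))
    (hφ : IsLongitudinalQuasimode L P l ε φ) (hΛ : ∫ x, deriv φ x ^ 2 ∂measX L ≤ Λ)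
    (hθ : ContDiffOn ℝ ∞ θ (Ioo (-L) L)) (hθ_le : ∀ x ∈ Ioo (-L) L, θ x ≤ Θ)
    (hθ'_le : ∀ x ∈ Ioo (-L) L, |deriv θ x| ≤ Θ)
    (hε : ε ^ 2 * (Real.exp (4 * Θ) * (1 + 8 * Θ ^ 2 + 2 * Λ)) ≤ 1) :
    ∫ x, (P x - l - deriv θ x ^ 2) * (Real.exp (2 * θ x) * φ x ^ 2) ∂measX L ≤ 1 := by
  refine (hφ.test.integral_agmon_le hP hθ l).trans (abs_le_of_sq_le_sq' ?_ zero_le_one).2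
  have hnorm := hφ.test.integral_exp_mul_sq_add_le hθ hθ_le hθ'_le
  rw [hφ.normalized, mul_one] at hnorm
  calc _ ≤ ε ^ 2 * (∫ x, (Real.exp (2 * θ x) * φ x) ^ 2 ∂measX L
            + ∫ x, deriv (fun x => Real.exp (2 * θ x) * φ x) x ^ 2 ∂measX L) :=
        hφ.form_error_sq_le _ (hφ.test.exp_mul hθ)
    _ ≤ ε ^ 2 * (Real.exp (4 * Θ) * (1 + 8 * Θ ^ 2 + 2 * Λ)) := by
        gcongr
        refine hnorm.trans ?_
        gcongr
    _ ≤ 1 ^ 2 := by rwa [one_pow]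

end Agmon

theorem exp_mul_setIntegral_sq_le {α : Type*} [MeasurableSpace α] {μ : Measure α}
    {W θ φ : α → ℝ} {well A : Set α} {Λ R S : ℝ} (hΛ : 0 ≤ Λ) (hA : MeasurableSet A)
    (hφ : Integrable (fun x => φ x ^ 2) μ)
    (hW : Integrable (fun x => W x * (Real.exp (2 * θ x) * φ x ^ 2)) μ)
    (hwell : ∀ᵐ x ∂μ, x ∈ well → -Λ ≤ W x ∧ θ x ≤ S ∧ x ∉ A)
    (hforb : ∀ᵐ x ∂μ, x ∉ well → 1 ≤ W x ∧ (x ∈ A → R ≤ θ x)) :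
    Real.exp (2 * R) * ∫ x in A, φ x ^ 2 ∂μ
      ≤ ∫ x, W x * (Real.exp (2 * θ x) * φ x ^ 2) ∂μ
        + Λ * Real.exp (2 * S) * ∫ x, φ x ^ 2 ∂μ := by
  have hmass := hφ.const_mul (Λ * Real.exp (2 * S))
  rw [← integral_const_mul, ← integral_const_mul, ← integral_add hW hmass,
    ← integral_indicator hA]
  refine integral_mono_ae ((hφ.const_mul _).indicator hA) (hW.add hmass) ?_
  filter_upwards [hwell, hforb] with x hxwell hxforb
  have hmass_nonneg : 0 ≤ Λ * Real.exp (2 * S) * φ x ^ 2 := by positivity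
  by_cases hx : x ∈ well
  · obtain ⟨hWx, hθx, hxA⟩ := hxwell hx
    have hexp : Λ * (Real.exp (2 * θ x) * φ x ^ 2) ≤ Λ * (Real.exp (2 * S) * φ x ^ 2) := by gcongr
    have := mul_le_mul_of_nonneg_right hWx
      (by positivity : 0 ≤ Real.exp (2 * θ x) * φ x ^ 2)
    rw [indicator_of_notMem hxA]
    linarith
  · obtain ⟨hWx, hθx⟩ := hxforb hx
    have hforbidden : Real.exp (2 * θ x) * φ x ^ 2 ≤ W x * (Real.exp (2 * θ x) * φ x ^ 2) :=
      le_mul_of_one_le_left (by positivity) hWx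
    by_cases hxA : x ∈ A
    · have hexp : Real.exp (2 * R) * φ x ^ 2 ≤ Real.exp (2 * θ x) * φ x ^ 2 := by
        gcongr
        exact hθx hxA
      rw [indicator_of_mem hxA]
      linarith
    · have : 0 ≤ Real.exp (2 * θ x) * φ x ^ 2 := by positivity
      rw [indicator_of_notMem hxA]
      linarith

/-- A coefficient on `[-L, L]` whose only zero is the origin. No finite order of vanishing and no
sign condition is imposed, in contrast with `IsGrushinCoeff`. -/
structure IsDegenerateCoeff (L : ℝ) (q : ℝ → ℝ) : Prop where
  smooth : ContDiffOn ℝ ∞ q (Icc (-L) L)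
  zero : q 0 = 0
  ne_zero : ∀ x ∈ Icc (-L) L, x ≠ 0 → q x ≠ 0

/-- A smooth minorant `D` of the Agmon distance to the origin that is at least `d` on `A`. -/
structure IsAgmonWeight (L : ℝ) (q : ℝ → ℝ) (A : Set ℝ) (d : ℝ) (D : ℝ → ℝ) : Prop where
  smooth : ContDiffOn ℝ ∞ D (Ioo (-L) L)
  zero : D 0 = 0
  abs_deriv_le : ∀ x ∈ Ioo (-L) L, |deriv D x| ≤ |q x|
  le : ∀ x ∈ A, d ≤ D x

section DegenerateCoeff

variable {L : ℝ} {q : ℝ → ℝ} {A : Set ℝ}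

theorem IsDegenerateCoeff.exists_abs_le (hq : IsDegenerateCoeff L q) :
    ∃ Q > 0, ∀ x ∈ Icc (-L) L, |q x| ≤ Q := by
  obtain ⟨Q, hQ⟩ := isCompact_Icc.exists_bound_of_continuousOn hq.smooth.continuousOn
  exact ⟨|Q| + 1, by positivity, fun x hx => (hQ x hx).trans (by linarith [le_abs_self Q])⟩

theorem exists_pos_forall_le_abs {f : ℝ → ℝ} (hf : ContinuousOn f (Icc (-L) L))
    (hne : ∀ x ∈ Icc (-L) L, x ≠ 0 → f x ≠ 0) {a : ℝ} (ha : 0 < a) :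
    ∃ δ > 0, ∀ x ∈ Icc (-L) L, a ≤ |x| → δ ≤ |f x| := by
  have hcompact : IsCompact (Icc (-L) L ∩ {x | a ≤ |x|}) :=
    isCompact_Icc.inter_right (isClosed_le continuous_const continuous_abs)
  obtain ⟨δ, hδ, hle⟩ := hcompact.exists_forall_le' (hf.mono inter_subset_left).abs (a := 0)
    fun x hx => abs_pos.2 (hne x hx.1 (abs_pos.1 (ha.trans_le hx.2)))
  exact ⟨δ, hδ, fun x hx hax => hle x ⟨hx, hax⟩⟩

theorem exists_abs_le_mul_abs {f : ℝ → ℝ} {f' b : ℝ} (hf : HasDerivAt f f' 0) (hf0 : f 0 = 0)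
    (hb : |f'| < b) (hL : 0 < L) : ∃ s > 0, 2 * s < L ∧ ∀ x, |x| < 2 * s → |f x| ≤ b * |x| := by
  have hslope : ∀ᶠ x in 𝓝 0, |x|⁻¹ * |f x| < b := by
    simpa [hf0] using hf.hasDerivWithinAt (s := univ) |>.limsup_norm_slope_le hb
  obtain ⟨η, hη, hball⟩ := Metric.eventually_nhds_iff.1 hslope
  refine ⟨min η L / 3, by positivity, by linarith [min_le_right η L], fun x hx => ?_⟩
  rcases eq_or_ne x 0 with rfl | hx0
  · simp [hf0]
  · have hlt := hball (y := x) (by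
      rw [Real.dist_0_eq_abs]
      linarith [min_le_left η L, abs_nonneg x])
    rw [inv_mul_lt_iff₀ (abs_pos.2 hx0), mul_comm] at hlt
    exact hlt.le

theorem IsAgmonWeight.abs_le {Q d : ℝ} {D : ℝ → ℝ} (hD : IsAgmonWeight L q A d D)
    (hQ : ∀ x ∈ Ioo (-L) L, |q x| ≤ Q) {x : ℝ} (hx : x ∈ Ioo (-L) L) : |D x| ≤ Q * |x| := by
  have h0 : (0 : ℝ) ∈ Ioo (-L) L := ⟨by linarith [hx.1, hx.2], by linarith [hx.1, hx.2]⟩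
  simpa [hD.zero] using (convex_Ioo (-L) L).norm_image_sub_le_of_norm_deriv_le
    (fun y hy => (hasDerivAt_of_contDiffOn_Ioo hD.smooth hy).differentiableAt)
    (fun y hy => (hD.abs_deriv_le y hy).trans (hQ y hy)) h0 hx

theorem memLp_top_of_continuousOn {f : ℝ → ℝ} (hf : ContinuousOn f (Icc (-L) L)) :
    MemLp f ⊤ (measX L) := by
  obtain ⟨C, hC⟩ := isCompact_Icc.exists_bound_of_continuousOn hf
  exact memLp_top_of_bound ((hf.mono Ioo_subset_Icc_self).aestronglyMeasurable measurableSet_Ioo) C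
    (ae_restrict_of_forall_mem measurableSet_Ioo fun x hx => hC x (Ioo_subset_Icc_self hx))

theorem IsDegenerateCoeff.memLp_potential {V : ℝ → ℝ} (hq : IsDegenerateCoeff L q)
    (hV : MemLp V ⊤ (measX L)) (μ : ℝ) : MemLp (fun x => V x + μ ^ 2 * q x ^ 2) ⊤ (measX L) :=
  hV.add (memLp_top_of_continuousOn (continuousOn_const.mul (hq.smooth.continuousOn.pow 2)))

end DegenerateCoeff

section LongitudinalQuasimode

variable {L b d d' v l ε Λ μ κ : ℝ} {q V D φ : ℝ → ℝ} {A : Set ℝ}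

theorem IsLongitudinalQuasimode.mono {P : ℝ → ℝ} {ε' : ℝ} (hφ : IsLongitudinalQuasimode L P l ε φ)
    (hε : 0 ≤ ε) (hle : ε ≤ ε') : IsLongitudinalQuasimode L P l ε' φ :=
  ⟨hφ.test, hφ.normalized, fun χ hχ => (hφ.form_error_sq_le χ hχ).trans <| by gcongr⟩

theorem IsAgmonWeight.sub_le_agmon_potential (hD : IsAgmonWeight L q A d D) {x : ℝ}
    (hx : x ∈ Ioo (-L) L) (hV : -v ≤ V x) (hlv : l + v ≤ Λ) (μ κ : ℝ) :
    (1 - κ ^ 2) * μ ^ 2 * q x ^ 2 - Λ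
      ≤ V x + μ ^ 2 * q x ^ 2 - l - deriv (fun x => μ * κ * D x) x ^ 2 := by
  have hderiv : (μ * κ) ^ 2 * deriv D x ^ 2 ≤ (μ * κ) ^ 2 * q x ^ 2 := by
    gcongr ?_ * ?_
    exact sq_le_sq.2 (hD.abs_deriv_le x hx)
  rw [deriv_const_mul_field, mul_pow (μ * κ)]
  linarith

/- On the well `{|x| < a}` the weight `θ = μ κ D` is at most `μ κ Q a`; outside of it, the effective
potential `V + μ² q² - l - θ'²` is at least one. -/
theorem IsLongitudinalQuasimode.exp_mul_setIntegral_sq_le {a Q δ : ℝ}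
    (hq : IsDegenerateCoeff L q) (hV : MemLp V ⊤ (measX L)) (hD : IsAgmonWeight L q A d D)
    (hφ : IsLongitudinalQuasimode L (fun x => V x + μ ^ 2 * q x ^ 2) l ε φ)
    (hv : ∀ᵐ x ∂measX L, -v ≤ V x) (hlv : l + v ≤ Λ) (hΛ : ∫ x, deriv φ x ^ 2 ∂measX L ≤ Λ)
    (hμ : 0 ≤ μ) (hκ : κ ∈ Icc 0 1) (hA : MeasurableSet A) (haA : ∀ x ∈ A, a ≤ |x|)
    (hQ0 : 0 ≤ Q) (hQ : ∀ x ∈ Icc (-L) L, |q x| ≤ Q) (hδ0 : 0 ≤ δ)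
    (hδ : ∀ x ∈ Icc (-L) L, a ≤ |x| → δ ≤ |q x|)
    (hΛδ : Λ + 1 ≤ (1 - κ ^ 2) * μ ^ 2 * δ ^ 2)
    (hε : ε ^ 2 * (Real.exp (4 * (μ * κ * (Q * (L + 1))))
      * (1 + 8 * (μ * κ * (Q * (L + 1))) ^ 2 + 2 * Λ)) ≤ 1) :
    Real.exp (2 * (μ * κ * d)) * ∫ x in A, φ x ^ 2 ∂measX L
      ≤ 1 + Λ * Real.exp (2 * (μ * κ * (Q * a))) := by
  have hμκ : 0 ≤ μ * κ := mul_nonneg hμ hκ.1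
  have hκ2 : 0 ≤ 1 - κ ^ 2 := sub_nonneg.2 (pow_le_one₀ hκ.1 hκ.2)
  have hQ' : ∀ x ∈ Ioo (-L) L, |q x| ≤ Q := fun x hx => hQ x (Ioo_subset_Icc_self hx)
  have hθ : ContDiffOn ℝ ∞ (fun x => μ * κ * D x) (Ioo (-L) L) := contDiffOn_const.mul hD.smooth
  have hθ_le : ∀ x ∈ Ioo (-L) L, μ * κ * D x ≤ μ * κ * (Q * (L + 1)) := fun x hx => by
    have : D x ≤ Q * |x| := (le_abs_self _).trans (hD.abs_le hQ' hx)
    have : |x| ≤ L + 1 := (abs_lt.2 hx).le.trans (by linarith)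
    gcongr
    nlinarith
  have hθ'_le : ∀ x ∈ Ioo (-L) L,
      |deriv (fun x => μ * κ * D x) x| ≤ μ * κ * (Q * (L + 1)) := fun x hx => by
    have : |deriv D x| ≤ Q := (hD.abs_deriv_le x hx).trans (hQ' x hx)
    rw [deriv_const_mul_field, abs_mul, abs_of_nonneg hμκ]
    gcongr
    nlinarith [hx.1, hx.2]
  have hP := hq.memLp_potential hV μ
  have hagmon := hφ.integral_agmon_le_one hP hΛ hθ hθ_le hθ'_le hε
  have hdecay := Grushin.exp_mul_setIntegral_sq_le (well := {x | |x| < a}) (Λ := Λ)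
    (R := μ * κ * d) (S := μ * κ * (Q * a))
    ((integral_nonneg fun x => sq_nonneg _).trans hΛ) hA hφ.test.integrable_sq
    (hφ.test.integrable_agmon hP hθ l) ?_ ?_
  · rw [hφ.normalized, mul_one] at hdecay
    linarith
  all_goals filter_upwards [hv, ae_restrict_mem measurableSet_Ioo] with x hvx hx hxa
  all_goals have hW := hD.sub_le_agmon_potential hx hvx hlv μ κ
  · have hD_le : D x ≤ Q * a := (le_abs_self _).trans
      ((hD.abs_le hQ' hx).trans (mul_le_mul_of_nonneg_left (le_of_lt hxa) hQ0))
    have : 0 ≤ (1 - κ ^ 2) * μ ^ 2 * q x ^ 2 := by positivity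
    exact ⟨by linarith, by gcongr, fun hxA => (haA x hxA).not_gt hxa⟩
  · have hδq : δ ^ 2 ≤ q x ^ 2 :=
      sq_abs (q x) ▸ pow_le_pow_left₀ hδ0 (hδ x (Ioo_subset_Icc_self hx) (not_lt.1 hxa)) 2
    have : (1 - κ ^ 2) * μ ^ 2 * δ ^ 2 ≤ (1 - κ ^ 2) * μ ^ 2 * q x ^ 2 := by gcongr
    exact ⟨by linarith, fun hxA => by gcongr; exact hD.le x hxA⟩

theorem exists_agmon_decay (hq : IsDegenerateCoeff L q) (hV : MemLp V ⊤ (measX L))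
    (hv : ∀ᵐ x ∂measX L, -v ≤ V x) (hD : IsAgmonWeight L q A d D) (hA : MeasurableSet A)
    (hdist : 0 < Metric.infDist 0 A) (hd' : 0 < d') (hd : d' < d) :
    ∃ η > 0, ∀ μ Λ l, 0 ≤ μ → 0 ≤ Λ → Λ + 1 ≤ η * μ ^ 2 → l + v ≤ Λ → ∃ ε > 0, ∀ φ,
      IsLongitudinalQuasimode L (fun x => V x + μ ^ 2 * q x ^ 2) l ε φ →
      ∫ x, deriv φ x ^ 2 ∂measX L ≤ Λ →
      ∫ x in A, φ x ^ 2 ∂measX L ≤ (1 + Λ) * Real.exp (-(2 * μ * d')) := by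
  obtain ⟨Q, hQ0, hQ⟩ := hq.exists_abs_le
  obtain ⟨a, ha, hadist, haQ⟩ : ∃ a > 0, a ≤ Metric.infDist 0 A ∧ a ≤ (d - d') / 2 / Q := by
    have : 0 < (d - d') / 2 / Q := div_pos (by linarith) hQ0
    exact ⟨min _ _, lt_min hdist this, min_le_left _ _, min_le_right _ _⟩
  have haA : ∀ x ∈ A, a ≤ |x| := fun x hx => by
    simpa using hadist.trans (Metric.infDist_le_dist_of_mem hx)
  obtain ⟨δ, hδ0, hδ⟩ := exists_pos_forall_le_abs hq.smooth.continuousOn hq.ne_zero ha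
  set κ := d' / ((d + d') / 2)
  have hκ0 : 0 < κ := div_pos hd' (by linarith)
  have hκ1 : κ < 1 := (div_lt_one (by linarith)).2 (by linarith)
  have hκd : d' ≤ κ * (d - Q * a) := by
    calc d' = κ * ((d + d') / 2) := (div_mul_cancel₀ _ (by linarith)).symm
      _ ≤ κ * (d - Q * a) := by
        gcongr
        linarith [(le_div_iff₀' hQ0).1 haQ]
  refine ⟨(1 - κ ^ 2) * δ ^ 2, mul_pos (by nlinarith) (by positivity),
    fun μ Λ l hμ hΛ hΛδ hlv => ?_⟩
  set K := Real.exp (4 * (μ * κ * (Q * (L + 1))))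
    * (1 + 8 * (μ * κ * (Q * (L + 1))) ^ 2 + 2 * Λ) with hK
  have hK0 : 0 < K := by positivity
  refine ⟨1 / √K, by positivity, fun φ hφ hφ' => ?_⟩
  have hdecay := hφ.exp_mul_setIntegral_sq_le hq hV hD hv hlv hφ' hμ ⟨hκ0.le, hκ1.le⟩ hA haA
    hQ0.le hQ hδ0.le hδ (by linarith)
    (by rw [← hK, div_pow, Real.sq_sqrt hK0.le, one_pow, one_div_mul_cancel hK0.ne'])
  calc ∫ x in A, φ x ^ 2 ∂measX L
      ≤ (1 + Λ * Real.exp (2 * (μ * κ * (Q * a)))) / Real.exp (2 * (μ * κ * d)) :=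
        (le_div_iff₀' (Real.exp_pos _)).2 hdecay
    _ ≤ (1 + Λ) * Real.exp (2 * (μ * κ * (Q * a))) / Real.exp (2 * (μ * κ * d)) := by
        gcongr
        linarith [Real.one_le_exp (by positivity : 0 ≤ 2 * (μ * κ * (Q * a)))]
    _ = (1 + Λ) * Real.exp (-(2 * μ * (κ * (d - Q * a)))) := by
        rw [mul_div_assoc, ← Real.exp_sub]
        ring_nf
    _ ≤ (1 + Λ) * Real.exp (-(2 * μ * d')) := by gcongr

theorem exists_longitudinal_energy_le (hL : 0 < L) (hq : IsDegenerateCoeff L q)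
    (hV : MemLp V ⊤ (measX L)) (hv0 : 0 ≤ v) (hv : ∀ᵐ x ∂measX L, |V x| ≤ v)
    (hb : |deriv q 0| < b) :
    ∃ C ≥ 0, ∀ μ ≥ 0, ∃ l, |l| + v ≤ b * μ + C ∧ ∀ ε > 0, ∃ φ,
      IsLongitudinalQuasimode L (fun x => V x + μ ^ 2 * q x ^ 2) l ε φ ∧
      ∫ x, deriv φ x ^ 2 ∂measX L ≤ b * μ + C := by
  have hb0 : 0 < b := (abs_nonneg _).trans_lt hb
  have hq' : HasDerivAt q (deriv q 0) 0 := hasDerivAt_of_contDiffOn_Ioo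
    (hq.smooth.mono Ioo_subset_Icc_self) ⟨neg_lt_zero.2 hL, hL⟩
  obtain ⟨s, hs, hsL, hqb⟩ := exists_abs_le_mul_abs hq' hq.zero hb hL
  obtain ⟨C, hC, htrial⟩ := exists_test_formX_le hs hsL
  refine ⟨C + 2 * v + 1, by positivity, fun μ hμ => ?_⟩
  have hPle : ∀ᵐ x ∂measX L, |x| < 2 * s →
      V x + μ ^ 2 * q x ^ 2 ≤ v + (b * μ) ^ 2 * x ^ 2 := hv.mono fun x hx hxs => by
    have : q x ^ 2 ≤ (b * |x|) ^ 2 := sq_le_sq' (abs_le.1 (hqb x hxs)).1 (abs_le.1 (hqb x hxs)).2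
    calc V x + μ ^ 2 * q x ^ 2 ≤ v + μ ^ 2 * (b * |x|) ^ 2 := by
          gcongr
          exact (le_abs_self _).trans hx
      _ = v + (b * μ) ^ 2 * x ^ 2 := by rw [mul_pow b |x|, sq_abs]; ring
  have hP := hq.memLp_potential hV μ
  have hP_ge : ∀ᵐ x ∂measX L, -v ≤ V x + μ ^ 2 * q x ^ 2 := hv.mono fun x hx => by
    linarith [(abs_le.1 hx).1, mul_nonneg (sq_nonneg μ) (sq_nonneg (q x))]
  obtain ⟨l, ⟨hvl, hlv⟩, hquasi⟩ := exists_longitudinalQuasimode_of_energy_le hP hP_ge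
    (htrial (b * μ) (by positivity) v _ hP hPle)
  refine ⟨l, ?_, fun ε hε => (hquasi ε hε).imp fun φ hφ => ⟨hφ.1, hφ.2.trans (by linarith)⟩⟩
  have : 0 ≤ b * μ := by positivity
  linarith [abs_le.2 ⟨(by linarith : -(b * μ + C + v) ≤ l), hlv⟩]

theorem exists_longitudinal_quasimode (hL : 0 < L) (hq : IsDegenerateCoeff L q)
    (hV : MemLp V ⊤ (measX L)) (hb : |deriv q 0| < b) (hD : IsAgmonWeight L q A d D)
    (hA : MeasurableSet A) (hdist : 0 < Metric.infDist 0 A) (hd' : 0 < d') (hd : d' < d) :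
    ∃ C ≥ 0, ∃ M > 0, ∀ μ ≥ M, ∀ ε > 0, ∃ l φ,
      IsLongitudinalQuasimode L (fun x => V x + μ ^ 2 * q x ^ 2) l ε φ ∧ |l| ≤ b * μ + C ∧
      ∫ x, deriv φ x ^ 2 ∂measX L ≤ b * μ + C ∧
      ∫ x in A, φ x ^ 2 ∂measX L ≤ (1 + (b * μ + C)) * Real.exp (-(2 * μ * d')) := by
  have hb0 : 0 < b := (abs_nonneg _).trans_lt hb
  obtain ⟨v, hv0, hv⟩ := exists_ae_abs_le hV
  obtain ⟨C, hC, henergy⟩ := exists_longitudinal_energy_le hL hq hV hv0 hv hb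
  obtain ⟨η, hη, hdecay⟩ := exists_agmon_decay hq hV (hv.mono fun x hx => (abs_le.1 hx).1) hD hA
    hdist hd' hd
  refine ⟨C, hC, max 1 ((b + C + 1) / η), by positivity, fun μ hμ ε hε => ?_⟩
  have hμ1 : 1 ≤ μ := (le_max_left _ _).trans hμ
  have hμη : b * μ + C + 1 ≤ η * μ ^ 2 := by
    calc b * μ + C + 1 ≤ (b + C + 1) * μ := by nlinarith
      _ ≤ (η * μ) * μ := by
        gcongr
        exact (div_le_iff₀' hη).1 ((le_max_right _ _).trans hμ)
      _ = η * μ ^ 2 := by ring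
  obtain ⟨l, hl, hquasi⟩ := henergy μ (by linarith)
  obtain ⟨ε₀, hε₀, hsmall⟩ := hdecay μ (b * μ + C) l (by linarith) (by positivity) hμη
    (by linarith [le_abs_self l])
  obtain ⟨φ, hφ, hφ'⟩ := hquasi (min ε ε₀) (lt_min hε hε₀)
  have hmin : 0 ≤ min ε ε₀ := (lt_min hε hε₀).le
  exact ⟨l, φ, hφ.mono hmin (min_le_left _ _), by linarith, hφ',
    hsmall φ (hφ.mono hmin (min_le_right _ _)) hφ'⟩

end LongitudinalQuasimode

/-! ### Product quasimodes -/

/-- Test functions on `Ω` for which all the terms of the form of `G_V` are finite, that is, those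
that give rise to an element of `formGraph`. -/
structure IsFormTest (L : ℝ) (Y : YDomain) (q r : ℝ → ℝ) (F : ℝ × ℝ → ℝ) : Prop where
  test : IsTest L Y F
  memLp : MemLp F 2 (meas L Y)
  memLp_dx : MemLp (dx F) 2 (meas L Y)
  memLp_dY : MemLp (dY q r F) 2 (meas L Y)

/-- The form of `G_V`, between an element of the form domain, which is given together with its weak
derivatives, and a test function. -/
noncomputable def weakForm (L : ℝ) (Y : YDomain) (q r V : ℝ → ℝ) (p : L2 L Y × L2 L Y × L2 L Y)
    (F : ℝ × ℝ → ℝ) : ℝ :=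
  ∫ z, (p.2.1 z * dx F z + p.2.2 z * dY q r F z + V z.1 * p.1 z * F z) ∂meas L Y

/-- A test function on `Ω` that solves `G_V F = l F` up to an error of size `ε` in the dual of the
form domain. -/
structure IsQuasimode (L : ℝ) (Y : YDomain) (q r V : ℝ → ℝ) (l ε : ℝ) (F : ℝ × ℝ → ℝ) :
    Prop where
  formTest : IsFormTest L Y q r F
  form_error_le : ∀ p ∈ formGraph L Y q r,
    |weakForm L Y q r V p F - l * ∫ z, p.1 z * F z ∂meas L Y|
      ≤ ε * (1 + (‖p.1‖ ^ 2 + ‖p.2.1‖ ^ 2 + ‖p.2.2‖ ^ 2))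

section WeakForm

variable {L : ℝ} {Y : YDomain} {q r V φ ψ : ℝ → ℝ} {F : ℝ × ℝ → ℝ}

theorem integral_meas {H : ℝ × ℝ → ℝ} (hH : Integrable H (meas L Y)) :
    ∫ z, H z ∂meas L Y = ∫ x, ∫ y, H (x, y) ∂measY Y ∂measX L := by
  rw [meas_eq_prod] at hH ⊢
  exact integral_prod H hH

theorem integral_meas_symm {H : ℝ × ℝ → ℝ} (hH : Integrable H (meas L Y)) :
    ∫ z, H z ∂meas L Y = ∫ y, ∫ x, H (x, y) ∂measX L ∂measY Y := by
  rw [meas_eq_prod] at hH ⊢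
  exact integral_prod_symm H hH

theorem memLp_meas_tensor (hφ : MemLp φ 2 (measX L)) (hψ : MemLp ψ 2 (measY Y)) :
    MemLp (tensor φ ψ) 2 (meas L Y) := by
  rw [meas_eq_prod]
  exact memLp_tensor hφ hψ

theorem memLp_top_comp_fst (hV : MemLp V ⊤ (measX L)) (Y : YDomain) :
    MemLp (fun z : ℝ × ℝ => V z.1) ⊤ (meas L Y) := by
  obtain ⟨v, -, hv⟩ := exists_ae_abs_le hV
  rw [meas_eq_prod]
  exact memLp_top_of_bound hV.1.comp_fst v (Measure.quasiMeasurePreserving_fst.ae hv)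

theorem IsFormTest.memLp_potential_mul (hV : MemLp V ⊤ (measX L)) (hF : IsFormTest L Y q r F) :
    MemLp (fun z => V z.1 * F z) 2 (meas L Y) :=
  hF.memLp.mul (memLp_top_comp_fst hV Y)

theorem IsFormTest.integrable_weakForm (hV : MemLp V ⊤ (measX L)) (hF : IsFormTest L Y q r F)
    (p : L2 L Y × L2 L Y × L2 L Y) :
    Integrable (fun z => p.2.1 z * dx F z + p.2.2 z * dY q r F z + V z.1 * p.1 z * F z)
      (meas L Y) := by
  refine (((Lp.memLp p.2.1).integrable_mul hF.memLp_dx).add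
    ((Lp.memLp p.2.2).integrable_mul hF.memLp_dY)).add ?_
  refine ((Lp.memLp p.1).integrable_mul (hF.memLp_potential_mul hV)).congr (.of_forall fun z => ?_)
  simp only [Pi.mul_apply]
  ring

theorem IsFormTest.weakForm_eq_inner (hV : MemLp V ⊤ (measX L)) (hF : IsFormTest L Y q r F)
    (p : L2 L Y × L2 L Y × L2 L Y) :
    weakForm L Y q r V p F = ⟪p.2.1, hF.memLp_dx.toLp⟫ + ⟪p.2.2, hF.memLp_dY.toLp⟫
      + ⟪p.1, (hF.memLp_potential_mul hV).toLp⟫ := by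
  have hx : Integrable (fun z => p.2.1 z * dx F z) (meas L Y) :=
    (Lp.memLp p.2.1).integrable_mul hF.memLp_dx
  have hY : Integrable (fun z => p.2.2 z * dY q r F z) (meas L Y) :=
    (Lp.memLp p.2.2).integrable_mul hF.memLp_dY
  have hxY : Integrable (fun z => p.2.1 z * dx F z + p.2.2 z * dY q r F z) (meas L Y) := hx.add hY
  have hpotential : Integrable (fun z => p.1 z * (V z.1 * F z)) (meas L Y) :=
    (Lp.memLp p.1).integrable_mul (hF.memLp_potential_mul hV)
  rw [inner_eq_integral .rfl hF.memLp_dx.coeFn_toLp, inner_eq_integral .rfl hF.memLp_dY.coeFn_toLp,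
    inner_eq_integral .rfl (hF.memLp_potential_mul hV).coeFn_toLp, weakForm]
  rw [← integral_add hx hY, ← integral_add hxY hpotential]
  simp only [mul_assoc, mul_left_comm]

theorem IsFormTest.integral_mul_eq_inner (hF : IsFormTest L Y q r F) (f : L2 L Y) :
    ∫ z, f z * F z ∂meas L Y = ⟪f, hF.memLp.toLp⟫ :=
  (inner_eq_integral .rfl hF.memLp.coeFn_toLp).symm

theorem isFormTest_tensor (hq : MemLp q ⊤ (measX L)) (hr : IsTransversalCoeff Y r)
    (hφ : IsTestX L φ) (hψ : IsTestY Y ψ) : IsFormTest L Y q r (tensor φ ψ) where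
  test := hφ.tensor hψ
  memLp := memLp_meas_tensor (hφ.memLp 2) hψ.memLp
  memLp_dx := dx_tensor φ ψ ▸ memLp_meas_tensor (hφ.memLp_deriv 2) hψ.memLp
  memLp_dY := dY_tensor q r φ ψ ▸
    memLp_meas_tensor ((hφ.memLp 2).mul hq) (hψ.memLp_coeff_mul_deriv hr)

end WeakForm

section Error

variable {L l ε μ Q : ℝ} {Y : YDomain} {q r V P φ ψ : ℝ → ℝ} {G : ℝ × ℝ → ℝ}

theorem abs_mul_le_of_sq_le {a b N : ℝ} (hε : 0 < ε) (hb : b ^ 2 ≤ ε ^ 2 * N) :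
    |a * b| ≤ ε / 2 * (a ^ 2 + N) := by
  have hscaled : ε * (2 * |a * b|) ≤ ε * (ε * (a ^ 2 + N)) := by
    rw [abs_mul]
    nlinarith [sq_nonneg (ε * |a| - |b|), sq_abs a, sq_abs b]
  linarith [le_of_mul_le_mul_left hscaled hε]

theorem integrable_longitudinal_error (hP : MemLp P ⊤ (measX L)) (hφ : IsTestX L φ)
    (hψ : MemLp ψ 2 (measY Y)) (l : ℝ) (hG : IsFormTest L Y q r G) :
    Integrable (fun z => dx G z * tensor (deriv φ) ψ z
      + G z * tensor (fun x => (P x - l) * φ x) ψ z) (meas L Y) :=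
  have hpotential : MemLp (fun x => (P x - l) * φ x) 2 (measX L) :=
    (hφ.memLp 2).mul (hP.sub (memLp_const l))
  (hG.memLp_dx.integrable_mul (memLp_meas_tensor (hφ.memLp_deriv 2) hψ)).add
    (hG.memLp.integrable_mul (memLp_meas_tensor hpotential hψ))

theorem IsLongitudinalQuasimode.abs_slice_error_le (hL : 0 < L) (hε : 0 < ε)
    (hP : MemLp P ⊤ (measX L)) (hφ : IsLongitudinalQuasimode L P l ε φ) (ψ : ℝ → ℝ)
    (hG : IsTest L Y G) (y : ℝ) :
    |∫ x, (dx G (x, y) * tensor (deriv φ) ψ (x, y)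
        + G (x, y) * tensor (fun x => (P x - l) * φ x) ψ (x, y)) ∂measX L|
      ≤ ε / 2 * (ψ y ^ 2 + (∫ x, G (x, y) ^ 2 ∂measX L + ∫ x, dx G (x, y) ^ 2 ∂measX L)) := by
  have hχ := hG.slice_x hL y
  have hslice : ∫ x, (dx G (x, y) * tensor (deriv φ) ψ (x, y)
        + G (x, y) * tensor (fun x => (P x - l) * φ x) ψ (x, y)) ∂measX L
      = ψ y * (formX L P φ (fun x => G (x, y)) - l * ∫ x, φ x * G (x, y) ∂measX L) := by
    rw [formX, ← integral_const_mul, ← integral_sub (hφ.test.integrable_formX hP hχ)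
      ((hφ.test.integrable_mul hχ).const_mul _), ← integral_const_mul]
    refine integral_congr_ae (.of_forall fun x => ?_)
    simp only [dx, tensor]
    ring
  rw [hslice]
  exact abs_mul_le_of_sq_le hε (hφ.form_error_sq_le _ hχ)

theorem IsLongitudinalQuasimode.abs_error_le (hL : 0 < L) (hε : 0 < ε)
    (hP : MemLp P ⊤ (measX L)) (hφ : IsLongitudinalQuasimode L P l ε φ)
    (hψ : MemLp ψ 2 (measY Y)) (hone : ∫ y, ψ y ^ 2 ∂measY Y = 1) (hG : IsFormTest L Y q r G) :
    |∫ z, (dx G z * tensor (deriv φ) ψ z + G z * tensor (fun x => (P x - l) * φ x) ψ z) ∂meas L Y|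
      ≤ ε / 2 * (1 + (∫ z, G z ^ 2 ∂meas L Y + ∫ z, dx G z ^ 2 ∂meas L Y)) := by
  have hG2 := hG.memLp.integrable_sq
  have hGx2 := hG.memLp_dx.integrable_sq
  have hmass : Integrable (fun y => ∫ x, G (x, y) ^ 2 ∂measX L) (measY Y) := by
    simpa only using (meas_eq_prod L Y ▸ hG2).integral_prod_right
  have henergy : Integrable (fun y => ∫ x, dx G (x, y) ^ 2 ∂measX L) (measY Y) := by
    simpa only using (meas_eq_prod L Y ▸ hGx2).integral_prod_right
  have hsum : Integrable (fun y => ∫ x, G (x, y) ^ 2 ∂measX L + ∫ x, dx G (x, y) ^ 2 ∂measX L)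
      (measY Y) := hmass.add henergy
  rw [integral_meas_symm (integrable_longitudinal_error hP hφ.test hψ l hG),
    integral_meas_symm hG2, integral_meas_symm hGx2, ← hone, ← integral_add hmass henergy,
    ← integral_add hψ.integrable_sq hsum, ← integral_const_mul]
  have hbound : Integrable (fun y => ε / 2 * (ψ y ^ 2
      + (∫ x, G (x, y) ^ 2 ∂measX L + ∫ x, dx G (x, y) ^ 2 ∂measX L))) (measY Y) :=
    (hψ.integrable_sq.add hsum).const_mul _
  exact (Real.norm_eq_abs _).symm.trans_le (norm_integral_le_of_norm_le hbound
    (.of_forall fun y => hφ.abs_slice_error_le hL hε hP ψ hG.test y))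

theorem integrable_transversal_error (hr : IsTransversalCoeff Y r) (hq : MemLp q ⊤ (measX L))
    (hq2 : MemLp (fun x => μ ^ 2 * q x ^ 2) ⊤ (measX L)) (hφ : MemLp φ 2 (measX L))
    (hψ : IsTestY Y ψ) (hG : IsFormTest L Y q r G) :
    Integrable (fun z => dY q r G z * tensor (fun x => q x * φ x) (fun y => r y * deriv ψ y) z
      - G z * tensor (fun x => μ ^ 2 * q x ^ 2 * φ x) ψ z) (meas L Y) :=
  (hG.memLp_dY.integrable_mul
    (memLp_meas_tensor (hφ.mul hq) (hψ.memLp_coeff_mul_deriv hr))).sub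
    (hG.memLp.integrable_mul (memLp_meas_tensor (hφ.mul hq2) hψ.memLp))

theorem IsTransversalQuasimode.abs_slice_error_le (hε : 0 < ε) (hr : IsTransversalCoeff Y r)
    (hψ : IsTransversalQuasimode Y r (μ ^ 2) ε ψ) (φ : ℝ → ℝ) (hG : IsTest L Y G) {x : ℝ}
    (hQ : |q x| ≤ Q) :
    |∫ y, (dY q r G (x, y) * tensor (fun x => q x * φ x) (fun y => r y * deriv ψ y) (x, y)
        - G (x, y) * tensor (fun x => μ ^ 2 * q x ^ 2 * φ x) ψ (x, y)) ∂measY Y|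
      ≤ ε / 2 * (Q ^ 2 * φ x ^ 2
        + (Q ^ 2 * ∫ y, G (x, y) ^ 2 ∂measY Y + ∫ y, dY q r G (x, y) ^ 2 ∂measY Y)) := by
  have hχ := hG.slice_y x
  have hqQ : q x ^ 2 ≤ Q ^ 2 := sq_le_sq.2 (hQ.trans (le_abs_self Q))
  have henergy : ∫ y, dY q r G (x, y) ^ 2 ∂measY Y
      = q x ^ 2 * ∫ y, (r y * deriv (fun y => G (x, y)) y) ^ 2 ∂measY Y := by
    simp only [← integral_const_mul, dY, mul_assoc, mul_pow]
  have hslice : ∫ y, (dY q r G (x, y)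
          * tensor (fun x => q x * φ x) (fun y => r y * deriv ψ y) (x, y)
        - G (x, y) * tensor (fun x => μ ^ 2 * q x ^ 2 * φ x) ψ (x, y)) ∂measY Y
      = (q x * φ x) * (q x * (∫ y, (r y * deriv ψ y) * (r y * deriv (fun y => G (x, y)) y) ∂measY Y
          - μ ^ 2 * ∫ y, ψ y * G (x, y) ∂measY Y)) := by
    have henergy : Integrable (fun y => (r y * deriv ψ y) * (r y * deriv (fun y => G (x, y)) y))
        (measY Y) := (hψ.test.memLp_coeff_mul_deriv hr).integrable_mul (hχ.memLp_coeff_mul_deriv hr)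
    have hmass : Integrable (fun y => ψ y * G (x, y)) (measY Y) :=
      hψ.test.memLp.integrable_mul hχ.memLp
    rw [← integral_const_mul, ← integral_sub henergy (hmass.const_mul _), ← integral_const_mul,
      ← integral_const_mul]
    refine integral_congr_ae (.of_forall fun y => ?_)
    simp only [dY, tensor]
    ring
  rw [hslice]
  calc _ ≤ ε / 2 * ((q x * φ x) ^ 2
        + (q x ^ 2 * ∫ y, G (x, y) ^ 2 ∂measY Y + ∫ y, dY q r G (x, y) ^ 2 ∂measY Y)) := by
        refine abs_mul_le_of_sq_le hε ?_
        rw [henergy, mul_pow, ← mul_add, mul_left_comm]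
        exact mul_le_mul_of_nonneg_left (hψ.form_error_sq_le _ hχ) (sq_nonneg _)
    _ ≤ _ := by
        have hnonneg : 0 ≤ ∫ y, G (x, y) ^ 2 ∂measY Y := integral_nonneg fun y => sq_nonneg _
        rw [mul_pow]
        exact mul_le_mul_of_nonneg_left (add_le_add (mul_le_mul_of_nonneg_right hqQ (sq_nonneg _))
          (add_le_add_left (mul_le_mul_of_nonneg_right hqQ hnonneg) _)) (by positivity)

theorem IsTransversalQuasimode.abs_error_le (hε : 0 < ε) (hr : IsTransversalCoeff Y r)
    (hq : MemLp q ⊤ (measX L)) (hq2 : MemLp (fun x => μ ^ 2 * q x ^ 2) ⊤ (measX L))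
    (hQ : ∀ x ∈ Ioo (-L) L, |q x| ≤ Q)
    (hψ : IsTransversalQuasimode Y r (μ ^ 2) ε ψ) (hφ : MemLp φ 2 (measX L))
    (hone : ∫ x, φ x ^ 2 ∂measX L = 1) (hG : IsFormTest L Y q r G) :
    |∫ z, (dY q r G z * tensor (fun x => q x * φ x) (fun y => r y * deriv ψ y) z
        - G z * tensor (fun x => μ ^ 2 * q x ^ 2 * φ x) ψ z) ∂meas L Y|
      ≤ ε / 2 * (Q ^ 2 + (Q ^ 2 * ∫ z, G z ^ 2 ∂meas L Y + ∫ z, dY q r G z ^ 2 ∂meas L Y)) := by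
  have hG2 := hG.memLp.integrable_sq
  have hGY2 := hG.memLp_dY.integrable_sq
  have hmass : Integrable (fun x => Q ^ 2 * ∫ y, G (x, y) ^ 2 ∂measY Y) (measX L) := by
    simpa only using (meas_eq_prod L Y ▸ hG2).integral_prod_left.const_mul (Q ^ 2)
  have henergy : Integrable (fun x => ∫ y, dY q r G (x, y) ^ 2 ∂measY Y) (measX L) := by
    simpa only using (meas_eq_prod L Y ▸ hGY2).integral_prod_left
  have hφ2 := hφ.integrable_sq.const_mul (Q ^ 2)
  have hsum : Integrable (fun x => Q ^ 2 * ∫ y, G (x, y) ^ 2 ∂measY Y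
      + ∫ y, dY q r G (x, y) ^ 2 ∂measY Y) (measX L) := hmass.add henergy
  have hbound : Integrable (fun x => ε / 2 * (Q ^ 2 * φ x ^ 2
      + (Q ^ 2 * ∫ y, G (x, y) ^ 2 ∂measY Y + ∫ y, dY q r G (x, y) ^ 2 ∂measY Y))) (measX L) :=
    (hφ2.add hsum).const_mul _
  rw [integral_meas (integrable_transversal_error hr hq hq2 hφ hψ.test hG)]
  calc |∫ x, ∫ y, (dY q r G (x, y)
            * tensor (fun x => q x * φ x) (fun y => r y * deriv ψ y) (x, y)
          - G (x, y) * tensor (fun x => μ ^ 2 * q x ^ 2 * φ x) ψ (x, y)) ∂measY Y ∂measX L|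
      ≤ ∫ x, ε / 2 * (Q ^ 2 * φ x ^ 2 + (Q ^ 2 * ∫ y, G (x, y) ^ 2 ∂measY Y
          + ∫ y, dY q r G (x, y) ^ 2 ∂measY Y)) ∂measX L :=
        (Real.norm_eq_abs _).symm.trans_le (norm_integral_le_of_norm_le hbound
          (ae_restrict_of_forall_mem measurableSet_Ioo fun x hx =>
            hψ.abs_slice_error_le hε hr φ hG.test (hQ x hx)))
    _ = ε / 2 * (Q ^ 2 + (Q ^ 2 * ∫ z, G z ^ 2 ∂meas L Y
          + ∫ z, dY q r G z ^ 2 ∂meas L Y)) := by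
        rw [integral_const_mul, integral_add hφ2 hsum, integral_add hmass henergy,
          integral_const_mul, integral_const_mul, hone, mul_one, integral_meas hG2,
          integral_meas hGY2]

theorem weakForm_tensor_sub (hV : MemLp V ⊤ (measX L)) (hr : IsTransversalCoeff Y r)
    (hq : MemLp q ⊤ (measX L)) (hq2 : MemLp (fun x => μ ^ 2 * q x ^ 2) ⊤ (measX L))
    (hφ : IsTestX L φ) (hψ : IsTestY Y ψ) (l : ℝ) (hG : IsFormTest L Y q r G)
    {p : L2 L Y × L2 L Y × L2 L Y} (hp : p.1 =ᵐ[meas L Y] G) (hpx : p.2.1 =ᵐ[meas L Y] dx G)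
    (hpY : p.2.2 =ᵐ[meas L Y] dY q r G) :
    weakForm L Y q r V p (tensor φ ψ) - l * ∫ z, p.1 z * tensor φ ψ z ∂meas L Y
      = ∫ z, (dx G z * tensor (deriv φ) ψ z
            + G z * tensor (fun x => (V x + μ ^ 2 * q x ^ 2 - l) * φ x) ψ z) ∂meas L Y
        + ∫ z, (dY q r G z * tensor (fun x => q x * φ x) (fun y => r y * deriv ψ y) z
            - G z * tensor (fun x => μ ^ 2 * q x ^ 2 * φ x) ψ z) ∂meas L Y := by
  have hφψ := isFormTest_tensor hq hr hφ hψ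
  have hmass : Integrable (fun z => p.1 z * tensor φ ψ z) (meas L Y) :=
    (Lp.memLp p.1).integrable_mul hφψ.memLp
  have hP : MemLp (fun x => V x + μ ^ 2 * q x ^ 2) ⊤ (measX L) := hV.add hq2
  rw [weakForm, ← integral_const_mul,
    ← integral_sub (hφψ.integrable_weakForm hV p) (hmass.const_mul l),
    ← integral_add (integrable_longitudinal_error hP hφ hψ.memLp l hG)
      (integrable_transversal_error hr hq hq2 (hφ.memLp 2) hψ hG)]
  refine integral_congr_ae ?_
  filter_upwards [hp, hpx, hpY] with z hz hzx hzY
  rw [hz, hzx, hzY, dx_tensor, dY_tensor]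
  simp only [tensor]
  ring

theorem IsLongitudinalQuasimode.isQuasimode_tensor (hL : 0 < L) (hε : 0 < ε)
    (hV : MemLp V ⊤ (measX L)) (hr : IsTransversalCoeff Y r) (hq : MemLp q ⊤ (measX L))
    (hq2 : MemLp (fun x => μ ^ 2 * q x ^ 2) ⊤ (measX L)) (hQ : ∀ x ∈ Ioo (-L) L, |q x| ≤ Q)
    (hφ : IsLongitudinalQuasimode L (fun x => V x + μ ^ 2 * q x ^ 2) l ε φ)
    (hψ : IsTransversalQuasimode Y r (μ ^ 2) ε ψ) :
    IsQuasimode L Y q r V l (ε * (1 + Q ^ 2)) (tensor φ ψ) := by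
  have hφψ := isFormTest_tensor hq hr hφ.test hψ.test
  have hclosed : IsClosed {p : L2 L Y × L2 L Y × L2 L Y |
      |weakForm L Y q r V p (tensor φ ψ) - l * ∫ z, p.1 z * tensor φ ψ z ∂meas L Y|
        ≤ ε * (1 + Q ^ 2) * (1 + (‖p.1‖ ^ 2 + ‖p.2.1‖ ^ 2 + ‖p.2.2‖ ^ 2))} := by
    simp only [hφψ.weakForm_eq_inner hV, hφψ.integral_mul_eq_inner]
    exact isClosed_le (by fun_prop) (by fun_prop)
  refine ⟨hφψ, fun p hp => closure_minimal ?_ hclosed hp⟩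
  clear p hp
  rintro p ⟨G, hGtest, hp, hpx, hpY⟩
  have hG : IsFormTest L Y q r G := ⟨hGtest, (memLp_congr_ae hp).1 (Lp.memLp _),
    (memLp_congr_ae hpx).1 (Lp.memLp _), (memLp_congr_ae hpY).1 (Lp.memLp _)⟩
  have hlong := hφ.abs_error_le hL hε (hV.add hq2) hψ.test.memLp hψ.normalized hG
  have htrans := hψ.abs_error_le hε hr hq hq2 hQ (hφ.test.memLp 2) hφ.normalized hG
  rw [mem_ofPred_eq, weakForm_tensor_sub hV hr hq hq2 hφ.test hψ.test l hG hp hpx hpY]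
  rw [← norm_sq_eq_integral hp, ← norm_sq_eq_integral hpx] at hlong
  rw [← norm_sq_eq_integral hp, ← norm_sq_eq_integral hpY] at htrans
  refine (abs_add_le _ _).trans ((add_le_add hlong htrans).trans ?_)
  nlinarith [mul_nonneg hε.le (sq_nonneg ‖p.1‖), mul_nonneg hε.le (sq_nonneg ‖p.2.1‖),
    mul_nonneg hε.le (sq_nonneg ‖p.2.2‖), mul_nonneg hε.le (sq_nonneg Q),
    mul_nonneg hε.le (mul_nonneg (sq_nonneg Q) (sq_nonneg ‖p.1‖)),
    mul_nonneg hε.le (mul_nonneg (sq_nonneg Q) (sq_nonneg ‖p.2.1‖)),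
    mul_nonneg hε.le (mul_nonneg (sq_nonneg Q) (sq_nonneg ‖p.2.2‖))]

end Error

/-! ### Pairing of steerable states with quasimodes -/

theorem abs_le_of_forall_abs_le_integral {m : ℝ → ℝ} {T Λ K : ℝ} (hT : 0 ≤ T) (hΛ : 0 ≤ Λ)
    (hm : ContinuousOn m (Icc 0 T))
    (h : ∀ t ∈ Icc 0 T, |m t| ≤ Λ * (∫ s in t..T, |m s|) + K) : |m 0| ≤ K * Real.exp (Λ * T) := by
  set N : ℝ → ℝ := fun t => ∫ s in t..T, |m s| with hN
  have hcontinuousOn : ContinuousOn N (Icc 0 T) := by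
    have := intervalIntegral.continuousOn_primitive_interval_left (μ := volume)
      ((uIcc_of_le hT).symm ▸ hm.abs.integrableOn_Icc)
    rwa [uIcc_of_le hT] at this
  have hderiv : ∀ t ∈ Ioo 0 T, HasDerivAt N (-|m t|) t := fun t ht =>
    intervalIntegral.integral_hasDerivAt_left
      ((hm.abs.mono (Icc_subset_Icc_left ht.1.le)).intervalIntegrable_of_Icc ht.2.le)
      ((hm.abs.mono Ioo_subset_Icc_self).stronglyMeasurableAtFilter isOpen_Ioo t ht)
      (hm.abs.continuousAt (Icc_mem_nhds ht.1 ht.2))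
  have hgrowth : ∀ t ∈ Ioo 0 T, HasDerivAt (fun t => Real.exp (Λ * t) * (Λ * N t + K))
      (Real.exp (Λ * t) * (Λ * (Λ * N t + K - |m t|))) t := fun t ht => by
    have hexp : HasDerivAt (fun t => Real.exp (Λ * t)) (Real.exp (Λ * t) * Λ) t := by
      simpa using ((hasDerivAt_id t).const_mul Λ).exp
    exact (hexp.mul (((hderiv t ht).const_mul Λ).add_const K)).congr_deriv (by ring)
  have hmono : MonotoneOn (fun t => Real.exp (Λ * t) * (Λ * N t + K)) (Icc 0 T) := by
    refine monotoneOn_of_deriv_nonneg (convex_Icc 0 T) (by fun_prop) ?_ ?_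
    · rw [interior_Icc]
      exact fun t ht => (hgrowth t ht).differentiableAt.differentiableWithinAt
    · rw [interior_Icc]
      intro t ht
      rw [(hgrowth t ht).deriv]
      have := h t (Ioo_subset_Icc_self ht)
      exact mul_nonneg (Real.exp_pos _).le (mul_nonneg hΛ (by linarith))
  have hle := hmono (left_mem_Icc.2 hT) (right_mem_Icc.2 hT) hT
  simp only [hN, intervalIntegral.integral_same, mul_zero, Real.exp_zero, one_mul, zero_add] at hle
  linarith [h 0 (left_mem_Icc.2 hT)]

theorem abs_le_of_integral_equation {m c n : ℝ → ℝ} {T Λ : ℝ} (hT : 0 ≤ T) (hΛ : 0 ≤ Λ)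
    (hm : ContinuousOn m (Icc 0 T)) (hc : IntegrableOn c (Ioo 0 T)) (hn : IntegrableOn n (Ioo 0 T))
    (hn0 : ∀ t, 0 ≤ n t) (heq : ∀ t ∈ Icc 0 T, m t + ∫ s in Ioo 0 t, c s = m 0) (hmT : m T = 0)
    (hle : ∀ᵐ t ∂volume.restrict (Ioo 0 T), |c t| ≤ Λ * |m t| + n t) :
    |m 0| ≤ (∫ t in Ioo 0 T, n t) * Real.exp (Λ * T) := by
  refine abs_le_of_forall_abs_le_integral hT hΛ hm fun t ht => ?_
  have hsub : Ioo t T ⊆ Ioo 0 T := Ioo_subset_Ioo_left ht.1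
  have hsplit : ∫ s in Ioo 0 T, c s = (∫ s in Ioo 0 t, c s) + ∫ s in Ioo t T, c s := by
    simp only [← integral_Ioc_eq_integral_Ioo]
    rw [← Ioc_union_Ioc_eq_Ioc ht.1 ht.2]
    rw [← integrableOn_Ioc_iff_integrableOn_Ioo] at hc
    exact setIntegral_union (Ioc_disjoint_Ioc_of_le le_rfl) measurableSet_Ioc
      (hc.mono_set (Ioc_subset_Ioc_right ht.2)) (hc.mono_set (Ioc_subset_Ioc_left ht.1))
  have hmt : m t = ∫ s in Ioo t T, c s := by
    linarith [heq t ht, heq T (right_mem_Icc.2 hT)]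
  have hmi : IntegrableOn (fun s => Λ * |m s|) (Ioo t T) :=
    (hm.abs.integrableOn_Icc.mono_set (hsub.trans Ioo_subset_Icc_self)).const_mul Λ
  rw [intervalIntegral.integral_of_le ht.2, integral_Ioc_eq_integral_Ioo]
  calc |m t| ≤ ∫ s in Ioo t T, (Λ * |m s| + n s) := by
        rw [hmt]
        exact (Real.norm_eq_abs _).symm.trans_le
          (norm_integral_le_of_norm_le (hmi.add (hn.mono_set hsub))
            (ae_mono (Measure.restrict_mono hsub le_rfl) hle))
    _ = Λ * (∫ s in Ioo t T, |m s|) + ∫ s in Ioo t T, n s := by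
        rw [integral_add hmi (hn.mono_set hsub), integral_const_mul]
    _ ≤ Λ * (∫ s in Ioo t T, |m s|) + ∫ s in Ioo 0 T, n s :=
        add_le_add_right (setIntegral_mono_set hn (.of_forall hn0) hsub.eventuallyLE) _

theorem integral_abs_integral_mul_le {α β : Type*} [MeasurableSpace α] [MeasurableSpace β]
    {μ : Measure α} {ν : Measure β} [IsFiniteMeasure μ] [SFinite ν] {u : α × β → ℝ} {F : β → ℝ}
    {s : ℝ} (hu : MemLp u 2 (μ.prod ν)) (hF : MemLp F 2 ν) (hs : 0 < s)
    (hFs : ∫ z, F z ^ 2 ∂ν ≤ s ^ 2) :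
    ∫ t, |∫ z, u (t, z) * F z ∂ν| ∂μ ≤ s * (∫ z, u z ^ 2 ∂μ.prod ν + μ.real univ) := by
  have hF' : MemLp (fun z : α × β => F z.2) 2 (μ.prod ν) := hF.comp_snd μ
  have huF : Integrable (fun z : α × β => u z * F z.2) (μ.prod ν) := hu.integrable_mul hF'
  have hyoung : ∀ a b : ℝ, |a * b| ≤ s * a ^ 2 + s⁻¹ * b ^ 2 := fun a b => by
    have hsq : 0 ≤ s⁻¹ * (s * |a| - |b|) ^ 2 := by positivity
    have hexpand : s⁻¹ * (s * |a| - |b|) ^ 2 = s * a ^ 2 - 2 * |a * b| + s⁻¹ * b ^ 2 := by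
      rw [abs_mul, ← sq_abs a, ← sq_abs b]
      field_simp
      ring
    linarith [abs_nonneg (a * b)]
  calc ∫ t, |∫ z, u (t, z) * F z ∂ν| ∂μ ≤ ∫ t, ∫ z, |u (t, z) * F z| ∂ν ∂μ :=
        integral_mono huF.integral_prod_left.abs huF.abs.integral_prod_left fun t =>
          abs_integral_le_integral_abs
    _ = ∫ z, |u z * F z.2| ∂μ.prod ν := (integral_prod _ huF.abs).symm
    _ ≤ ∫ z, (s * u z ^ 2 + s⁻¹ * F z.2 ^ 2) ∂μ.prod ν :=
        integral_mono huF.abs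
          ((hu.integrable_sq.const_mul _).add (hF'.integrable_sq.const_mul _)) fun z => hyoung _ _
    _ = s * ∫ z, u z ^ 2 ∂μ.prod ν + s⁻¹ * (μ.real univ * ∫ z, F z ^ 2 ∂ν) := by
        rw [integral_add (hu.integrable_sq.const_mul _) (hF'.integrable_sq.const_mul _),
          integral_const_mul, integral_const_mul, integral_prod _ hF'.integrable_sq]
        simp only [integral_const, smul_eq_mul]
    _ ≤ s * ∫ z, u z ^ 2 ∂μ.prod ν + s⁻¹ * (μ.real univ * s ^ 2) := by gcongr
    _ = s * (∫ z, u z ^ 2 ∂μ.prod ν + μ.real univ) := by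
        field_simp

/-- `c = (ε + s) e^{|l| T}` for a quasimode `F` of energy `l` and precision `ε` whose `L²` norm on
`W` is at most `s`. This bounds the pairing of `F` with any initial state that can be steered to `0`
in time `T`, up to a constant that depends on the initial state only. -/
def HasPairingCost (L : ℝ) (Y : YDomain) (q r V : ℝ → ℝ) (W : Set (ℝ × ℝ)) (T : ℝ)
    (F : ℝ × ℝ → ℝ) (c : ℝ) : Prop :=
  ∃ l ε s, 0 ≤ ε ∧ 0 < s ∧ IsQuasimode L Y q r V l ε F ∧ ∫ z in W, F z ^ 2 ∂meas L Y ≤ s ^ 2 ∧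
    c = (ε + s) * Real.exp (|l| * T)

section Pairing

variable {L T : ℝ} {Y : YDomain} {q r V : ℝ → ℝ} {W : Set (ℝ × ℝ)}

theorem IsQuasimode.abs_weakForm_sub_le {l ε : ℝ} {F : ℝ × ℝ → ℝ}
    (hF : IsQuasimode L Y q r V l ε F) {p : L2 L Y × L2 L Y × L2 L Y}
    (hp : p ∈ formGraph L Y q r) (κ : ℝ) :
    |weakForm L Y q r V p F - κ| ≤ |l| * |∫ z, p.1 z * F z ∂meas L Y|
      + (ε * (1 + (‖p.1‖ ^ 2 + ‖p.2.1‖ ^ 2 + ‖p.2.2‖ ^ 2)) + |κ|) := by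
  have herror := hF.form_error_le p hp
  have hsplit := abs_add_le (weakForm L Y q r V p F - l * ∫ z, p.1 z * F z ∂meas L Y)
    (l * ∫ z, p.1 z * F z ∂meas L Y)
  rw [sub_add_cancel, abs_mul] at hsplit
  linarith [abs_sub (weakForm L Y q r V p F) κ]

theorem IsSolution.exists_abs_integral_initial_le {f₀ : L2 L Y} {u : ℝ × (ℝ × ℝ) → ℝ}
    {f : ℝ → L2 L Y} (hT : 0 ≤ T) (hV : MemLp V ⊤ (measX L))
    (hf : IsSolution L Y q r V W T f₀ u f) (hfT : f T = 0) :
    ∃ N ≥ 0, ∀ l ε F, 0 ≤ ε → IsQuasimode L Y q r V l ε F →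
      IntegrableOn (fun t => ∫ z in W, u (t, z) * F z ∂meas L Y) (Ioo 0 T) →
      |∫ z, f₀ z * F z ∂meas L Y|
        ≤ (ε * N + ∫ t in Ioo 0 T, |∫ z in W, u (t, z) * F z ∂meas L Y|)
          * Real.exp (|l| * T) := by
  obtain ⟨hcont, hf0, g, h, hg, hh, hgraph, hweak⟩ := hf
  set n : ℝ → ℝ := fun t => 1 + (‖f t‖ ^ 2 + ‖g t‖ ^ 2 + ‖h t‖ ^ 2)
  have hf2 : IntegrableOn (fun t => ‖f t‖ ^ 2) (Ioo 0 T) :=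
    (hcont.norm.pow 2).integrableOn_Icc.mono_set Ioo_subset_Icc_self
  have hni : IntegrableOn n (Ioo 0 T) :=
    (integrable_const 1).add ((hf2.add (hg.integrable_norm_pow (by simp))).add
      (hh.integrable_norm_pow (by simp)))
  refine ⟨∫ t in Ioo 0 T, n t, integral_nonneg fun t => by positivity, fun l ε F hε hF hk => ?_⟩
  set k : ℝ → ℝ := fun t => ∫ z in W, u (t, z) * F z ∂meas L Y
  set B : ℝ → ℝ := fun t => weakForm L Y q r V (f t, g t, h t) F with hB
  have hBi : IntegrableOn B (Ioo 0 T) := by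
    have hfi : IntegrableOn f (Ioo 0 T) := hcont.integrableOn_Icc.mono_set Ioo_subset_Icc_self
    simp only [hB, hF.formTest.weakForm_eq_inner hV]
    exact (((hg.integrable one_le_two).inner_const _).add
      ((hh.integrable one_le_two).inner_const _)).add (hfi.inner_const _)
  have hm : ContinuousOn (fun t => ∫ z, f t z * F z ∂meas L Y) (Icc 0 T) := by
    simp only [hF.formTest.integral_mul_eq_inner]
    exact hcont.inner continuousOn_const
  have hmT : ∫ z, f T z * F z ∂meas L Y = 0 := by
    rw [hF.formTest.integral_mul_eq_inner, hfT, inner_zero_left]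
  rw [← hf0, ← integral_const_mul, ← integral_add (hni.const_mul ε) hk.abs]
  refine abs_le_of_integral_equation (c := fun t => B t - k t) hT (abs_nonneg l) hm (hBi.sub hk)
    ((hni.const_mul ε).add hk.abs) (fun t => by positivity) (fun t ht => ?_) hmT
    (hgraph.mono fun t ht => hF.abs_weakForm_sub_le ht (k t))
  have hsub : Ioo 0 t ⊆ Ioo 0 T := Ioo_subset_Ioo_right ht.2
  have hsol : _ + ∫ s in Ioo 0 t, B s = _ + ∫ s in Ioo 0 t, k s := hweak F hF.formTest.test t ht
  rw [integral_sub (hBi.mono_set hsub) (hk.mono_set hsub), hf0]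
  linarith

theorem Steerable.exists_abs_integral_le {f₀ : L2 L Y} (hT : 0 ≤ T) (hV : MemLp V ⊤ (measX L))
    (hf₀ : Steerable L Y q r V W T f₀) :
    ∃ C, ∀ F c, HasPairingCost L Y q r V W T F c → |∫ z, f₀ z * F z ∂meas L Y| ≤ C * c := by
  obtain ⟨u, hu, f, hf, hfT⟩ := hf₀
  obtain ⟨N, hN, hpairing⟩ := hf.exists_abs_integral_initial_le hT hV hfT
  have : SFinite (meas L Y) := meas_eq_prod L Y ▸ inferInstance
  set U := ∫ z, u z ^ 2 ∂(volume.restrict (Ioo 0 T)).prod ((meas L Y).restrict W)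
    + (volume.restrict (Ioo 0 T)).real univ
  have hU : 0 ≤ U := add_nonneg (integral_nonneg fun z => sq_nonneg _) measureReal_nonneg
  refine ⟨N + U, fun F c ⟨l, ε, s, hε, hs, hF, hFW, hc⟩ => ?_⟩
  have hFm : MemLp F 2 ((meas L Y).restrict W) := hF.formTest.memLp.restrict W
  have huF := (hu.integrable_mul (hFm.comp_snd _)).integral_prod_left
  calc |∫ z, f₀ z * F z ∂meas L Y|
      ≤ (ε * N + s * U) * Real.exp (|l| * T) := by
        refine (hpairing l ε F hε hF huF).trans ?_
        gcongr
        exact integral_abs_integral_mul_le hu hFm hs hFW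
    _ ≤ (N + U) * ((ε + s) * Real.exp (|l| * T)) := by
        rw [← mul_assoc]
        gcongr
        nlinarith
    _ = (N + U) * c := by rw [hc]

end Pairing

/-! ### Lack of null controllability -/

section UniformPairing

variable {L T : ℝ} {Y : YDomain} {q r V : ℝ → ℝ} {W : Set (ℝ × ℝ)} {F G : ℝ × ℝ → ℝ}

theorem exists_forall_abs_le_of_forall_exists {E ι : Type*} [NormedAddCommGroup E]
    [NormedSpace ℝ E] [CompleteSpace E] {a : ι → E →L[ℝ] ℝ} {m : ι → ℝ} (hm : ∀ i, 0 < m i)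
    (h : ∀ p, ∃ K, ∀ i, |a i p| ≤ K * m i) : ∃ K ≥ 0, ∀ i p, |a i p| ≤ K * m i * ‖p‖ := by
  have hpointwise : ∀ p, ∃ K, ∀ i, ‖((m i)⁻¹ • a i) p‖ ≤ K := fun p => by
    refine (h p).imp fun K hK i => ?_
    rw [smul_apply, norm_smul, norm_inv, Real.norm_of_nonneg (hm i).le,
      inv_mul_le_iff₀ (hm i), mul_comm]
    exact hK i
  obtain ⟨K, hK⟩ := banach_steinhaus hpointwise
  refine ⟨|K|, abs_nonneg K, fun i p => ?_⟩
  have hle := ((m i)⁻¹ • a i).le_of_opNorm_le ((hK i).trans (le_abs_self K)) p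
  rwa [smul_apply, norm_smul, norm_inv, Real.norm_of_nonneg (hm i).le,
    inv_mul_le_iff₀ (hm i), Real.norm_eq_abs, ← mul_assoc, mul_comm (m i)] at hle

theorem dx_add (hF : IsTest L Y F) (hG : IsTest L Y G) : dx (F + G) = dx F + dx G := by
  funext z
  have hslice : ∀ {H}, IsTest L Y H → DifferentiableAt ℝ (fun x => H (x, z.2)) z.1 := fun hH =>
    (hH.smooth.comp (contDiff_id.prodMk contDiff_const)).differentiable (by simp) z.1
  exact deriv_add (hslice hF) (hslice hG)

theorem dY_add (q r : ℝ → ℝ) (hF : IsTest L Y F) (hG : IsTest L Y G) :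
    dY q r (F + G) = dY q r F + dY q r G := by
  funext z
  have hslice : ∀ {H}, IsTest L Y H → DifferentiableAt ℝ (fun y => H (z.1, y)) z.2 := fun hH =>
    (hH.smooth.comp (contDiff_const.prodMk contDiff_id)).differentiable (by simp) z.2
  simp only [dY, Pi.add_apply, deriv_fun_add (hslice hF) (hslice hG), mul_add]

theorem dx_const_smul (c : ℝ) (F : ℝ × ℝ → ℝ) : dx (c • F) = c • dx F := by
  funext z
  simp only [dx, Pi.smul_apply, smul_eq_mul, deriv_const_mul_field]

theorem dY_const_smul (q r : ℝ → ℝ) (c : ℝ) (F : ℝ × ℝ → ℝ) :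
    dY q r (c • F) = c • dY q r F := by
  funext z
  simp only [dY, Pi.smul_apply, smul_eq_mul, deriv_const_mul_field, mul_left_comm]

/-- The triples `(F, ∂_x F, q r ∂_y F)` in `L²(Ω)³`, for test functions `F`. Their closure is
`formGraph`. -/
def testTriples (L : ℝ) (Y : YDomain) (q r : ℝ → ℝ) :
    Submodule ℝ (L2 L Y × L2 L Y × L2 L Y) where
  carrier := {p | ∃ F, IsTest L Y F ∧ p.1 =ᵐ[meas L Y] F ∧ p.2.1 =ᵐ[meas L Y] dx F ∧
    p.2.2 =ᵐ[meas L Y] dY q r F}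
  add_mem' := by
    rintro p p' ⟨F, hF, hp, hpx, hpY⟩ ⟨G, hG, hp', hpx', hpY'⟩
    exact ⟨F + G, hF.add hG, (Lp.coeFn_add _ _).trans (hp.add hp'),
      (Lp.coeFn_add _ _).trans (dx_add hF hG ▸ hpx.add hpx'),
      (Lp.coeFn_add _ _).trans (dY_add q r hF hG ▸ hpY.add hpY')⟩
  zero_mem' := by
    exact ⟨0, IsTest.zero L Y, Lp.coeFn_zero _ _ _,
      (Lp.coeFn_zero _ _ _).trans (.of_forall fun z => by simp [dx]),
      (Lp.coeFn_zero _ _ _).trans (.of_forall fun z => by simp [dY])⟩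
  smul_mem' := by
    rintro c p ⟨F, hF, hp, hpx, hpY⟩
    exact ⟨c • F, hF.const_smul c, (Lp.coeFn_smul _ _).trans (hp.const_smul c),
      (Lp.coeFn_smul _ _).trans (dx_const_smul c F ▸ hpx.const_smul c),
      (Lp.coeFn_smul _ _).trans (dY_const_smul q r c F ▸ hpY.const_smul c)⟩

theorem IsFormTest.triple_mem_formGraph (hF : IsFormTest L Y q r F) :
    (hF.memLp.toLp, hF.memLp_dx.toLp, hF.memLp_dY.toLp) ∈ formGraph L Y q r :=
  subset_closure ⟨F, hF.test, hF.memLp.coeFn_toLp, hF.memLp_dx.coeFn_toLp, hF.memLp_dY.coeFn_toLp⟩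

theorem norm_triple_le (p : L2 L Y × L2 L Y × L2 L Y) :
    ‖p‖ ≤ 1 + (‖p.1‖ ^ 2 + ‖p.2.1‖ ^ 2 + ‖p.2.2‖ ^ 2) := by
  have hle : ∀ t : ℝ, t ≤ 1 + t ^ 2 := fun t => by nlinarith [sq_nonneg (t - 1)]
  have hnonneg := fun f : L2 L Y => sq_nonneg ‖f‖
  refine max_le ?_ (max_le ?_ ?_)
  · linarith [hle ‖p.1‖, hnonneg p.2.1, hnonneg p.2.2]
  · linarith [hle ‖p.2.1‖, hnonneg p.1, hnonneg p.2.2]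
  · linarith [hle ‖p.2.2‖, hnonneg p.1, hnonneg p.2.1]

theorem HasPairingCost.isFormTest {c : ℝ} (hF : HasPairingCost L Y q r V W T F c) :
    IsFormTest L Y q r F := by
  obtain ⟨l, ε, s, -, -, hF, -⟩ := hF
  exact hF.formTest

theorem HasPairingCost.pos {c : ℝ} (hF : HasPairingCost L Y q r V W T F c) : 0 < c := by
  obtain ⟨l, ε, s, hε, hs, -, -, rfl⟩ := hF
  positivity

theorem exists_integral_sq_le_of_forall_steerable (hT : 0 ≤ T) (hV : MemLp V ⊤ (measX L))
    (h : ∀ f₀ ∈ formDomain L Y q r, Steerable L Y q r V W T f₀) :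
    ∃ K ≥ 0, ∀ F c, HasPairingCost L Y q r V W T F c →
      ∫ z, F z ^ 2 ∂meas L Y ≤ K * c * (1 + (∫ z, F z ^ 2 ∂meas L Y
        + ∫ z, dx F z ^ 2 ∂meas L Y + ∫ z, dY q r F z ^ 2 ∂meas L Y)) := by
  set E := (testTriples L Y q r).topologicalClosure
  have : CompleteSpace E := (testTriples L Y q r).isClosed_topologicalClosure.completeSpace_coe
  let ι := {x : (ℝ × ℝ → ℝ) × ℝ // HasPairingCost L Y q r V W T x.1 x.2}
  let pairing : ι → E →L[ℝ] ℝ := fun i =>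
    (innerSL ℝ i.2.isFormTest.memLp.toLp).comp ((ContinuousLinearMap.fst ℝ _ _).comp E.subtypeL)
  have hpairing : ∀ (i : ι) (p : E), pairing i p = ⟪p.1.1, i.2.isFormTest.memLp.toLp⟫ :=
    fun i p => by simp only [pairing, ContinuousLinearMap.comp_apply, innerSL_apply_apply,
      ContinuousLinearMap.coe_fst', Submodule.subtypeL_apply, real_inner_comm]
  obtain ⟨K, hK, huniform⟩ := exists_forall_abs_le_of_forall_exists (a := pairing)
    (m := fun i => i.1.2) (fun i => i.2.pos) fun p => by
      obtain ⟨C, hC⟩ := (h p.1.1 ⟨_, _, p.2⟩).exists_abs_integral_le hT hV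
      refine ⟨C, fun i => ?_⟩
      rw [hpairing, ← i.2.isFormTest.integral_mul_eq_inner]
      exact hC _ _ i.2
  refine ⟨K, hK, fun F c hF => ?_⟩
  have hFtest := hF.isFormTest
  have hle := huniform ⟨(F, c), hF⟩ ⟨_, hFtest.triple_mem_formGraph⟩
  rw [hpairing, real_inner_self_eq_norm_sq, abs_of_nonneg (sq_nonneg _)] at hle
  rw [← norm_toLp_sq hFtest.memLp, ← norm_toLp_sq hFtest.memLp_dx, ← norm_toLp_sq hFtest.memLp_dY]
  exact hle.trans (mul_le_mul_of_nonneg_left (norm_triple_le _) (mul_nonneg hK hF.pos.le))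

end UniformPairing

section NonSteerable

variable {L T b d d' μ ε : ℝ} {Y : YDomain} {q r V D φ ψ : ℝ → ℝ} {A : Set ℝ}

theorem integral_meas_tensor_sq (L : ℝ) (Y : YDomain) (φ ψ : ℝ → ℝ) :
    ∫ z, tensor φ ψ z ^ 2 ∂meas L Y = (∫ x, φ x ^ 2 ∂measX L) * ∫ y, ψ y ^ 2 ∂measY Y := by
  rw [meas_eq_prod, integral_tensor_sq]

theorem setIntegral_strip_tensor_sq (L : ℝ) (Y : YDomain) (A : Set ℝ) (φ ψ : ℝ → ℝ) :
    ∫ z in A ×ˢ Y.carrier, tensor φ ψ z ^ 2 ∂meas L Y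
      = (∫ x in A, φ x ^ 2 ∂measX L) * ∫ y, ψ y ^ 2 ∂measY Y := by
  rw [meas_eq_prod, ← Measure.prod_restrict, Measure.restrict_restrict_of_subset subset_rfl,
    integral_tensor_sq]

theorem IsTransversalQuasimode.energy_le {ν : ℝ} (hν : 0 ≤ ν) (hε : 0 ≤ ε) (hε1 : ε ≤ 1)
    (hψ : IsTransversalQuasimode Y r ν ε ψ) :
    ∫ y, (r y * deriv ψ y) ^ 2 ∂measY Y ≤ 2 * ν + 2 := by
  have herror := hψ.form_error_sq_le ψ hψ.test
  simp only [← sq, hψ.normalized, mul_one] at herror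
  have hE : 0 ≤ ∫ y, (r y * deriv ψ y) ^ 2 ∂measY Y := integral_nonneg fun y => sq_nonneg _
  have hε2 : ε ^ 2 ≤ 1 := pow_le_one₀ hε hε1
  by_contra! hlt
  nlinarith

theorem integral_mul_sq_le (hq : MemLp q ⊤ (measX L)) {Q : ℝ}
    (hQ : ∀ x ∈ Ioo (-L) L, |q x| ≤ Q) (hφ : MemLp φ 2 (measX L)) :
    ∫ x, (q x * φ x) ^ 2 ∂measX L ≤ Q ^ 2 * ∫ x, φ x ^ 2 ∂measX L := by
  rw [← integral_const_mul]
  refine integral_mono_ae (hφ.mul hq).integrable_sq (hφ.integrable_sq.const_mul _)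
    (ae_restrict_of_forall_mem measurableSet_Ioo fun x hx => ?_)
  dsimp only
  rw [mul_pow, ← sq_abs (q x)]
  gcongr
  exact hQ x hx

theorem energy_tensor_le {P : ℝ → ℝ} {Q l m : ℝ} (hμ : 1 ≤ μ) (hε : 0 ≤ ε) (hε1 : ε ≤ 1)
    (hq : MemLp q ⊤ (measX L)) (hQ : ∀ x ∈ Ioo (-L) L, |q x| ≤ Q)
    (hφ : IsLongitudinalQuasimode L P l ε φ) (hφm : ∫ x, deriv φ x ^ 2 ∂measX L ≤ m)
    (hψ : IsTransversalQuasimode Y r (μ ^ 2) ε ψ) :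
    ∫ z, tensor φ ψ z ^ 2 ∂meas L Y + ∫ z, dx (tensor φ ψ) z ^ 2 ∂meas L Y
      + ∫ z, dY q r (tensor φ ψ) z ^ 2 ∂meas L Y ≤ 1 + m + 4 * Q ^ 2 * μ ^ 2 := by
  have hweight := integral_mul_sq_le hq hQ (hφ.test.memLp 2)
  have henergy := hψ.energy_le (sq_nonneg μ) hε hε1
  rw [hφ.normalized, mul_one] at hweight
  rw [dx_tensor, dY_tensor, integral_meas_tensor_sq, integral_meas_tensor_sq,
    integral_meas_tensor_sq, hφ.normalized, hψ.normalized, mul_one, mul_one]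
  refine add_le_add (add_le_add_right hφm 1) ?_
  calc (∫ x, (q x * φ x) ^ 2 ∂measX L) * ∫ y, (r y * deriv ψ y) ^ 2 ∂measY Y
      ≤ Q ^ 2 * (2 * μ ^ 2 + 2) := by gcongr
    _ ≤ 4 * Q ^ 2 * μ ^ 2 := by nlinarith [mul_nonneg (sq_nonneg Q) (sub_nonneg.2 hμ)]

theorem pairing_cost_le {l C : ℝ} (Q : ℝ) (hT : 0 ≤ T) (hμ : 1 ≤ μ) (hC : 0 ≤ C)
    (hl : |l| ≤ b * μ + C) :
    (Real.exp (-(μ * d')) * (1 + Q ^ 2) + (1 + (b * μ + C)) * Real.exp (-(μ * d')))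
        * Real.exp (|l| * T)
      ≤ (2 + Q ^ 2 + b + C) * Real.exp (C * T) * μ * Real.exp (-(d' - b * T) * μ) := by
  have hgrowth : Real.exp (|l| * T) ≤ Real.exp (C * T) * Real.exp (b * T * μ) := by
    rw [← Real.exp_add]
    exact Real.exp_le_exp.2 ((mul_le_mul_of_nonneg_right hl hT).trans_eq (by ring))
  have hprefactor : 1 + Q ^ 2 + (1 + (b * μ + C)) ≤ (2 + Q ^ 2 + b + C) * μ := by
    nlinarith [sq_nonneg Q]
  have hprefactor_nonneg : 0 ≤ 1 + Q ^ 2 + (1 + (b * μ + C)) := by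
    linarith [sq_nonneg Q, (abs_nonneg l).trans hl]
  have hbound_nonneg := hprefactor_nonneg.trans hprefactor
  calc _ = (1 + Q ^ 2 + (1 + (b * μ + C))) * Real.exp (-(μ * d')) * Real.exp (|l| * T) := by ring
    _ ≤ (2 + Q ^ 2 + b + C) * μ * Real.exp (-(μ * d'))
        * (Real.exp (C * T) * Real.exp (b * T * μ)) := by gcongr
    _ = (2 + Q ^ 2 + b + C) * Real.exp (C * T) * μ
        * (Real.exp (-(μ * d')) * Real.exp (b * T * μ)) := by ring
    _ = _ := by rw [← Real.exp_add]; ring_nf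

theorem exists_hasPairingCost (hL : 0 < L) (hT : 0 ≤ T) (hq : IsDegenerateCoeff L q)
    (hr : IsTransversalCoeff Y r) (hV : MemLp V ⊤ (measX L)) (hb : |deriv q 0| < b)
    (hD : IsAgmonWeight L q A d D) (hA : MeasurableSet A) (hdist : 0 < Metric.infDist 0 A)
    (hd' : 0 < d') (hd : d' < d) :
    ∃ K₁ K₂, ∀ N, ∃ μ ≥ N, ∃ F c, HasPairingCost L Y q r V (A ×ˢ Y.carrier) T F c ∧
      c ≤ K₁ * μ * Real.exp (-(d' - b * T) * μ) ∧ ∫ z, F z ^ 2 ∂meas L Y = 1 ∧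
      1 + (∫ z, F z ^ 2 ∂meas L Y + ∫ z, dx F z ^ 2 ∂meas L Y
        + ∫ z, dY q r F z ^ 2 ∂meas L Y) ≤ K₂ * μ ^ 2 := by
  obtain ⟨C, hC, M, -, hlong⟩ := exists_longitudinal_quasimode hL hq hV hb hD hA hdist hd' hd
  obtain ⟨Q, -, hQ⟩ := hq.exists_abs_le
  replace hQ := fun x (hx : x ∈ Ioo (-L) L) => hQ x (Ioo_subset_Icc_self hx)
  have hqm := memLp_top_of_continuousOn hq.smooth.continuousOn
  refine ⟨(2 + Q ^ 2 + b + C) * Real.exp (C * T), 2 + b + C + 4 * Q ^ 2, fun N => ?_⟩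
  obtain ⟨ν, hν, htrans⟩ := exists_transversal_energy_ge hr (max 1 (max N M) ^ 2)
  obtain ⟨μ, hμ, rfl⟩ : ∃ μ, max 1 (max N M) ≤ μ ∧ μ ^ 2 = ν :=
    ⟨√ν, Real.le_sqrt_of_sq_le hν, Real.sq_sqrt ((sq_nonneg _).trans hν)⟩
  obtain ⟨hμ1, hμN, hμM⟩ : 1 ≤ μ ∧ N ≤ μ ∧ M ≤ μ := by simpa only [max_le_iff] using hμ
  have hε : 0 < Real.exp (-(μ * d')) := Real.exp_pos _
  have hε1 : Real.exp (-(μ * d')) ≤ 1 := Real.exp_le_one_iff.2 (by nlinarith)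
  obtain ⟨ψ, hψ⟩ := htrans _ hε
  obtain ⟨l, φ, hφ, hl, hφ', hφA⟩ := hlong μ hμM _ hε
  have hmass : 0 ≤ b * μ + C := (abs_nonneg l).trans hl
  refine ⟨μ, hμN, tensor φ ψ, _, ⟨l, Real.exp (-(μ * d')) * (1 + Q ^ 2),
    (1 + (b * μ + C)) * Real.exp (-(μ * d')), by positivity, by positivity,
    hφ.isQuasimode_tensor hL hε hV hr hqm
      (memLp_top_of_continuousOn (continuousOn_const.mul (hq.smooth.continuousOn.pow 2))) hQ hψ,
    ?_, rfl⟩, pairing_cost_le Q hT hμ1 hC hl, ?_, ?_⟩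
  · rw [setIntegral_strip_tensor_sq, hψ.normalized, mul_one, mul_pow, ← Real.exp_nat_mul]
    refine hφA.trans ?_
    rw [show ((2 : ℕ) : ℝ) * -(μ * d') = -(2 * μ * d') by push_cast; ring]
    gcongr
    nlinarith
  · rw [integral_meas_tensor_sq, hφ.normalized, hψ.normalized, mul_one]
  · have henergy := energy_tensor_le hμ1 hε.le hε1 hqm hQ hφ hφ' hψ
    have hb0 : 0 ≤ b := (abs_nonneg _).trans hb.le
    nlinarith [mul_nonneg hb0 (sub_nonneg.2 hμ1), mul_nonneg hC (sub_nonneg.2 hμ1)]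

theorem exists_not_steerable_of_isAgmonWeight (hL : 0 < L) (hT : 0 < T)
    (hq : IsDegenerateCoeff L q) (hr : IsTransversalCoeff Y r) (hV : MemLp V ⊤ (measX L))
    (hD : IsAgmonWeight L q A d D) (hA : MeasurableSet A) (hdist : 0 < Metric.infDist 0 A)
    (hTd : T * |deriv q 0| < d) :
    ∃ f₀ ∈ formDomain L Y q r, ¬ Steerable L Y q r V (A ×ˢ Y.carrier) T f₀ := by
  by_contra! hsteer
  obtain ⟨b, hb, hbT⟩ := exists_between ((lt_div_iff₀' hT).2 hTd)
  rw [lt_div_iff₀' hT, mul_comm] at hbT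
  obtain ⟨d', hbd', hd⟩ := exists_between hbT
  have hd' : 0 < d' := (mul_nonneg ((abs_nonneg _).trans hb.le) hT.le).trans_lt hbd'
  obtain ⟨K, hK, hle⟩ := exists_integral_sq_le_of_forall_steerable hT.le hV hsteer
  obtain ⟨K₁, K₂, hmodes⟩ := exists_hasPairingCost hL hT.le hq hr hV hb hD hA hdist hd' hd
  have hdecay : Tendsto (fun μ => K * K₁ * K₂ * (μ ^ 3 * Real.exp (-(d' - b * T) * μ))) atTop
      (𝓝 (K * K₁ * K₂ * 0)) := by
    refine Tendsto.const_mul _ ?_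
    exact_mod_cast tendsto_rpow_mul_exp_neg_mul_atTop_nhds_zero 3 _ (sub_pos.2 hbd')
  rw [mul_zero] at hdecay
  obtain ⟨N, hN⟩ := eventually_atTop.1 (hdecay.eventually_lt_const one_pos)
  obtain ⟨μ, hμ, F, c, hF, hc, hnorm, henergy⟩ := hmodes N
  refine (hN μ hμ).not_ge ?_
  calc 1 ≤ K * c * (1 + (∫ z, F z ^ 2 ∂meas L Y + ∫ z, dx F z ^ 2 ∂meas L Y
        + ∫ z, dY q r F z ^ 2 ∂meas L Y)) := hnorm.symm.trans_le (hle F c hF)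
    _ ≤ K * c * (K₂ * μ ^ 2) :=
        mul_le_mul_of_nonneg_left henergy (mul_nonneg hK hF.pos.le)
    _ ≤ K * (K₁ * μ * Real.exp (-(d' - b * T) * μ)) * (K₂ * μ ^ 2) := by
        have := henergy.trans' (by positivity)
        gcongr
    _ = K * K₁ * K₂ * (μ ^ 3 * Real.exp (-(d' - b * T) * μ)) := by ring

end NonSteerable

/-! ### The Agmon distance -/

section AgmonDistance

variable {L d x : ℝ} {q Q : ℝ → ℝ} {A : Set ℝ}

theorem agmonDist_eq_abs_integral (q : ℝ → ℝ) (x : ℝ) :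
    agmonDist q x = |(∫ s in (0)..x, |q s|)| := by
  rw [intervalIntegral.abs_integral_eq_abs_integral_uIoc,
    abs_of_nonneg (integral_nonneg fun s => abs_nonneg (q s)), agmonDist,
    intervalIntegral.integral_of_le min_le_max, uIoc]

theorem agmonDist_nonneg (q : ℝ → ℝ) (x : ℝ) : 0 ≤ agmonDist q x :=
  (abs_nonneg _).trans_eq (agmonDist_eq_abs_integral q x).symm

theorem agmonDist_congr_abs (h : ∀ x, |Q x| = |q x|) : agmonDist Q = agmonDist q := by
  funext x
  simp only [agmonDist, h]

theorem agmonDistSet_le (q : ℝ → ℝ) (hx : x ∈ A) : agmonDistSet q A ≤ agmonDist q x :=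
  csInf_le ⟨0, forall_mem_image.2 fun y _ => agmonDist_nonneg q y⟩ (mem_image_of_mem _ hx)

theorem continuousOn_agmonDist (hL : 0 ≤ L) (hq : ContinuousOn q (Icc (-L) L)) :
    ContinuousOn (agmonDist q) (Icc (-L) L) := by
  rw [← uIcc_of_le (neg_le_self hL)] at hq ⊢
  have hmem : (0 : ℝ) ∈ uIcc (-L) L := mem_uIcc_of_le (neg_nonpos.2 hL) hL
  exact (intervalIntegral.continuousOn_primitive_interval' hq.abs.intervalIntegrable
    hmem).abs.congr fun x _ => agmonDist_eq_abs_integral q x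

theorem agmonDist_pos (hq : ContinuousOn q (Icc (-L) L))
    (hne : ∀ x ∈ Icc (-L) L, x ≠ 0 → q x ≠ 0) (hx : x ∈ Icc (-L) L) (hx0 : x ≠ 0) :
    0 < agmonDist q x := by
  have hL : 0 ≤ L := (abs_nonneg x).trans (abs_le.2 hx)
  have hsub : Icc (min 0 x) (max 0 x) ⊆ Icc (-L) L :=
    Icc_subset_Icc (le_min (neg_nonpos.2 hL) hx.1) (max_le hL hx.2)
  refine intervalIntegral.intervalIntegral_pos_of_pos_on
    ((hq.mono hsub).abs.intervalIntegrable_of_Icc min_le_max)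
    (fun s hs => abs_pos.2 (hne s (hsub (Ioo_subset_Icc_self hs)) ?_)) (min_lt_max.2 hx0.symm)
  rintro rfl
  rcases le_total 0 x with h | h
  · exact (min_eq_left h ▸ hs.1).false
  · exact (max_eq_left h ▸ hs.2).false

theorem exists_pos_forall_le_agmonDist (hL : 0 ≤ L) (hq : ContinuousOn q (Icc (-L) L))
    (hne : ∀ x ∈ Icc (-L) L, x ≠ 0 → q x ≠ 0) (hA : A ⊆ Icc (-L) L)
    (hdist : 0 < Metric.infDist 0 A) : ∃ d > 0, ∀ x ∈ A, d ≤ agmonDist q x := by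
  obtain ⟨d, hd, hle⟩ := exists_pos_forall_le_abs (continuousOn_agmonDist hL hq)
    (fun x hx hx0 => (agmonDist_pos hq hne hx hx0).ne') hdist
  refine ⟨d, hd, fun x hx => (hle x (hA hx) ?_).trans_eq (abs_of_nonneg (agmonDist_nonneg q x))⟩
  simpa using Metric.infDist_le_dist_of_mem (x := (0 : ℝ)) hx

theorem agmonDistSet_pos (hL : 0 ≤ L) (hq : ContinuousOn q (Icc (-L) L))
    (hne : ∀ x ∈ Icc (-L) L, x ≠ 0 → q x ≠ 0) (hA : A ⊆ Icc (-L) L)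
    (hdist : 0 < Metric.infDist 0 A) : 0 < agmonDistSet q A := by
  have hA0 : A.Nonempty := by
    by_contra! h
    simp [h] at hdist
  obtain ⟨d, hd, hle⟩ := exists_pos_forall_le_agmonDist hL hq hne hA hdist
  exact hd.trans_le (le_csInf (hA0.image _) (forall_mem_image.2 hle))

theorem agmonDist_eq_integral (hQ : ∀ x ∈ Icc (-L) L, 0 ≤ x * Q x) (hx : x ∈ Icc (-L) L) :
    agmonDist Q x = ∫ s in (0)..x, Q s := by
  rcases le_total 0 x with h0 | h0
  · rw [agmonDist, min_eq_left h0, max_eq_right h0]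
    refine intervalIntegral.integral_congr_Ioo_of_le h0 fun s hs => abs_of_nonneg ?_
    exact nonneg_of_mul_nonneg_right (hQ s ⟨by linarith [hs.1, hs.2, hx.2], hs.2.le.trans hx.2⟩)
      hs.1
  · rw [agmonDist, min_eq_right h0, max_eq_left h0, intervalIntegral.integral_symm x 0,
      ← intervalIntegral.integral_neg]
    refine intervalIntegral.integral_congr_Ioo_of_le h0 fun s hs => abs_of_nonpos ?_
    exact nonpos_of_mul_nonneg_right (hQ s ⟨hx.1.trans hs.1.le, by linarith [hs.1, hs.2, hx.1]⟩)
      hs.2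

end AgmonDistance

/-! ### Agmon weights -/

section AgmonWeight

variable {L d x : ℝ} {q Q : ℝ → ℝ} {A : Set ℝ}

theorem hasDerivAt_integral_of_continuousOn_Icc (hQ : ContinuousOn Q (Icc (-L) L))
    (hx : x ∈ Ioo (-L) L) : HasDerivAt (fun x => ∫ s in (0)..x, Q s) (Q x) x := by
  have hL : 0 < L := neg_lt_self_iff.1 (hx.1.trans hx.2)
  exact intervalIntegral.integral_hasDerivAt_right
    (hQ.mono (uIcc_subset_Icc ⟨neg_nonpos.2 hL.le, hL.le⟩
      (Ioo_subset_Icc_self hx))).intervalIntegrable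
    ((hQ.mono Ioo_subset_Icc_self).stronglyMeasurableAtFilter isOpen_Ioo x hx)
    (hQ.continuousAt (Icc_mem_nhds hx.1 hx.2))

theorem isAgmonWeight_integral (hQ : ContDiffOn ℝ ∞ Q (Icc (-L) L))
    (hQq : ∀ x ∈ Ioo (-L) L, |Q x| ≤ |q x|) (hsign : ∀ x ∈ Icc (-L) L, 0 ≤ x * Q x)
    (hA : A ⊆ Icc (-L) L) (hd : ∀ x ∈ A, d ≤ agmonDist Q x) :
    IsAgmonWeight L q A d fun x => ∫ s in (0)..x, Q s where
  smooth := by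
    have hderiv := fun x hx => hasDerivAt_integral_of_continuousOn_Icc hQ.continuousOn (x := x) hx
    exact (contDiffOn_infty_iff_deriv_of_isOpen isOpen_Ioo).2
      ⟨fun x hx => (hderiv x hx).differentiableAt.differentiableWithinAt,
        (hQ.mono Ioo_subset_Icc_self).congr fun x hx => (hderiv x hx).deriv⟩
  zero := intervalIntegral.integral_same
  abs_deriv_le x hx := by
    rw [(hasDerivAt_integral_of_continuousOn_Icc hQ.continuousOn hx).deriv]
    exact hQq x hx
  le x hx := (hd x hx).trans_eq (agmonDist_eq_integral hsign (hA hx))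

theorem IsDegenerateCoeff.deriv_mul_nonneg (hL : 0 < L) (hq : IsDegenerateCoeff L q)
    (hx : x ∈ Icc (-L) L) : 0 ≤ deriv q 0 * (x * q x) := by
  have hnhds : Icc (-L) L ∈ 𝓝 0 := Icc_mem_nhds (neg_lt_zero.2 hL) hL
  have hcont : ContinuousOn (dslope q 0) (Icc (-L) L) := (continuousOn_dslope hnhds).2
    ⟨hq.smooth.continuousOn, (hq.smooth.contDiffAt hnhds).differentiableAt (by simp)⟩
  have hslope : ∀ y, y ≠ 0 → dslope q 0 y = q y / y := fun y hy => by
    rw [dslope_of_ne _ hy, slope_def_field, hq.zero, sub_zero, sub_zero]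
  suffices hpos : 0 ≤ deriv q 0 * dslope q 0 x by
    rcases eq_or_ne x 0 with rfl | hx0
    · rw [zero_mul, mul_zero]
    · rw [hslope x hx0] at hpos
      calc 0 ≤ deriv q 0 * (q x / x) * x ^ 2 := mul_nonneg hpos (sq_nonneg x)
        _ = deriv q 0 * (x * q x) := by field_simp
  by_contra! hneg
  have hq' : deriv q 0 ≠ 0 := left_ne_zero_of_mul hneg.ne
  obtain ⟨y, hy, hy0⟩ := isPreconnected_Icc.intermediate_value hx (mem_of_mem_nhds hnhds)
    (continuousOn_const.mul hcont) ⟨hneg.le, (by rw [dslope_same]; exact mul_self_nonneg _ :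
      0 ≤ deriv q 0 * dslope q 0 0)⟩
  have hslope_zero : dslope q 0 y = 0 := (mul_eq_zero.1 hy0).resolve_left hq'
  rcases eq_or_ne y 0 with rfl | hyne
  · exact hq' (dslope_same q 0 ▸ hslope_zero)
  · rw [hslope y hyne] at hslope_zero
    exact div_ne_zero (hq.ne_zero y hy hyne) hyne hslope_zero

theorem IsDegenerateCoeff.exists_isAgmonWeight_agmonDistSet (hL : 0 < L)
    (hq : IsDegenerateCoeff L q) (hq' : deriv q 0 ≠ 0) (hA : A ⊆ Icc (-L) L) :
    ∃ D, IsAgmonWeight L q A (agmonDistSet q A) D := by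
  set σ := deriv q 0 / |deriv q 0|
  have hσ : ∀ x, |σ * q x| = |q x| := fun x => by
    rw [abs_mul, abs_div, abs_abs, div_self (abs_ne_zero.2 hq'), one_mul]
  refine ⟨_, isAgmonWeight_integral (contDiffOn_const.mul hq.smooth) (fun x _ => (hσ x).le)
    (fun x hx => ?_) hA fun x hx => ?_⟩
  · calc 0 ≤ deriv q 0 * (x * q x) / |deriv q 0| := 
          div_nonneg (hq.deriv_mul_nonneg hL hx) (abs_nonneg _)
      _ = x * (σ * q x) := by ring
  · rw [agmonDist_congr_abs hσ]
    exact agmonDistSet_le q hx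

theorem IsDegenerateCoeff.exists_isAgmonWeight (hL : 0 < L) (hq : IsDegenerateCoeff L q)
    (hA : A ⊆ Icc (-L) L) (hdist : 0 < Metric.infDist 0 A) :
    ∃ d > 0, ∃ D, IsAgmonWeight L q A d D := by
  obtain ⟨M, hM, hqM⟩ := hq.exists_abs_le
  have hsmooth : ContDiffOn ℝ ∞ (fun x => (L * M)⁻¹ * x * q x ^ 2) (Icc (-L) L) :=
    (contDiffOn_const.mul contDiffOn_id).mul (hq.smooth.pow 2)
  obtain ⟨d, hd, hle⟩ := exists_pos_forall_le_agmonDist hL.le hsmooth.continuousOn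
    (fun x hx hx0 => mul_ne_zero (mul_ne_zero (by positivity) hx0)
      (pow_ne_zero 2 (hq.ne_zero x hx hx0))) hA hdist
  refine ⟨d, hd, _, isAgmonWeight_integral hsmooth (fun x hx => ?_) (fun x _ => ?_) hA hle⟩
  · have hxL : |x| ≤ L := abs_le.2 (Ioo_subset_Icc_self hx)
    have hxM := hqM x (Ioo_subset_Icc_self hx)
    calc |(L * M)⁻¹ * x * q x ^ 2| = (L * M)⁻¹ * (|x| * |q x|) * |q x| := by
          rw [abs_mul, abs_mul, abs_of_pos (by positivity), abs_pow]; ring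
      _ ≤ (L * M)⁻¹ * (L * M) * |q x| := by gcongr
      _ = |q x| := by rw [inv_mul_cancel₀ (by positivity), one_mul]
  · calc 0 ≤ (L * M)⁻¹ * (x ^ 2 * q x ^ 2) := by positivity
      _ = x * ((L * M)⁻¹ * x * q x ^ 2) := by ring

theorem IsGrushinCoeff.isDegenerateCoeff {γ : ℕ} (hq : IsGrushinCoeff L γ q) (hγ : 1 ≤ γ) :
    IsDegenerateCoeff L q where
  smooth := hq.smooth
  zero := by simpa only [iteratedDeriv_zero] using hq.deriv_zero 0 hγ
  ne_zero := hq.ne_zero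

end AgmonWeight

end Grushin

theorem mainTheorem3_general (L : ℝ) (hL : 0 < L) (Y : Grushin.YDomain) (q r V : ℝ → ℝ)
    (hq : Grushin.IsDegenerateCoeff L q) (hr : Grushin.IsTransversalCoeff Y r)
    (hV : MemLp V ⊤ (volume.restrict (Ioo (-L) L)))
    (ωx : Set ℝ) (hω_meas : MeasurableSet ωx) (hω_sub : ωx ⊆ Ioo (-L) L)
    (hω_dist : 0 < Metric.infDist 0 ωx) (T : ℝ) (hT : 0 < T)
    (hTd : T * |deriv q 0| < Grushin.agmonDistSet q ωx) :
    ∃ f₀ ∈ Grushin.formDomain L Y q r,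
      ¬ Grushin.Steerable L Y q r V (ωx ×ˢ Y.carrier) T f₀ := by
  have hω_sub' := hω_sub.trans Ioo_subset_Icc_self
  by_cases hq' : deriv q 0 = 0
  · obtain ⟨d, hd, D, hD⟩ := hq.exists_isAgmonWeight hL hω_sub' hω_dist
    exact Grushin.exists_not_steerable_of_isAgmonWeight hL hT hq hr hV hD hω_meas hω_dist
      (by rwa [hq', abs_zero, mul_zero])
  · obtain ⟨D, hD⟩ := hq.exists_isAgmonWeight_agmonDistSet hL hq' hω_sub'
    exact Grushin.exists_not_steerable_of_isAgmonWeight hL hT hq hr hV hD hω_meas hω_dist hTd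

theorem mainTheorem3 (L : ℝ) (hL : 0 < L) (Y : Grushin.YDomain) (γ : ℕ) (hγ : 1 ≤ γ)
    (q r V : ℝ → ℝ) (hq : Grushin.IsGrushinCoeff L γ q) (hr : Grushin.IsTransversalCoeff Y r)
    (hV : MemLp V ⊤ (volume.restrict (Ioo (-L) L)))
    (ωx : Set ℝ) (hω_meas : MeasurableSet ωx) (hω_sub : ωx ⊆ Ioo (-L) L)
    (hω_dist : 0 < Metric.infDist 0 ωx) :
    (γ = 1 → ∀ T : ℝ, 0 < T → T < Grushin.agmonDistSet q ωx / deriv q 0 →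
      ∃ f₀ ∈ Grushin.formDomain L Y q r,
        ¬ Grushin.Steerable L Y q r V (ωx ×ˢ Y.carrier) T f₀) ∧
    (1 < γ → ∀ T : ℝ, 0 < T →
      ∃ f₀ ∈ Grushin.formDomain L Y q r,
        ¬ Grushin.Steerable L Y q r V (ωx ×ˢ Y.carrier) T f₀) := by
  have hdeg := hq.isDegenerateCoeff hγ
  have hnot_steerable := mainTheorem3_general L hL Y q r V hdeg hr hV ωx hω_meas hω_sub hω_dist
  constructor
  · rintro rfl T hT hTd
    have hpos : 0 < deriv q 0 := by simpa only [iteratedDeriv_one] using hq.deriv_pos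
    exact hnot_steerable T hT (by rwa [abs_of_pos hpos, ← lt_div_iff₀ hpos])
  · intro hγ' T hT
    have hzero : deriv q 0 = 0 := by simpa only [iteratedDeriv_one] using hq.deriv_zero 1 hγ'
    refine hnot_steerable T hT ?_
    rw [hzero, abs_zero, mul_zero]
    exact Grushin.agmonDistSet_pos hL.le hdeg.smooth.continuousOn hdeg.ne_zero
      (hω_sub.trans Ioo_subset_Icc_self) hω_dist
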